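/- Fix $M,L>0$, $k>\frac12$ and $\kappa$ with $-2^{-2/3}\frac{M^2}{2L}<\kappa<0$. For $\varepsilon>0$ let $U^\varepsilon$ be the gravitational potential and $E_0^\varepsilon$ the cut-off energy of the steady state of the radial Vlasov--Poisson system with central point mass $M$ and fixed squared angular momentum $L$ given by $$f^{\varepsilon}(r,w)=\varepsilon\,\bigl(E_0^\varepsilon-E^\varepsilon(r,w)\bigr)_+^k,\qquad E^\varepsilon(r,w)=\tfrac12w^2+\Psi^\varepsilon(r),\qquad \Psi^\varepsilon(r)=U^\varepsilon(r)-\frac Mr+\frac L{2r^2},$$ that is, $U^\varepsilon$ is continuous on $[0,\infty)$ and $$(U^\varepsilon)'(r)=\frac{4\pi}{r^2}\int_0^r s^2\rho^\varepsilon(s)\,ds\ \ (r>0),\qquad \rho^\varepsilon(r)=\frac{\pi}{r^2}\int_{\mathbb R}f^\varepsilon(r,w)\,dw,\qquad \lim_{r\to\infty}U^\varepsilon(r)=0,\qquad E_0^\varepsilon-U^\varepsilon(0)=\kappa .$$ For $\varepsilon=0$ set $U^0\equiv0$, $E_0^0=\kappa$, $\Psi^0(r)=-\frac Mr+\frac L{2r^2}$.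 For $\varepsilon\ge0$ let $E_{\min}^\varepsilon=\min_{r>0}\Psi^\varepsilon(r)$ and $I^\varepsilon=(E_{\min}^\varepsilon,E_0^\varepsilon)$. For $E_{\min}^\varepsilon<E<0$ let $r_-^\varepsilon(E)<r_+^\varepsilon(E)$ be the two solutions $r>0$ of $\Psi^\varepsilon(r)=E$, and define the period function $$T^\varepsilon(E)=2\int_{r_-^\varepsilon(E)}^{r_+^\varepsilon(E)}\frac{dr}{\sqrt{2E-2\Psi^\varepsilon(r)}}.$$ Let $T_{\min}^\varepsilon=\inf_{I^\varepsilon}T^\varepsilon$ and $T_{\max}^\varepsilon=\sup_{I^\varepsilon}T^\varepsilon$. In the limiting case, $E_{\min}^0=-\frac{M^2}{2L}$ and $T^0(E)=\frac{\pi M}{\sqrt2\,(-E)^{3/2}}$ for $E\in(E_{\min}^0,0)$. Then: (a) $E_{\min}^\varepsilon\to E_{\min}^0$ and $E_0^\varepsilon\to\kappa$ as $\varepsilon\to0$. (b) $T_{\min}^\varepsilon\to T_{\min}^0$ and $T_{\max}^\varepsilon\to T_{\max}^0$ as $\varepsilon\to0$. Moreover, there are constants $\varepsilon_0>0$ and $0<c\le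 C<\infty$ such that for all $0\le\varepsilon<\varepsilon_0$ the function $T^\varepsilon$ is $C^2$ on $I^\varepsilon$ and $$c\le (T^\varepsilon)^{(j)}(E)\le C,\qquad E\in I^\varepsilon,\ j\in\{0,1,2\}.$$ In particular, $T^\varepsilon$ is strictly increasing on $I^\varepsilon$ for $0\le\varepsilon<\varepsilon_0$. -/

import Mathlib

open Set Filter Topology MeasureTheory

namespace VP

noncomputable section

/-- Effective potential `Ψ(r) = U(r) - M/r + L/(2r²)`. -/
def effPot (M L : ℝ) (U : ℝ → ℝ) (r : ℝ) : ℝ :=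
  U r - M / r + L / (2 * r ^ 2)

/-- Particle energy `E(r,w) = w²/2 + Ψ(r)`. -/
def energy (M L : ℝ) (U : ℝ → ℝ) (r w : ℝ) : ℝ :=
  w ^ 2 / 2 + effPot M L U r

/-- Polytropic phase-space density `f(r,w) = ε (E₀ - E(r,w))₊ᵏ`. -/
def phaseDensity (M L k ε : ℝ) (U : ℝ → ℝ) (E₀ r w : ℝ) : ℝ :=
  ε * (max (E₀ - energy M L U r w) 0) ^ k

/-- Macroscopic mass density `ρ(r) = (π / r²) ∫ f(r,w) dw`. -/
def massDensity (M L k ε : ℝ) (U : ℝ → ℝ) (E₀ r : ℝ) : ℝ :=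
  Real.pi / r ^ 2 * ∫ w : ℝ, phaseDensity M L k ε U E₀ r w

/-- `(U, E₀)` is the polytropic steady state with parameters `k`, `κ`, `ε`: the gravitational
potential `U` on `[0,∞[` is the one generated by `f = ε (E₀ - E)₊ᵏ` through the radial Poisson
equation, it vanishes at infinity, and `E₀ - U(0) = κ`. -/
structure IsSteadyState (M L k κ ε : ℝ) (U : ℝ → ℝ) (E₀ : ℝ) : Prop where
  continuous_zero : ContinuousWithinAt U (Ici 0) 0
  poisson : ∀ r : ℝ, 0 < r →
    HasDerivAt U
      (4 * Real.pi / r ^ 2 * ∫ s in (0 : ℝ)..r, s ^ 2 * massDensity M L k ε U E₀ s) r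
  tendsto_zero : Tendsto U atTop (𝓝 0)
  kappa_eq : E₀ - U 0 = κ

/-- Minimal energy `E_min = min_{r > 0} Ψ(r)`. -/
def minEnergy (M L : ℝ) (U : ℝ → ℝ) : ℝ :=
  sInf (effPot M L U '' Ioi 0)

/-- Inner turning point `r₋(E)`: the smaller of the two solutions `r > 0` of `Ψ(r) = E`. -/
def rMinus (M L : ℝ) (U : ℝ → ℝ) (E : ℝ) : ℝ :=
  sInf {r : ℝ | 0 < r ∧ effPot M L U r = E}

/-- Outer turning point `r₊(E)`: the larger of the two solutions `r > 0` of `Ψ(r) = E`. -/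
def rPlus (M L : ℝ) (U : ℝ → ℝ) (E : ℝ) : ℝ :=
  sSup {r : ℝ | 0 < r ∧ effPot M L U r = E}

/-- Period function `T(E) = 2 ∫_{r₋(E)}^{r₊(E)} dr / √(2E - 2Ψ(r))`. -/
def period (M L : ℝ) (U : ℝ → ℝ) (E : ℝ) : ℝ :=
  2 * ∫ r in (rMinus M L U E)..(rPlus M L U E), 1 / Real.sqrt (2 * E - 2 * effPot M L U r)

/-- Action interval `I = ]E_min, E₀[`. -/
def actionInterval (M L : ℝ) (U : ℝ → ℝ) (E₀ : ℝ) : Set ℝ :=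
  Ioo (minEnergy M L U) E₀

/-- `T_min = inf_I T`. -/
def periodMin (M L : ℝ) (U : ℝ → ℝ) (E₀ : ℝ) : ℝ :=
  sInf (period M L U '' actionInterval M L U E₀)

/-- `T_max = sup_I T`. -/
def periodMax (M L : ℝ) (U : ℝ → ℝ) (E₀ : ℝ) : ℝ :=
  sSup (period M L U '' actionInterval M L U E₀)

end

end VP
namespace VP
/-- The velocity integral of the polytropic ansatz is a power law in `z = E₀ - Ψ(r)`. -/
theorem velocity_integral (k ε : ℝ) (hk : 1 / 2 < k) (hε : 0 ≤ ε) :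
    ∃ c : ℝ, 0 ≤ c ∧ ∀ z : ℝ,
      ∫ w : ℝ, ε * (max (z - w ^ 2 / 2) 0) ^ k = c * (max z 0) ^ (k + 1 / 2) := by
  refine ⟨ε * Real.sqrt 2 * ∫ u : ℝ, (max (1 - u ^ 2) 0) ^ k, ?_, ?_⟩
  · have : 0 ≤ ∫ u : ℝ, (max (1 - u ^ 2) 0) ^ k :=
      integral_nonneg fun u => Real.rpow_nonneg (le_max_right _ _) _
    positivity
  intro z
  rcases le_or_gt z 0 with hz | hz
  · have h1 : ∀ w : ℝ, ε * (max (z - w ^ 2 / 2) 0) ^ k = 0 := by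
      intro w
      rw [max_eq_right (by nlinarith [sq_nonneg w]), Real.zero_rpow (by linarith), mul_zero]
    simp only [h1, integral_zero]
    rw [max_eq_right hz, Real.zero_rpow (by linarith), mul_zero]
  · have ha : 0 < Real.sqrt (2 * z) := Real.sqrt_pos.mpr (by linarith)
    have h1 := Measure.integral_comp_mul_left
      (fun w : ℝ => ε * (max (z - w ^ 2 / 2) 0) ^ k) (Real.sqrt (2 * z))
    have h2 : ∀ u : ℝ, ε * (max (z - (Real.sqrt (2 * z) * u) ^ 2 / 2) 0) ^ k
        = (ε * z ^ k) * (max (1 - u ^ 2) 0) ^ k := by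
      intro u
      rw [mul_pow, Real.sq_sqrt (by linarith),
        show z - 2 * z * u ^ 2 / 2 = z * (1 - u ^ 2) by ring,
        show max (z * (1 - u ^ 2)) 0 = z * max (1 - u ^ 2) 0 by
          rw [mul_max_of_nonneg _ _ hz.le, mul_zero],
        Real.mul_rpow hz.le (le_max_right _ _)]
      ring
    simp only [h2] at h1
    rw [integral_const_mul, smul_eq_mul, abs_of_pos (inv_pos.mpr ha)] at h1
    have h3 : ∫ w : ℝ, ε * (max (z - w ^ 2 / 2) 0) ^ k
        = Real.sqrt (2 * z) * (ε * z ^ k * ∫ u : ℝ, (max (1 - u ^ 2) 0) ^ k) := by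
      rw [h1]; field_simp
    rw [h3, max_eq_left hz.le, Real.sqrt_mul (by norm_num), Real.rpow_add hz,
      ← Real.sqrt_eq_rpow]
    ring

theorem lipschitz_pow (c p B : ℝ) (hp : 1 ≤ p) :
    ∃ K : NNReal, LipschitzWith K (fun z : ℝ => c * (max (min z B) 0) ^ p) := by
  have h1 : ContDiff ℝ 1 (fun x : ℝ => c * x ^ p) :=
    contDiff_const.mul (Real.contDiff_rpow_const_of_le (by exact_mod_cast hp))
  obtain ⟨K, hK⟩ := (h1.locallyLipschitz.locallyLipschitzOn (s := Icc 0 (max B 0))).exists_lipschitzOnWith_of_compact isCompact_Icc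
  refine ⟨K * 1, ?_⟩
  have h2 : LipschitzWith 1 (fun z : ℝ => max (min z B) 0) :=
    (LipschitzWith.id.min_const B).max_const 0
  rw [← lipschitzOnWith_univ] at h2 ⊢
  refine LipschitzOnWith.comp (g := fun x : ℝ => c * x ^ p) hK h2 ?_
  intro z _
  exact ⟨le_max_right _ _, max_le_max (min_le_right _ _) le_rfl⟩

/-- Solvability, on a compact interval away from the origin, of the ODE system for `y = E₀ - U`
and the local mass `m`. -/
theorem exists_mass_profile (a b κ Q : ℝ) (ha : 0 < a) (hab : a ≤ b) (hQ : 0 ≤ Q) (h Γ : ℝ → ℝ)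
    (hh : ContinuousOn h (Icc a b)) (K : NNReal) (hΓ : LipschitzWith K Γ)
    (hΓ0 : ∀ z, 0 ≤ Γ z) (hΓQ : ∀ z, Γ z ≤ Q) :
    ∃ y m : ℝ → ℝ, y a = κ ∧ m a = 0 ∧
      (∀ t ∈ Icc a b, HasDerivWithinAt y (-m t / t ^ 2) (Icc a b) t) ∧
      (∀ t ∈ Icc a b, HasDerivWithinAt m (Γ (y t + h t)) (Icc a b) t) ∧
      ∀ t ∈ Icc a b, 0 ≤ m t := by
  set N : ℝ := Q * (b - a) with hN
  have hN0 : 0 ≤ N := mul_nonneg hQ (by linarith)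
  set cl : ℝ → ℝ := fun x => max (min x N) 0 with hcl
  have hclL : LipschitzWith 1 cl := (LipschitzWith.id.min_const N).max_const 0
  have hcl0 : ∀ x, 0 ≤ cl x := fun x => le_max_right _ _
  have hclN : ∀ x, cl x ≤ N := fun x => max_le (min_le_right _ _) hN0
  set f : ℝ → ℝ × ℝ → ℝ × ℝ := fun t x => (-cl x.2 / t ^ 2, Γ (x.1 + h t)) with hf
  set Lb : NNReal := Real.toNNReal (max (N / a ^ 2) Q) with hLb
  set A : NNReal := Lb * Real.toNNReal (b - a) with hA
  set Kc : NNReal := max (Real.toNNReal (1 / a ^ 2)) K with hKc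
  have hsq : ∀ t ∈ Icc a b, a ^ 2 ≤ t ^ 2 := fun t ht => by nlinarith [ht.1]
  have ha2 : 0 < a ^ 2 := by positivity
  have hpl : IsPicardLindelof f (⟨a, le_rfl, hab⟩ : Icc a b) ((κ, 0) : ℝ × ℝ) A 0 Lb Kc := by
    constructor
    · intro t ht
      apply LipschitzWith.lipschitzOnWith
      refine LipschitzWith.prodMk ?_ ?_
      · refine LipschitzWith.of_dist_le_mul fun x y => ?_
        have h1 : dist (cl x.2) (cl y.2) ≤ dist x y :=
          (hclL.dist_le_mul _ _).trans (by
            rw [NNReal.coe_one, one_mul]; exact le_max_right _ _)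
        have h2 : dist (-cl x.2 / t ^ 2) (-cl y.2 / t ^ 2) = (1 / t ^ 2) * dist (cl x.2) (cl y.2) := by
          rw [Real.dist_eq, Real.dist_eq,
            show -cl x.2 / t ^ 2 - -cl y.2 / t ^ 2 = -((1 / t ^ 2) * (cl x.2 - cl y.2)) by ring,
            abs_neg, abs_mul, abs_of_nonneg (by positivity)]
        rw [h2, Real.coe_toNNReal _ (by positivity)]
        exact mul_le_mul (one_div_le_one_div_of_le ha2 (hsq t ht)) h1 dist_nonneg (by positivity)
      · refine LipschitzWith.of_dist_le_mul fun x y => ?_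
        refine (hΓ.dist_le_mul _ _).trans (mul_le_mul_of_nonneg_left ?_ K.coe_nonneg)
        rw [dist_add_right]
        exact le_max_left _ _
    · intro x _
      refine ContinuousOn.prodMk ?_ ?_
      · refine ContinuousOn.div continuousOn_const (by fun_prop) fun t ht => ?_
        have := hsq t ht
        exact ne_of_gt (by linarith)
      · exact hΓ.continuous.comp_continuousOn (continuousOn_const.add hh)
    · intro t ht x _
      rw [hLb, Real.coe_toNNReal _ (le_max_of_le_right hQ)]
      refine max_le_max ?_ ?_
      · change |-cl x.2 / t ^ 2| ≤ _
        rw [abs_div, abs_neg, abs_of_nonneg (hcl0 _), abs_of_nonneg (by positivity)]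
        exact div_le_div₀ hN0 (hclN _) ha2 (hsq t ht)
      · change |Γ _| ≤ _
        rw [abs_of_nonneg (hΓ0 _)]
        exact hΓQ _
    · simp [hA, hab]
  obtain ⟨α, hα0, hα⟩ := hpl.exists_eq_forall_mem_Icc_hasDerivWithinAt₀
  have hα0' : α a = (κ, 0) := hα0
  have hy : ∀ t ∈ Icc a b, HasDerivWithinAt (fun t => (α t).1) (-cl (α t).2 / t ^ 2) (Icc a b) t :=
    fun t ht => (hα t ht).fst
  have hm : ∀ t ∈ Icc a b, HasDerivWithinAt (fun t => (α t).2) (Γ ((α t).1 + h t)) (Icc a b) t :=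
    fun t ht => (hα t ht).snd
  have hmc : ContinuousOn (fun t => (α t).2) (Icc a b) := fun t ht => (hm t ht).continuousWithinAt
  have hmd : ∀ t ∈ interior (Icc a b), HasDerivAt (fun t => (α t).2) (Γ ((α t).1 + h t)) t := by
    intro t ht
    rw [interior_Icc] at ht
    exact (hm t (Ioo_subset_Icc_self ht)).hasDerivAt (Icc_mem_nhds ht.1 ht.2)
  have hmono : MonotoneOn (fun t => (α t).2) (Icc a b) := by
    refine monotoneOn_of_deriv_nonneg (convex_Icc a b) hmc
      (fun t ht => (hmd t ht).differentiableAt.differentiableWithinAt) fun t ht => ?_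
    rw [(hmd t ht).deriv]
    exact hΓ0 _
  have hm0 : ∀ t ∈ Icc a b, 0 ≤ (α t).2 := fun t ht => by
    have := hmono (left_mem_Icc.mpr hab) ht ht.1
    simpa [hα0'] using this
  have hmN : ∀ t ∈ Icc a b, (α t).2 ≤ N := fun t ht => by
    have := (convex_Icc a b).image_sub_le_mul_sub_of_deriv_le hmc
      (fun t ht => (hmd t ht).differentiableAt.differentiableWithinAt)
      (C := Q) (fun t ht => by rw [(hmd t ht).deriv]; exact hΓQ _)
      a (left_mem_Icc.mpr hab) t ht ht.1
    simp only [hα0', sub_zero] at this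
    exact this.trans (mul_le_mul_of_nonneg_left (by linarith [ht.2]) hQ)
  refine ⟨fun t => (α t).1, fun t => (α t).2, by simp [hα0'], by simp [hα0'], fun t ht => ?_, hm, hm0⟩
  have h1 := hy t ht
  have h2 : cl (α t).2 = (α t).2 := by
    simp only [hcl]
    rw [min_eq_left (hmN t ht), max_eq_left (hm0 t ht)]
  rwa [h2] at h1

/-- A steady state exists for all admissible parameters. -/
theorem exists_isSteadyState (M L k κ ε : ℝ) (hM : 0 < M) (hL : 0 < L) (hk : 1 / 2 < k)
    (hκ : κ < 0) (hε : 0 ≤ ε) : ∃ (U : ℝ → ℝ) (E₀ : ℝ), IsSteadyState M L k κ ε U E₀ := by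
  obtain ⟨c, hc, hG⟩ := velocity_integral k ε hk hε
  set a : ℝ := L / (2 * M) with ha_def
  have ha : 0 < a := by positivity
  set b : ℝ := a + M / (-κ) with hb_def
  have hbM : 0 < M / (-κ) := div_pos hM (by linarith)
  have hab : a ≤ b := by linarith
  set h : ℝ → ℝ := fun t => M / t - L / (2 * t ^ 2) with hh_def
  have hh : ContinuousOn h (Icc a b) := by
    refine ContinuousOn.sub ?_ ?_
    · exact ContinuousOn.div continuousOn_const continuousOn_id
        fun t ht => ne_of_gt (lt_of_lt_of_le ha ht.1)
    · refine ContinuousOn.div continuousOn_const (by fun_prop) fun t ht => ?_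
      have : 0 < t := lt_of_lt_of_le ha ht.1
      positivity
  have hh_a : ∀ t, 0 < t → t ≤ a → h t ≤ 0 := by
    intro t ht hta
    have h1 : h t = (2 * M * t - L) / (2 * t ^ 2) := by
      simp only [hh_def]; field_simp
    rw [h1]
    refine div_nonpos_of_nonpos_of_nonneg ?_ (by positivity)
    rw [ha_def, le_div_iff₀ (by positivity)] at hta
    linarith
  have hh_M : ∀ t, 0 < t → h t ≤ M / t := by
    intro t ht
    have : 0 ≤ L / (2 * t ^ 2) := by positivity
    simp only [hh_def]; linarith
  have hh_b : ∀ t, b ≤ t → κ + h t ≤ 0 := by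
    intro t ht
    have ht0 : 0 < t := by linarith
    have h1 : M / t ≤ -κ := by
      rw [div_le_iff₀ ht0]
      have : M / (-κ) ≤ t := by linarith
      rw [div_le_iff₀ (by linarith)] at this
      linarith
    linarith [hh_M t ht0]
  set p : ℝ := k + 1 / 2 with hp
  set B : ℝ := M / a with hB
  set d : ℝ := 4 * Real.pi ^ 2 * c with hd
  have hd0 : 0 ≤ d := by positivity
  set Γ : ℝ → ℝ := fun z => d * (max (min z B) 0) ^ p with hΓ_def
  obtain ⟨K, hK⟩ := lipschitz_pow d p B (by linarith)
  have hB0 : 0 < B := by positivity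
  have hΓ0 : ∀ z, 0 ≤ Γ z := fun z => mul_nonneg hd0 (Real.rpow_nonneg (le_max_right _ _) _)
  have hΓQ : ∀ z, Γ z ≤ d * B ^ p := fun z => mul_le_mul_of_nonneg_left
    (Real.rpow_le_rpow (le_max_right _ _) (max_le (min_le_right _ _) hB0.le) (by linarith)) hd0
  have hΓz : ∀ z, z ≤ 0 → Γ z = 0 := fun z hz => by
    simp only [hΓ_def]
    rw [max_eq_right ((min_le_left _ _).trans hz), Real.zero_rpow (by linarith), mul_zero]
  obtain ⟨y, m, hya, hma, hy, hm, hm0⟩ := exists_mass_profile a b κ (d * B ^ p) ha hab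
    (mul_nonneg hd0 (Real.rpow_nonneg hB0.le _)) h Γ hh K hK hΓ0 hΓQ
  have hyc : ContinuousOn y (Icc a b) := fun t ht => (hy t ht).continuousWithinAt
  have hmc : ContinuousOn m (Icc a b) := fun t ht => (hm t ht).continuousWithinAt
  set P : ℝ → ℝ := fun r => max a (min r b) with hP
  have hPm : ∀ r, P r ∈ Icc a b := fun r => ⟨le_max_left _ _, max_le hab (min_le_right _ _)⟩
  have hPc : Continuous P := by fun_prop
  have hPin : ∀ r ∈ Icc a b, P r = r := fun r hr => by
    simp only [hP]; rw [min_eq_left hr.2, max_eq_right hr.1]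
  have hPa : ∀ r, r ≤ a → P r = a := fun r hr => by
    simp only [hP]; rw [min_eq_left (hr.trans hab), max_eq_left hr]
  have hPb : ∀ r, b ≤ r → P r = b := fun r hr => by
    simp only [hP]; rw [min_eq_right hr, max_eq_right hab]
  set F : ℝ → ℝ := fun r => Γ (y (P r) + h (P r)) with hF
  have hFc : Continuous F := hK.continuous.comp
    ((hyc.comp_continuous hPc hPm).add (hh.comp_continuous hPc hPm))
  have hF0 : ∀ r, 0 ≤ F r := fun r => hΓ0 _
  have hFa : ∀ r, r ≤ a → F r = 0 := fun r hr => by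
    simp only [hF]
    rw [hPa r hr, hya]
    exact hΓz _ (by linarith [hh_a a ha le_rfl])
  set mm : ℝ → ℝ := fun r => ∫ s in (0 : ℝ)..r, F s with hmm
  have hmmd : ∀ r, HasDerivAt mm (F r) r := fun r =>
    intervalIntegral.integral_hasDerivAt_right (hFc.intervalIntegrable _ _)
      (hFc.stronglyMeasurableAtFilter _ _) hFc.continuousAt
  have hmmc : Continuous mm := continuous_iff_continuousAt.mpr fun r => (hmmd r).continuousAt
  have hmma : ∀ r, r ≤ a → mm r = 0 := fun r hr => by
    simp only [hmm]
    rw [intervalIntegral.integral_congr (g := fun _ => (0 : ℝ)) fun s hs => hFa s ?_]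
    · simp
    · exact (hs.2).trans (sup_le ha.le hr)
  have hmm_m : ∀ r ∈ Icc a b, mm r = m r := by
    intro r hr
    have h1 := intervalIntegral.integral_eq_sub_of_hasDerivAt_of_le (f := m) (f' := F) hr.1
      (hmc.mono (Icc_subset_Icc le_rfl hr.2))
      (fun t ht => by
        have ht' : t ∈ Icc a b := ⟨ht.1.le, ht.2.le.trans hr.2⟩
        have := (hm t ht').hasDerivAt (Icc_mem_nhds ht.1 (lt_of_lt_of_le ht.2 hr.2))
        simpa only [hF, hPin t ht'] using this)
      (hFc.intervalIntegrable _ _)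
    have h2 : mm r = mm a + ∫ s in a..r, F s :=
      (intervalIntegral.integral_add_adjacent_intervals (hFc.intervalIntegrable _ _)
        (hFc.intervalIntegrable _ _)).symm
    rw [h2, h1, hmma a le_rfl, hma]; ring
  have hmm_nonneg : ∀ r, 0 ≤ r → 0 ≤ mm r := fun r hr =>
    intervalIntegral.integral_nonneg hr fun s _ => hF0 s
  set q : ℝ → ℝ := fun r => mm r / (max r a) ^ 2 with hq
  have hqc : Continuous q := by
    refine hmmc.div (by fun_prop) fun r => ?_
    have : 0 < max r a := lt_of_lt_of_le ha (le_max_right _ _)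
    positivity
  have hq0 : ∀ r, 0 ≤ r → 0 ≤ q r := fun r hr => div_nonneg (hmm_nonneg r hr) (sq_nonneg _)
  have hqr : ∀ r, 0 < r → q r = mm r / r ^ 2 := by
    intro r hr
    rcases le_total r a with hra | hra
    · simp only [hq, hmma r hra, zero_div]
    · simp only [hq, max_eq_left hra]
  have hqa : ∀ r, r ≤ a → q r = 0 := fun r hr => by simp only [hq, hmma r hr, zero_div]
  set yy : ℝ → ℝ := fun r => κ - ∫ s in (0 : ℝ)..r, q s with hyy
  have hyyd : ∀ r, HasDerivAt yy (-q r) r := fun r => by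
    have := intervalIntegral.integral_hasDerivAt_right (hqc.intervalIntegrable 0 r)
      (hqc.stronglyMeasurableAtFilter _ _) hqc.continuousAt
    simpa using this.const_sub κ
  have hyyc : Continuous yy := continuous_iff_continuousAt.mpr fun r => (hyyd r).continuousAt
  have hyyle : ∀ r, 0 ≤ r → yy r ≤ κ := fun r hr => by
    have : 0 ≤ ∫ s in (0 : ℝ)..r, q s :=
      intervalIntegral.integral_nonneg hr fun s hs => hq0 s hs.1
    simp only [hyy]; linarith
  have hyya : yy a = κ := by
    simp only [hyy]
    rw [intervalIntegral.integral_congr (g := fun _ => (0 : ℝ)) fun s hs => hqa s ?_]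
    · simp
    · exact (hs.2).trans (sup_le ha.le le_rfl)
  have hyy_y : ∀ r ∈ Icc a b, yy r = y r := by
    intro r hr
    have h1 := intervalIntegral.integral_eq_sub_of_hasDerivAt_of_le (f := y)
      (f' := fun s => -q s) hr.1 (hyc.mono (Icc_subset_Icc le_rfl hr.2))
      (fun t ht => by
        have ht' : t ∈ Icc a b := ⟨ht.1.le, ht.2.le.trans hr.2⟩
        have := (hy t ht').hasDerivAt (Icc_mem_nhds ht.1 (lt_of_lt_of_le ht.2 hr.2))
        rw [hqr t (ha.trans ht.1), hmm_m t ht', ← neg_div]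
        exact this)
      (hqc.neg.intervalIntegrable _ _)
    have h2 := intervalIntegral.integral_eq_sub_of_hasDerivAt (f := yy) (f' := fun s => -q s)
      (a := a) (b := r) (fun t _ => hyyd t) (hqc.neg.intervalIntegrable _ _)
    rw [h1] at h2
    linarith
  have hFG : ∀ s, 0 < s → F s = 4 * Real.pi ^ 2 * (c * (max (yy s + h s) 0) ^ p) := by
    intro s hs
    have hzero : ∀ z : ℝ, z ≤ 0 → c * (max z 0) ^ p = 0 := fun z hz => by
      rw [max_eq_right hz, Real.zero_rpow (by linarith), mul_zero]
    rcases le_total s a with hsa | hsa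
    · rw [hFa s hsa, hzero _ (by linarith [hyyle s hs.le, hh_a s hs hsa]), mul_zero]
    rcases le_total s b with hsb | hsb
    · have hs' : s ∈ Icc a b := ⟨hsa, hsb⟩
      have h1 : yy s + h s ≤ B := by
        have : M / s ≤ M / a := div_le_div_of_nonneg_left hM.le ha hsa
        linarith [hyyle s hs.le, hh_M s hs]
      simp only [hF, hΓ_def]
      rw [hPin s hs', ← hyy_y s hs', min_eq_left h1, hd]
      ring
    · have hb0 : (0 : ℝ) ≤ b := by linarith
      have h1 : y b + h b ≤ 0 := by
        rw [← hyy_y b ⟨hab, le_rfl⟩]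
        linarith [hyyle b hb0, hh_b b le_rfl]
      rw [hzero _ (by linarith [hyyle s hs.le, hh_b s hsb]), mul_zero]
      simp only [hF]
      rw [hPb s hsb]
      exact hΓz _ h1
  have hFb : ∀ s, b ≤ s → F s = 0 := fun s hs => by
    have hs0 : 0 < s := by linarith
    rw [hFG s hs0, max_eq_right (by linarith [hyyle s hs0.le, hh_b s hs]),
      Real.zero_rpow (by linarith), mul_zero, mul_zero]
  have hmmb : ∀ r, b ≤ r → mm r = mm b := fun r hr => by
    have h2 : mm r = mm b + ∫ s in b..r, F s :=
      (intervalIntegral.integral_add_adjacent_intervals (hFc.intervalIntegrable _ _)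
        (hFc.intervalIntegrable _ _)).symm
    rw [h2, intervalIntegral.integral_congr (g := fun _ => (0 : ℝ)) fun s hs => hFb s ?_]
    · simp
    · rw [uIcc_of_le hr] at hs
      exact hs.1
  have hb0 : 0 < b := by linarith
  have hyyb : ∀ r, b ≤ r → yy r = yy b - mm b / b + mm b / r := by
    intro r hr
    have hd1 : ∀ t ∈ uIcc b r, HasDerivAt (fun t => yy t - mm b * t⁻¹) 0 t := by
      intro t ht
      rw [uIcc_of_le hr] at ht
      have ht0 : 0 < t := lt_of_lt_of_le hb0 ht.1
      have := (hyyd t).sub ((hasDerivAt_inv ht0.ne').const_mul (mm b))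
      refine this.congr_deriv ?_
      rw [hqr t ht0, hmmb t ht.1]
      field_simp
      ring
    have h2 := intervalIntegral.integral_eq_sub_of_hasDerivAt hd1
      (by simp)
    simp only [intervalIntegral.integral_zero] at h2
    rw [div_eq_mul_inv, div_eq_mul_inv]
    linarith
  refine ⟨fun r => (yy b - mm b / b) - yy r, yy b - mm b / b, ?_, ?_, ?_, ?_⟩
  · exact (continuous_const.sub hyyc).continuousWithinAt
  · intro r hr
    have h1 := (hyyd r).const_sub (yy b - mm b / b)
    rw [neg_neg, hqr r hr] at h1
    refine h1.congr_deriv ?_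
    rw [div_mul_eq_mul_div]
    congr 1
    symm
    rw [show mm r = ∫ s in (0 : ℝ)..r, F s from rfl]
    rw [← intervalIntegral.integral_const_mul]
    refine intervalIntegral.integral_congr_ae (ae_of_all _ fun s hs => ?_)
    rw [uIoc_of_le hr.le] at hs
    have hs0 : 0 < s := hs.1
    rw [hFG s hs0, ← hG]
    simp only [massDensity, phaseDensity, energy, effPot, hh_def]
    have h2 : ∀ w : ℝ, (yy b - mm b / b) - (w ^ 2 / 2 + ((yy b - mm b / b) - yy s - M / s
        + L / (2 * s ^ 2))) = yy s + (M / s - L / (2 * s ^ 2)) - w ^ 2 / 2 := fun w => by ring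
    simp only [h2]
    field_simp
  · have h1 : Tendsto (fun r : ℝ => -(mm b / r)) atTop (𝓝 (-0)) :=
      (tendsto_const_nhds.div_atTop tendsto_id).neg
    rw [neg_zero] at h1
    refine h1.congr' ?_
    filter_upwards [eventually_ge_atTop b] with r hr
    rw [hyyb r hr]; ring
  · simp [hyy]
end VP

/-! In the inverse radius u = 1/r the Kepler potential is the parabola L u²/2 - M u, and for ε > 0
the shifted potential P(u) = Ψ(1/u) - U(0) satisfies P'' = L + δ u⁻² (κ - P)₊^p, with p = k + 1/2 >
1 and δ a multiple of ε. So P is strictly convex, and P(x(s)) = Pm + s²/2, s ∈ ]-S, S[, charts all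
radii reached below the cut-off energy. Since P'(x) x' = s, the derivative of P'(x(s))² is 2 s
P''(x(s)); hence P'(x(s))² = s² (L + δ W(s)), where W averages x⁻² gap^p over the dilates t s, 0 ≤ t
≤ 1, and gap = (S² - s²)/2. Thus x' = (L + δ W)^(-1/2), which is regular even at the bottom s = 0 of
the well (`KeplerProfile.exists_chart`).

With A = √(2(E - E_min)) and r = 1/x(A sin θ) the period becomes T = 2 ∫ f(A sin θ) dθ over [-π/2,
π/2], where f = x'/x² (`EnergyChart.period_eq`). Differentiating in E and integrating by parts in θ
gives T' = 2 ∫ cos²θ f'' and T'' = (2/3) ∫ cos⁴θ f'''' (`hasDerivAt_cosIntegral_sqrt`). For δ = 0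
the chart is affine, and f'' = 6 x'³/x⁴ and f'''' = 120 x'⁵/x⁶ are bounded and bounded away from 0.

For δ > 0 the obstacle is that gap^p may be little better than C¹ at s = ±S: its derivative of order
l is only O(gap^(-(l-1))). Averaging over dilations improves this to gap^(-⌊l/2⌋) for l ≤ 4
(`Tame.average`), a rate stable under products and inverses and hence inherited by x. So f'' and
f'''' differ from the monomials above by δ O(gap⁻¹) and δ O(gap⁻²), and the weights cos² and cos⁴
absorb exactly these singularities (`cosIntegral_bounds`). This puts T, T' and T'' between c - Kδ
and C, uniformly in the family (`ChartFamily.exists_period_bounds`).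

For the extrema, periods at equal height above the respective minimum differ from the Kepler ones by
O(ε) (`ChartFamily.exists_period_comparison`), while the interval of heights lies in the limiting
one and converges to it. -/

namespace VP

/-! ### Integrals depending on a dilation parameter -/

theorem mul_mem_Ioo_of_abs_le_one {S s t : ℝ} (ht : |t| ≤ 1) (hs : s ∈ Ioo (-S) S) :
    t * s ∈ Ioo (-S) S := by
  have h1 : |s| < S := abs_lt.mpr hs
  have h2 : |t * s| < S := by
    rw [abs_mul]
    exact (mul_le_of_le_one_left (abs_nonneg s) ht).trans_lt h1
  exact abs_lt.mp h2

theorem exists_abs_lt_lt {S s : ℝ} (hs : s ∈ Ioo (-S) S) :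
    ∃ S₁, S₁ < S ∧ s ∈ Ioo (-S₁) S₁ := by
  obtain ⟨S₁, h1, h2⟩ := exists_between (abs_lt.mpr hs)
  exact ⟨S₁, h2, abs_lt.mp h1⟩

theorem continuousOn_mul_comp_mul {S a b : ℝ} {f φ ψ : ℝ → ℝ} (hφ : Continuous φ)
    (hψ : Continuous ψ) (hφ1 : ∀ t ∈ uIcc a b, |φ t| ≤ 1) (hf : ContinuousOn f (Ioo (-S) S))
    {s : ℝ} (hs : s ∈ Ioo (-S) S) :
    ContinuousOn (fun t => ψ t * f (φ t * s)) (uIcc a b) :=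
  hψ.continuousOn.mul (hf.comp (by fun_prop) fun t ht => mul_mem_Ioo_of_abs_le_one (hφ1 t ht) hs)

theorem exists_bound_comp_mul {S : ℝ} {f : ℝ → ℝ} (hf : ContinuousOn f (Ioo (-S) S)) {S₁ : ℝ}
    (hS : S₁ < S) : ∃ K, ∀ s ∈ Ioo (-S₁) S₁, |f s| ≤ K := by
  obtain ⟨K, hK⟩ := isCompact_Icc.exists_bound_of_continuousOn
    (hf.mono (Icc_subset_Ioo (neg_lt_neg hS) hS) : ContinuousOn f (Icc (-S₁) S₁))
  exact ⟨K, fun s hs => hK s (Ioo_subset_Icc_self hs)⟩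

/-- Needed twice: with φ = id, ψ = tᵐ on [0, 1] for averages, and with φ = sin, ψ = cosⁿ for the
period. Since `f` may blow up at ±S, domination is done on a smaller symmetric interval, which
contractions preserve. -/
theorem continuousOn_integral_comp_mul {S a b : ℝ} {f φ ψ : ℝ → ℝ} (hφ : Continuous φ)
    (hψ : Continuous ψ) (hφ1 : ∀ t ∈ uIcc a b, |φ t| ≤ 1) (hf : ContinuousOn f (Ioo (-S) S)) :
    ContinuousOn (fun s => ∫ t in a..b, ψ t * f (φ t * s)) (Ioo (-S) S) := by
  intro s hs
  refine ContinuousAt.continuousWithinAt ?_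
  obtain ⟨S₁, hS₁, hs₁⟩ := exists_abs_lt_lt hs
  obtain ⟨K, hK⟩ := exists_bound_comp_mul hf hS₁
  have hsub : Ioo (-S₁) S₁ ⊆ Ioo (-S) S := Ioo_subset_Ioo (neg_le_neg hS₁.le) hS₁.le
  refine intervalIntegral.continuousAt_of_dominated_interval (bound := fun t => |ψ t| * K)
    ?_ ?_ ((hψ.abs.mul continuous_const).intervalIntegrable _ _) ?_
  · filter_upwards [isOpen_Ioo.mem_nhds hs₁] with y hy
    exact ((continuousOn_mul_comp_mul hφ hψ hφ1 hf (hsub hy)).mono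
      uIoc_subset_uIcc).aestronglyMeasurable measurableSet_uIoc
  · filter_upwards [isOpen_Ioo.mem_nhds hs₁] with y hy
    refine ae_of_all _ fun t ht => ?_
    rw [Real.norm_eq_abs, abs_mul]
    exact mul_le_mul_of_nonneg_left
      (hK _ (mul_mem_Ioo_of_abs_le_one (hφ1 t (uIoc_subset_uIcc ht)) hy)) (abs_nonneg _)
  · refine ae_of_all _ fun t ht => ?_
    have h1 := hf.continuousAt
      (isOpen_Ioo.mem_nhds (mul_mem_Ioo_of_abs_le_one (hφ1 t (uIoc_subset_uIcc ht)) hs))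
    exact continuousAt_const.mul
      (ContinuousAt.comp (f := fun y => φ t * y) h1 (by fun_prop))

theorem hasDerivAt_integral_comp_mul {S a b : ℝ} {f f' φ ψ : ℝ → ℝ} (hφ : Continuous φ)
    (hψ : Continuous ψ) (hφ1 : ∀ t ∈ uIcc a b, |φ t| ≤ 1)
    (hf : ∀ s ∈ Ioo (-S) S, HasDerivAt f (f' s) s) (hf' : ContinuousOn f' (Ioo (-S) S)) {s : ℝ}
    (hs : s ∈ Ioo (-S) S) :
    HasDerivAt (fun s => ∫ t in a..b, ψ t * f (φ t * s))
      (∫ t in a..b, ψ t * φ t * f' (φ t * s)) s := by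
  have hfc : ContinuousOn f (Ioo (-S) S) := fun s hs => (hf s hs).continuousAt.continuousWithinAt
  obtain ⟨S₁, hS₁, hs₁⟩ := exists_abs_lt_lt hs
  obtain ⟨K, hK⟩ := exists_bound_comp_mul hf' hS₁
  have hsub : Ioo (-S₁) S₁ ⊆ Ioo (-S) S := Ioo_subset_Ioo (neg_le_neg hS₁.le) hS₁.le
  refine (intervalIntegral.hasDerivAt_integral_of_dominated_loc_of_deriv_le
    (bound := fun t => |ψ t * φ t| * K) (F' := fun s t => ψ t * φ t * f' (φ t * s))
    (isOpen_Ioo.mem_nhds hs₁) ?_ ?_ ?_ ?_ ?_ ?_).2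
  · filter_upwards [isOpen_Ioo.mem_nhds hs₁] with y hy
    exact ((continuousOn_mul_comp_mul hφ hψ hφ1 hfc (hsub hy)).mono
      uIoc_subset_uIcc).aestronglyMeasurable measurableSet_uIoc
  · exact (continuousOn_mul_comp_mul hφ hψ hφ1 hfc hs).intervalIntegrable
  · exact ((continuousOn_mul_comp_mul hφ (hψ.mul hφ) hφ1 hf' hs).mono
      uIoc_subset_uIcc).aestronglyMeasurable measurableSet_uIoc
  · refine ae_of_all _ fun t ht y hy => ?_
    rw [Real.norm_eq_abs, abs_mul]
    exact mul_le_mul_of_nonneg_left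
      (hK _ (mul_mem_Ioo_of_abs_le_one (hφ1 t (uIoc_subset_uIcc ht)) hy)) (abs_nonneg _)
  · exact ((hψ.mul hφ).abs.mul continuous_const).intervalIntegrable _ _
  · refine ae_of_all _ fun t ht y hy => ?_
    have h1 := hf _ (mul_mem_Ioo_of_abs_le_one (hφ1 t (uIoc_subset_uIcc ht)) (hsub hy))
    have h2 := (h1.comp y ((hasDerivAt_id y).const_mul (φ t))).const_mul (ψ t)
    refine h2.congr_deriv ?_
    ring

/-! ### Families of functions with weighted bounds on their derivatives -/

/-- The energy gap between the parameter `s` and the end point `S`. -/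
noncomputable def gap (S s : ℝ) : ℝ := (S ^ 2 - s ^ 2) / 2

theorem gap_pos {S s : ℝ} (hs : s ∈ Ioo (-S) S) : 0 < gap S s := by
  unfold gap; nlinarith [hs.1, hs.2]

theorem gap_le {S s G : ℝ} (hG : S ^ 2 ≤ G) : gap S s ≤ G := by
  unfold gap; nlinarith [sq_nonneg s, sq_nonneg S]

theorem hasDerivAt_gap (S s : ℝ) : HasDerivAt (gap S) (-s) s := by
  have := ((hasDerivAt_pow 2 s).const_sub (S ^ 2)).div_const 2
  refine this.congr_deriv ?_
  push_cast; ring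

/-- `f i = O(gap ^ (-e))`, uniformly in the index. -/
def GapBound {ι : Type*} (S : ι → ℝ) (e : ℕ) (f : ι → ℝ → ℝ) : Prop :=
  ∃ K, 0 ≤ K ∧ ∀ i, ∀ s ∈ Ioo (-S i) (S i), |f i s| * gap (S i) s ^ e ≤ K

/-- `f i` has `n` continuous derivatives on `]-S i, S i[`, and the derivative of order `j ≤ n` is
`O(gap ^ (-e (l + j)))`, uniformly in the index. -/
def Tame {ι : Type*} (S : ι → ℝ) (e : ℕ → ℕ) : ℕ → ℕ → (ι → ℝ → ℝ) → Prop
  | 0, l, f => GapBound S (e l) f ∧ ∀ i, ContinuousOn (f i) (Ioo (-S i) (S i))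
  | n + 1, l, f => GapBound S (e l) f ∧
      ∃ f' : ι → ℝ → ℝ, (∀ i, ∀ s ∈ Ioo (-S i) (S i), HasDerivAt (f i) (f' i s) s) ∧
        Tame S e n (l + 1) f'

variable {ι : Type*} {S : ι → ℝ} {e : ℕ → ℕ} {n l : ℕ} {f g : ι → ℝ → ℝ} {G : ℝ}

theorem Tame.gapBound (h : Tame S e n l f) : GapBound S (e l) f := by
  cases n <;> exact h.1

theorem Tame.continuousOn (h : Tame S e n l f) (i : ι) : ContinuousOn (f i) (Ioo (-S i) (S i)) := by
  cases n with
  | zero => exact h.2 i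
  | succ n =>
    obtain ⟨_, f', h1, _⟩ := h
    exact fun s hs => (h1 i s hs).continuousAt.continuousWithinAt

theorem Tame.of_succ (h : Tame S e (n + 1) l f) : Tame S e n l f := by
  induction n generalizing l f with
  | zero => exact ⟨h.gapBound, h.continuousOn⟩
  | succ n ih =>
    obtain ⟨h0, f', h1, h2⟩ := h
    exact ⟨h0, f', h1, ih h2⟩

theorem Tame.of_le {m : ℕ} (h : Tame S e n l f) (hm : m ≤ n) : Tame S e m l f := by
  induction n, hm using Nat.le_induction with
  | base => exact h
  | succ n _ ih => exact ih h.of_succ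

/-- Gaps are at most `G`, so additional powers of the gap cost only a constant. -/
theorem GapBound.mono {a b : ℕ} (hG : ∀ i, S i ^ 2 ≤ G) (h : GapBound S a f) (hab : a ≤ b) :
    GapBound S b f := by
  obtain ⟨K, hK0, hK⟩ := h
  refine ⟨K * (max G 1) ^ (b - a), by positivity, fun i s hs => ?_⟩
  have h1 : gap (S i) s ^ b = gap (S i) s ^ a * gap (S i) s ^ (b - a) := by
    rw [← pow_add]; congr 1; omega
  rw [h1, ← mul_assoc]
  have h2 := gap_pos hs
  exact mul_le_mul (hK i s hs)
    (pow_le_pow_left₀ h2.le ((gap_le (hG i)).trans (le_max_left _ _)) _) (by positivity) hK0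

theorem Tame.weaken {e' : ℕ → ℕ} {l' : ℕ} (hG : ∀ i, S i ^ 2 ≤ G) (h : Tame S e n l f)
    (he : ∀ j ≤ n, e (l + j) ≤ e' (l' + j)) : Tame S e' n l' f := by
  induction n generalizing l l' f with
  | zero => exact ⟨h.1.mono hG (he 0 le_rfl), h.2⟩
  | succ n ih =>
    obtain ⟨h0, f', h1, h2⟩ := h
    refine ⟨h0.mono hG (he 0 (Nat.zero_le _)), f', h1, ih h2 fun j hj => ?_⟩
    have := he (j + 1) (by omega)
    rwa [show l + (j + 1) = l + 1 + j by ring, show l' + (j + 1) = l' + 1 + j by ring] at this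

theorem Tame.congr (h : Tame S e n l f) (hfg : ∀ i, ∀ s ∈ Ioo (-S i) (S i), g i s = f i s) :
    Tame S e n l g := by
  have hb : GapBound S (e l) g := by
    obtain ⟨K, hK0, hK⟩ := h.gapBound
    exact ⟨K, hK0, fun i s hs => by rw [hfg i s hs]; exact hK i s hs⟩
  cases n with
  | zero => exact ⟨hb, fun i => (h.2 i).congr (hfg i)⟩
  | succ n =>
    obtain ⟨_, f', h1, h2⟩ := h
    exact ⟨hb, f', fun i s hs => (h1 i s hs).congr_of_eventuallyEq
      (eventuallyEq_of_mem (isOpen_Ioo.mem_nhds hs) (hfg i)), h2⟩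

theorem GapBound.of_bounded {K : ℝ} (h : ∀ i, ∀ s ∈ Ioo (-S i) (S i), |f i s| ≤ K) :
    GapBound S 0 f :=
  ⟨max K 0, le_max_right _ _, fun i s hs => by simpa using Or.inl (h i s hs)⟩

theorem GapBound.add {a : ℕ} (hf : GapBound S a f) (hg : GapBound S a g) :
    GapBound S a (fun i s => f i s + g i s) := by
  obtain ⟨K, hK0, hK⟩ := hf
  obtain ⟨K', hK0', hK'⟩ := hg
  refine ⟨K + K', by positivity, fun i s hs => ?_⟩
  have h2 := gap_pos hs
  calc |f i s + g i s| * gap (S i) s ^ a ≤ (|f i s| + |g i s|) * gap (S i) s ^ a :=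
        mul_le_mul_of_nonneg_right (abs_add_le _ _) (by positivity)
    _ ≤ K + K' := by rw [add_mul]; exact add_le_add (hK i s hs) (hK' i s hs)

theorem GapBound.mul {a b : ℕ} (hf : GapBound S a f) (hg : GapBound S b g) :
    GapBound S (a + b) (fun i s => f i s * g i s) := by
  obtain ⟨K, hK0, hK⟩ := hf
  obtain ⟨K', hK0', hK'⟩ := hg
  refine ⟨K * K', by positivity, fun i s hs => ?_⟩
  have h2 := gap_pos hs
  rw [abs_mul, pow_add, show |f i s| * |g i s| * (gap (S i) s ^ a * gap (S i) s ^ b)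
    = (|f i s| * gap (S i) s ^ a) * (|g i s| * gap (S i) s ^ b) by ring]
  exact mul_le_mul (hK i s hs) (hK' i s hs) (by positivity) hK0

theorem Tame.add (hf : Tame S e n l f) (hg : Tame S e n l g) :
    Tame S e n l (fun i s => f i s + g i s) := by
  induction n generalizing l f g with
  | zero => exact ⟨hf.1.add hg.1, fun i => (hf.2 i).add (hg.2 i)⟩
  | succ n ih =>
    obtain ⟨h0, f', h1, h2⟩ := hf
    obtain ⟨k0, g', k1, k2⟩ := hg
    exact ⟨h0.add k0, _, fun i s hs => (h1 i s hs).add (k1 i s hs), ih h2 k2⟩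

/-- Superadditivity of the exponents is what the product rule needs. It holds for both rates in use,
`l - 1` (truncated) and `l / 2`. -/
theorem Tame.mul {m : ℕ} (hG : ∀ i, S i ^ 2 ≤ G) (he : ∀ a b, e a + e b ≤ e (a + b))
    (hf : Tame S e n l f) (hg : Tame S e n m g) :
    Tame S e n (l + m) (fun i s => f i s * g i s) := by
  induction n generalizing l m f g with
  | zero => exact ⟨(hf.1.mul hg.1).mono hG (he _ _), fun i => (hf.2 i).mul (hg.2 i)⟩
  | succ n ih =>
    have hf' := hf.of_succ
    have hg' := hg.of_succ
    obtain ⟨h0, f', h1, h2⟩ := hf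
    obtain ⟨k0, g', k1, k2⟩ := hg
    refine ⟨(h0.mul k0).mono hG (he _ _), _, fun i s hs => (h1 i s hs).mul (k1 i s hs), ?_⟩
    have a1 := ih h2 hg'
    have a2 := ih hf' k2
    rw [show l + 1 + m = l + m + 1 by ring] at a1
    exact a1.add a2

theorem Tame.const {c : ι → ℝ} {K : ℝ} (hc : ∀ i, |c i| ≤ K) (hG : ∀ i, S i ^ 2 ≤ G) :
    Tame S e n l (fun i _ => c i) := by
  have hb : ∀ (l : ℕ) {c : ι → ℝ} {K : ℝ}, (∀ i, |c i| ≤ K) → GapBound S (e l) (fun i _ => c i) :=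
    fun l c K hc => (GapBound.of_bounded fun i _ _ => hc i).mono hG (Nat.zero_le _)
  induction n generalizing l c K with
  | zero => exact ⟨hb l hc, fun i => continuousOn_const⟩
  | succ n ih =>
    exact ⟨hb l hc, fun _ _ => 0, fun i s _ => hasDerivAt_const s (c i),
      ih (c := fun _ => 0) (K := 0) (by simp)⟩

theorem Tame.const_mul {c : ι → ℝ} {K : ℝ} (hc : ∀ i, |c i| ≤ K)
    (hf : Tame S e n l f) : Tame S e n l (fun i s => c i * f i s) := by
  have hb : ∀ (l : ℕ) (f : ι → ℝ → ℝ), GapBound S (e l) f →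
      GapBound S (e l) (fun i s => c i * f i s) := fun l f hf => by
    have := (GapBound.of_bounded (S := S) (f := fun i _ => c i) fun i _ _ => hc i).mul hf
    rwa [zero_add] at this
  induction n generalizing l f with
  | zero => exact ⟨hb _ _ hf.1, fun i => continuousOn_const.mul (hf.2 i)⟩
  | succ n ih =>
    obtain ⟨h0, f', h1, h2⟩ := hf
    exact ⟨hb _ _ h0, _, fun i s hs => (h1 i s hs).const_mul (c i), ih h2⟩

theorem Tame.id (hG : ∀ i, S i ^ 2 ≤ G) : Tame S e n l (fun _ s => s) := by
  have hb : GapBound S (e l) (fun _ s => s) := by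
    refine (GapBound.of_bounded (K := max G 1) fun i s hs => ?_).mono hG (Nat.zero_le _)
    have h1 : |s| < S i := abs_lt.mpr hs
    have h2 : |s| ^ 2 ≤ G := (pow_le_pow_left₀ (abs_nonneg s) h1.le 2).trans (hG i)
    rcases le_or_gt |s| 1 with h | h
    · exact h.trans (le_max_right _ _)
    · exact le_trans (by nlinarith) (le_max_left _ _)
  cases n with
  | zero => exact ⟨hb, fun i => continuousOn_id⟩
  | succ n =>
    exact ⟨hb, fun _ _ => 1, fun i s _ => hasDerivAt_id s,
      Tame.const (c := fun _ => 1) (K := 1) (by simp) hG⟩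

theorem Tame.pow (hG : ∀ i, S i ^ 2 ≤ G) (he : ∀ a b, e a + e b ≤ e (a + b))
    (hf : Tame S e n 0 f) (k : ℕ) : Tame S e n 0 (fun i s => f i s ^ k) := by
  induction k with
  | zero => simpa using Tame.const (c := fun _ => (1 : ℝ)) (K := 1) (by simp) hG
  | succ k ih => simpa [pow_succ] using ih.mul hG he hf

/-- The derivative -f' f⁻² contains the inverse itself undifferentiated, so regularity of order n of
the inverse yields order n + 1. -/
theorem Tame.inv {K : ℝ} (hG : ∀ i, S i ^ 2 ≤ G) (he : ∀ a b, e a + e b ≤ e (a + b))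
    (hK : 0 < K) (hf : Tame S e n 0 f) (hfK : ∀ i, ∀ s ∈ Ioo (-S i) (S i), K ≤ f i s) :
    Tame S e n 0 (fun i s => (f i s)⁻¹) := by
  have hb : GapBound S (e 0) (fun i s => (f i s)⁻¹) := by
    refine (GapBound.of_bounded (K := K⁻¹) fun i s hs => ?_).mono hG (Nat.zero_le _)
    have h1 := hfK i s hs
    rw [abs_of_pos (inv_pos.mpr (hK.trans_le h1))]
    exact inv_anti₀ hK h1
  induction n with
  | zero => exact ⟨hb, fun i => (hf.2 i).inv₀ fun s hs => (hK.trans_le (hfK i s hs)).ne'⟩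
  | succ n ih =>
    have h3 := ih hf.of_succ
    obtain ⟨h0, f', h1, h2⟩ := hf
    refine ⟨hb, fun i s => (-1) * (f' i s * ((f i s)⁻¹ ^ 2)), fun i s hs => ?_, ?_⟩
    · refine ((h1 i s hs).inv (hK.trans_le (hfK i s hs)).ne').congr_deriv ?_
      simp only [inv_pow]; ring
    · have := h2.mul hG he (h3.pow hG he 2)
      exact this.const_mul (c := fun _ => -1) (K := 1) (by simp)

theorem hasDerivAt_inv_sqrt {f : ℝ → ℝ} {f' s : ℝ} (hf : HasDerivAt f f' s) (h0 : 0 < f s) :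
    HasDerivAt (fun s => (√(f s))⁻¹) (-(1 / 2) * ((√(f s))⁻¹ ^ 3 * f')) s := by
  have h1 := Real.sqrt_pos.mpr h0
  refine ((hf.sqrt h0.ne').inv h1.ne').congr_deriv ?_
  field_simp

theorem Tame.inv_sqrt {K : ℝ} (hG : ∀ i, S i ^ 2 ≤ G) (he : ∀ a b, e a + e b ≤ e (a + b))
    (hK : 0 < K) (hf : Tame S e n 0 f) (hfK : ∀ i, ∀ s ∈ Ioo (-S i) (S i), K ≤ f i s) :
    Tame S e n 0 (fun i s => (√(f i s))⁻¹) := by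
  have hb : GapBound S (e 0) (fun i s => (√(f i s))⁻¹) := by
    refine (GapBound.of_bounded (K := (√K)⁻¹) fun i s hs => ?_).mono hG (Nat.zero_le _)
    have h1 := Real.sqrt_le_sqrt (hfK i s hs)
    have h2 := Real.sqrt_pos.mpr hK
    rw [abs_of_pos (inv_pos.mpr (h2.trans_le h1))]
    exact inv_anti₀ h2 h1
  induction n with
  | zero => exact ⟨hb, fun i => (hf.2 i).sqrt.inv₀ fun s hs =>
      (Real.sqrt_pos.mpr (hK.trans_le (hfK i s hs))).ne'⟩
  | succ n ih =>
    have h3 := ih hf.of_succ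
    obtain ⟨h0, f', h1, h2⟩ := hf
    refine ⟨hb, _, fun i s hs => hasDerivAt_inv_sqrt (h1 i s hs) (hK.trans_le (hfK i s hs)), ?_⟩
    have := (h3.pow hG he 3).mul hG he h2
    rw [add_comm] at this
    exact this.const_mul (c := fun _ => -(1 / 2)) (K := 1 / 2) (by norm_num [abs_of_pos])

/-- Real powers of the gap. -/
theorem tame_gap_rpow {q : ℝ} (hG : ∀ i, S i ^ 2 ≤ G) (hq : 1 - (l : ℝ) ≤ q) (hq0 : l = 0 → 1 ≤ q) :
    Tame S (fun l => l - 1) n l (fun i s => gap (S i) s ^ q) := by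
  have hb : GapBound S (l - 1) (fun i s => gap (S i) s ^ q) := by
    have hl : 0 ≤ q + ((l - 1 : ℕ) : ℝ) := by
      rcases Nat.eq_zero_or_pos l with h | h
      · subst h; simpa using (zero_le_one.trans (hq0 rfl))
      · rw [Nat.cast_sub h]; push_cast; linarith
    refine ⟨(max G 0) ^ (q + ((l - 1 : ℕ) : ℝ)), by positivity, fun i s hs => ?_⟩
    have h1 := gap_pos hs
    rw [abs_of_pos (Real.rpow_pos_of_pos h1 _), ← Real.rpow_natCast (gap (S i) s), ← Real.rpow_add h1]
    exact Real.rpow_le_rpow h1.le ((gap_le (hG i)).trans (le_max_left _ _)) hl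
  induction n generalizing l q with
  | zero =>
    exact ⟨hb, fun i s hs => ((hasDerivAt_gap (S i) s).rpow_const
      (Or.inl (gap_pos hs).ne')).continuousAt.continuousWithinAt⟩
  | succ n ih =>
    refine ⟨hb, _, fun i s hs => (hasDerivAt_gap (S i) s).rpow_const (Or.inl (gap_pos hs).ne'), ?_⟩
    -- Differentiation lowers the power and raises the order together, which preserves 1 - l ≤ q.
    have hq' : 1 - ((l + 1 : ℕ) : ℝ) ≤ q - 1 := by push_cast; linarith
    have hb' : GapBound S (l + 1 - 1) (fun i s => gap (S i) s ^ (q - 1)) := by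
      have hl : 0 ≤ q - 1 + (l : ℝ) := by linarith
      refine ⟨(max G 0) ^ (q - 1 + (l : ℝ)), by positivity, fun i s hs => ?_⟩
      have h1 := gap_pos hs
      rw [abs_of_pos (Real.rpow_pos_of_pos h1 _), Nat.add_sub_cancel,
        ← Real.rpow_natCast (gap (S i) s), ← Real.rpow_add h1]
      exact Real.rpow_le_rpow h1.le ((gap_le (hG i)).trans (le_max_left _ _)) hl
    have h2 := ih hq' (by simp) hb'
    have h3 := (Tame.id (S := S) (e := fun l => l - 1) (n := n) (l := 0) hG).mul hG
      (fun a b => by omega) h2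
    rw [zero_add] at h3
    refine (h3.const_mul (c := fun _ => -q) (K := |q|) (by simp)).congr fun i s _ => by ring

/-- Averaging along dilations gains integrability in the weight. -/
theorem integral_gap_le {S s R : ℝ} (hR : 0 < R) (hRS : R ≤ S ^ 2) (hs : s ∈ Ioo (-S) S) (l : ℕ)
    (hl : l ≤ 4) :
    (∫ t in (0 : ℝ)..1, t * (gap S (t * s) ^ (l - 1))⁻¹) * gap S s ^ (l / 2) ≤ 1 + 2 / R := by
  have hR' : 0 < 2 / R := by positivity
  have hpos : ∀ t ∈ Icc (0 : ℝ) 1, 0 < gap S (t * s) := fun t ht =>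
    gap_pos (mul_mem_Ioo_of_abs_le_one (abs_le.mpr ⟨by linarith [ht.1], ht.2⟩) hs)
  have hg := gap_pos hs
  have hge : ∀ t ∈ Icc (0 : ℝ) 1, gap S s ≤ gap S (t * s) := fun t ht => by
    unfold gap
    have : t ^ 2 * s ^ 2 ≤ 1 * s ^ 2 :=
      mul_le_mul_of_nonneg_right (by nlinarith [ht.1, ht.2]) (sq_nonneg s)
    nlinarith
  have hcont : Continuous (gap S) := continuous_iff_continuousAt.mpr fun s =>
    (hasDerivAt_gap S s).continuousAt
  have hint : ∀ k : ℕ, IntervalIntegrable (fun t => t * (gap S (t * s) ^ k)⁻¹) volume 0 1 := by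
    intro k
    refine ContinuousOn.intervalIntegrable ?_
    rw [uIcc_of_le zero_le_one]
    exact continuousOn_id.mul (((hcont.comp (continuous_id.mul continuous_const)).pow k).continuousOn.inv₀
      fun t ht => (pow_pos (hpos t ht) k).ne')
  have hd : ∀ t, HasDerivAt (fun t => gap S (t * s)) (-(t * s) * s) t := fun t => by
    have := (hasDerivAt_gap S (t * s)).comp t ((hasDerivAt_id t).mul_const s)
    rwa [one_mul] at this
  have hle1 : ∀ k : ℕ, (∫ t in (0 : ℝ)..1, t * (gap S (t * s) ^ k)⁻¹) ≤ (gap S s ^ k)⁻¹ := by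
    intro k
    calc (∫ t in (0 : ℝ)..1, t * (gap S (t * s) ^ k)⁻¹) ≤ ∫ t in (0 : ℝ)..1, (gap S s ^ k)⁻¹ := by
          refine intervalIntegral.integral_mono_on zero_le_one (hint k) (by simp) fun t ht => ?_
          have h1 : (gap S (t * s) ^ k)⁻¹ ≤ (gap S s ^ k)⁻¹ :=
            inv_anti₀ (by positivity) (pow_le_pow_left₀ hg.le (hge t ht) k)
          have h2 : 0 ≤ (gap S (t * s) ^ k)⁻¹ := inv_nonneg.mpr (pow_nonneg (hpos t ht).le k)
          nlinarith [ht.1, ht.2]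
      _ = (gap S s ^ k)⁻¹ := by simp
  have hS : S ^ 2 ≠ 0 := by linarith
  interval_cases l
  · have := hle1 0; simp at this ⊢; linarith
  · have := hle1 0; simp at this ⊢; linarith
  -- For l = 2 the integral grows only logarithmically; the cruder gap⁻¹ already matches ⌊2/2⌋ = 1.
  · have := hle1 1
    simp only [Nat.reduceSub, Nat.reduceDiv]
    calc _ ≤ (gap S s ^ 1)⁻¹ * gap S s ^ 1 := mul_le_mul_of_nonneg_right this (by positivity)
      _ = 1 := inv_mul_cancel₀ (by positivity)
      _ ≤ 1 + 2 / R := by linarith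
  -- The antiderivative normalised to vanish at t = 0: in (1/gap(ts) - 1/gap(0))/s² the factor s²
  -- cancels, so s = 0 is no exception.
  · have h1 := intervalIntegral.integral_eq_sub_of_hasDerivAt
      (f := fun t => t ^ 2 / (S ^ 2 * gap S (t * s))) (f' := fun t => t * (gap S (t * s) ^ 2)⁻¹)
      (a := 0) (b := 1) (fun t ht => by
        rw [uIcc_of_le zero_le_one] at ht
        have h2 := hpos t ht
        refine ((hasDerivAt_pow 2 t).div ((hd t).const_mul (S ^ 2))
          (mul_ne_zero hS h2.ne')).congr_deriv ?_
        have h3 : S ^ 2 = 2 * gap S (t * s) + (t * s) ^ 2 := by unfold gap; ring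
        push_cast
        field_simp
        rw [div_eq_iff hS]
        linear_combination (-t) * h3) (hint 2)
    simp only [Nat.reduceSub, Nat.reduceDiv]
    rw [h1]
    simp only [one_mul, one_pow]
    have : (1 / (S ^ 2 * gap S s) - 0 ^ 2 / (S ^ 2 * gap S (0 * s))) * gap S s ^ 1 = 1 / S ^ 2 := by
      field_simp; simp
    rw [this]
    have h4 : 1 / S ^ 2 ≤ 1 / R := one_div_le_one_div_of_le hR hRS
    have h5 : 2 / R = 2 * (1 / R) := by ring
    have h6 : 0 < 1 / R := by positivity
    linarith
  -- The same normalisation, applied to 1/(2 s² gap(ts)²).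
  · have h1 := intervalIntegral.integral_eq_sub_of_hasDerivAt
      (f := fun t => t ^ 2 * (S ^ 2 / 2 + gap S (t * s)) / (S ^ 4 * gap S (t * s) ^ 2))
      (f' := fun t => t * (gap S (t * s) ^ 3)⁻¹)
      (a := 0) (b := 1) (fun t ht => by
        rw [uIcc_of_le zero_le_one] at ht
        have h2 := hpos t ht
        have hS4 : S ^ 4 ≠ 0 := by rw [show S ^ 4 = S ^ 2 * S ^ 2 by ring]; exact mul_ne_zero hS hS
        refine (((hasDerivAt_pow 2 t).mul ((hd t).const_add (S ^ 2 / 2))).div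
          (((hd t).pow 2).const_mul (S ^ 4))
          (mul_ne_zero hS4 (pow_pos h2 2).ne')).congr_deriv ?_
        have h3 : S ^ 2 = 2 * gap S (t * s) + (t * s) ^ 2 := by unfold gap; ring
        simp only [Pi.mul_apply, Pi.pow_apply]
        push_cast
        field_simp
        rw [div_eq_iff hS4]
        linear_combination t * (-S ^ 2 - gap S (t * s)) * h3) (hint 3)
    simp only [Nat.reduceSub, Nat.reduceDiv]
    rw [h1]
    simp only [one_mul, one_pow]
    have hS4 : S ^ 4 ≠ 0 := by rw [show S ^ 4 = S ^ 2 * S ^ 2 by ring]; exact mul_ne_zero hS hS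
    have h7 : ((S ^ 2 / 2 + gap S s) / (S ^ 4 * gap S s ^ 2)
        - 0 ^ 2 * (S ^ 2 / 2 + gap S (0 * s)) / (S ^ 4 * gap S (0 * s) ^ 2)) * gap S s ^ 2
        = (S ^ 2 / 2 + gap S s) / S ^ 4 := by
      field_simp; simp
    rw [h7]
    have h8 : S ^ 2 / 2 + gap S s ≤ S ^ 2 := by unfold gap; nlinarith [sq_nonneg s]
    have h9 : (S ^ 2 / 2 + gap S s) / S ^ 4 ≤ S ^ 2 / S ^ 4 :=
      div_le_div_of_nonneg_right h8 (by positivity)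
    have h10 : S ^ 2 / S ^ 4 = 1 / S ^ 2 := by field_simp
    have h4 : 1 / S ^ 2 ≤ 1 / R := one_div_le_one_div_of_le hR hRS
    have h5 : 2 / R = 2 * (1 / R) := by ring
    have h6 : 0 < 1 / R := by positivity
    linarith

/-- Each derivative in s brings out a factor t, hence the general `m`; the estimate uses only tᵐ ≤
t. Averaging lowers the exponent l - 1 to l - 2 for l ≥ 3, which is within ⌊l/2⌋ only up to l = 4:
exactly the order needed for T''. -/
theorem Tame.average {R : ℝ} (hR : 0 < R) (hRS : ∀ i, R ≤ S i ^ 2)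
    {m : ℕ} (hm : 1 ≤ m) (hln : l + n ≤ 4) (hf : Tame S (fun l => l - 1) n l f) :
    Tame S (fun l => l / 2) n l (fun i s => ∫ t in (0 : ℝ)..1, t ^ m * f i (t * s)) := by
  have h01 : ∀ t ∈ uIcc (0 : ℝ) 1, |t| ≤ 1 := fun t ht => by
    rw [uIcc_of_le zero_le_one] at ht
    exact abs_le.mpr ⟨by linarith [ht.1], ht.2⟩
  have hb : ∀ (l : ℕ) (f : ι → ℝ → ℝ) (m : ℕ), 1 ≤ m → l ≤ 4 → GapBound S (l - 1) f →
      (∀ i, ContinuousOn (f i) (Ioo (-S i) (S i))) →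
      GapBound S (l / 2) (fun i s => ∫ t in (0 : ℝ)..1, t ^ m * f i (t * s)) := by
    intro l f m hm hl ⟨K, hK0, hK⟩ hfc
    refine ⟨K * (1 + 2 / R), by positivity, fun i s hs => ?_⟩
    have hg := gap_pos hs
    have hcont : Continuous (gap (S i)) := continuous_iff_continuousAt.mpr fun s =>
      (hasDerivAt_gap (S i) s).continuousAt
    have h1 : |∫ t in (0 : ℝ)..1, t ^ m * f i (t * s)|
        ≤ ∫ t in (0 : ℝ)..1, K * (t * (gap (S i) (t * s) ^ (l - 1))⁻¹) := by
      rw [← Real.norm_eq_abs]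
      refine intervalIntegral.norm_integral_le_of_norm_le zero_le_one (ae_of_all _ fun t ht => ?_) ?_
      · have ht' : t ∈ uIcc (0 : ℝ) 1 := by
          rw [uIcc_of_le zero_le_one]; exact Ioc_subset_Icc_self ht
        have h2 := mul_mem_Ioo_of_abs_le_one (h01 t ht') hs
        have h3 := hK i _ h2
        have h4 := gap_pos h2
        have h5 : |f i (t * s)| ≤ K * (gap (S i) (t * s) ^ (l - 1))⁻¹ := by
          rw [← div_eq_mul_inv, le_div_iff₀ (by positivity)]; exact h3
        have h6 : t ^ m ≤ t := pow_le_of_le_one ht.1.le ht.2 (by omega)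
        rw [Real.norm_eq_abs, abs_mul, abs_of_nonneg (pow_nonneg ht.1.le m)]
        calc t ^ m * |f i (t * s)| ≤ t * (K * (gap (S i) (t * s) ^ (l - 1))⁻¹) :=
              mul_le_mul h6 h5 (abs_nonneg _) ht.1.le
          _ = _ := by ring
      · refine ContinuousOn.intervalIntegrable ?_
        refine continuousOn_const.mul (continuousOn_id.mul
          (((hcont.comp (continuous_id.mul continuous_const)).pow _).continuousOn.inv₀
            fun t ht => (pow_pos (gap_pos (mul_mem_Ioo_of_abs_le_one (h01 t ht) hs)) _).ne'))
    rw [intervalIntegral.integral_const_mul] at h1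
    calc _ ≤ K * (∫ t in (0 : ℝ)..1, t * (gap (S i) (t * s) ^ (l - 1))⁻¹) * gap (S i) s ^ (l / 2) :=
          mul_le_mul_of_nonneg_right h1 (by positivity)
      _ ≤ K * (1 + 2 / R) := by
          rw [mul_assoc]
          exact mul_le_mul_of_nonneg_left (integral_gap_le hR (hRS i) hs l hl) hK0
  induction n generalizing l f m with
  | zero =>
    exact ⟨hb l f m hm (by omega) hf.1 hf.2, fun i =>
      continuousOn_integral_comp_mul continuous_id (continuous_pow m) h01 (hf.2 i)⟩
  | succ n ih =>
    have hc := hf.continuousOn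
    obtain ⟨h0, f', h1, h2⟩ := hf
    refine ⟨hb l f m hm (by omega) h0 hc, fun i s => ∫ t in (0 : ℝ)..1, t ^ (m + 1) * f' i (t * s),
      fun i s hs => ?_, ih (by omega) (by omega) h2⟩
    have := hasDerivAt_integral_comp_mul (a := 0) (b := 1) (φ := fun t => t) continuous_id (continuous_pow m) h01
      (h1 i) (h2.continuousOn i) hs
    simpa only [pow_succ] using this

/-! ### The potential in the inverse radial variable -/

/-- The shifted effective potential `P u = Ψ (1 / u) - U 0` in the inverse radius `u = 1 / r`,
together with the mass `μ u` inside the radius `1 / u`. -/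
structure KeplerProfile (M L κ p δ B : ℝ) (P μ : ℝ → ℝ) : Prop where
  hasDerivAt_pot : ∀ u, 0 < u → HasDerivAt P (L * u - M - μ u) u
  hasDerivAt_mass : ∀ u, 0 < u → HasDerivAt μ (-(δ * (u⁻¹ ^ 2 * (max (κ - P u) 0) ^ p))) u
  mass_nonneg : ∀ u, 0 < u → 0 ≤ μ u
  mass_le : ∀ u, 0 < u → μ u ≤ B * δ
  mass_eq_zero : ∀ u, 2 * M / L ≤ u → μ u = 0
  le_pot : ∀ u, 0 < u → L * u ^ 2 / 2 - M * u ≤ P u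
  pot_le : ∀ u, 0 < u → P u ≤ L * u ^ 2 / 2 - M * u + B * δ

theorem effPot_eq_inv {M L r : ℝ} {U : ℝ → ℝ} :
    effPot M L U r = U r + (L * r⁻¹ ^ 2 / 2 - M * r⁻¹) := by
  simp only [effPot, div_eq_mul_inv, mul_inv, inv_pow]; ring

theorem integral_phaseDensity {M L k ε c₀ E₀ r : ℝ} {U : ℝ → ℝ}
    (hc₀ : ∀ z : ℝ, ∫ w : ℝ, 1 * (max (z - w ^ 2 / 2) 0) ^ k = c₀ * (max z 0) ^ (k + 1 / 2)) :
    ∫ w, phaseDensity M L k ε U E₀ r w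
      = ε * (c₀ * (max (E₀ - effPot M L U r) 0) ^ (k + 1 / 2)) := by
  rw [← hc₀, ← integral_const_mul]
  refine integral_congr_ae (ae_of_all _ fun w => ?_)
  simp only [phaseDensity, energy, one_mul]
  rw [show E₀ - (w ^ 2 / 2 + effPot M L U r) = E₀ - effPot M L U r - w ^ 2 / 2 by ring]

theorem massDensity_nonneg {M L k ε E₀ r : ℝ} {U : ℝ → ℝ} (hε : 0 ≤ ε) :
    0 ≤ massDensity M L k ε U E₀ r := by
  refine mul_nonneg (by positivity) (integral_nonneg fun w => ?_)
  exact mul_nonneg hε (Real.rpow_nonneg (le_max_right _ _) _)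

theorem IsSteadyState.monotoneOn {M L k κ ε E₀ : ℝ} {U : ℝ → ℝ} (hε : 0 ≤ ε)
    (h : IsSteadyState M L k κ ε U E₀) : MonotoneOn U (Ici 0) := by
  have hc : ContinuousOn U (Ici 0) := by
    intro r hr
    rcases eq_or_lt_of_le (show (0 : ℝ) ≤ r from hr) with h0 | h0
    · rw [← h0]; exact h.continuous_zero
    · exact (h.poisson r h0).continuousAt.continuousWithinAt
  refine monotoneOn_of_deriv_nonneg (convex_Ici 0) hc ?_ ?_
  · intro r hr
    rw [interior_Ici] at hr
    exact (h.poisson r hr).differentiableAt.differentiableWithinAt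
  · intro r hr
    rw [interior_Ici] at hr
    rw [(h.poisson r hr).deriv]
    exact mul_nonneg (by positivity) (intervalIntegral.integral_nonneg (le_of_lt hr) fun s _ =>
      mul_nonneg (sq_nonneg s) (massDensity_nonneg hε))

/-- The mass function of a density which is supported in a fixed annulus. -/
theorem exists_mass_of_density {a b Q : ℝ} (ha : 0 < a) (hab : a ≤ b) (hQ : 0 ≤ Q) {F : ℝ → ℝ}
    (hF : ContinuousOn F (Ioi 0)) (hF0 : ∀ s, 0 < s → 0 ≤ F s) (hFQ : ∀ s, 0 < s → F s ≤ Q)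
    (hFa : ∀ s, 0 < s → s ≤ a → F s = 0) (hFb : ∀ s, b ≤ s → F s = 0) :
    (∀ r, 0 < r → HasDerivAt (fun r => ∫ s in (0 : ℝ)..r, F s) (F r) r) ∧
    (∀ r, 0 < r → 0 ≤ ∫ s in (0 : ℝ)..r, F s) ∧
    (∀ r, 0 < r → ∫ s in (0 : ℝ)..r, F s ≤ Q * b) ∧
    (∀ r, 0 < r → r ≤ a → ∫ s in (0 : ℝ)..r, F s = 0) := by
  -- Freezing the density to the left of `a` makes it continuous on ℝ without changing it on ]0, ∞[,
  -- since it vanishes on ]0, a].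
  set Fe : ℝ → ℝ := fun s => F (max s a) with hFe
  have hFec : Continuous Fe := hF.comp_continuous (by fun_prop) fun s => ha.trans_le (le_max_right _ _)
  have hFeF : ∀ s, 0 < s → Fe s = F s := by
    intro s hs
    rcases le_total s a with h | h
    · simp only [hFe, max_eq_right h, hFa s hs h, hFa a ha le_rfl]
    · simp only [hFe, max_eq_left h]
  have hint : ∀ r, 0 < r → ∫ s in (0 : ℝ)..r, F s = ∫ s in (0 : ℝ)..r, Fe s := by
    intro r hr
    refine intervalIntegral.integral_congr_ae (ae_of_all _ fun s hs => ?_)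
    rw [uIoc_of_le hr.le] at hs
    exact (hFeF s hs.1).symm
  have hFe0 : ∀ s, 0 ≤ Fe s := fun s => hF0 _ (ha.trans_le (le_max_right _ _))
  have hFeQ : ∀ s, Fe s ≤ Q := fun s => hFQ _ (ha.trans_le (le_max_right _ _))
  have hii : ∀ x y, IntervalIntegrable Fe volume x y := fun x y => hFec.intervalIntegrable _ _
  have hle : ∀ r, 0 < r → ∫ s in (0 : ℝ)..r, Fe s ≤ Q * r := by
    intro r hr
    have := intervalIntegral.integral_mono_on hr.le (hii 0 r) (g := fun _ => Q) (by simp)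
      fun s _ => hFeQ s
    simpa [mul_comm] using this
  have hb : 0 < b := ha.trans_le hab
  refine ⟨fun r hr => ?_, fun r hr => ?_, fun r hr => ?_, fun r hr hra => ?_⟩
  · have h1 : HasDerivAt (fun r => ∫ s in (0 : ℝ)..r, Fe s) (Fe r) r :=
      intervalIntegral.integral_hasDerivAt_right (hii _ _)
        (hFec.stronglyMeasurableAtFilter _ _) hFec.continuousAt
    rw [hFeF r hr] at h1
    exact h1.congr_of_eventuallyEq (eventuallyEq_of_mem (isOpen_Ioi.mem_nhds hr) hint)
  · exact intervalIntegral.integral_nonneg_of_ae_restrict hr.le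
      (by
        rw [EventuallyLE, ae_restrict_iff' measurableSet_Icc]
        have h0 : ∀ᵐ s : ℝ, s ≠ 0 := by
          simp [ae_iff, measure_singleton]
        filter_upwards [h0] with s hs0 hs
        exact hF0 s (lt_of_le_of_ne hs.1 hs0.symm))
  · rw [hint r hr]
    rcases le_total r b with h | h
    · exact (hle r hr).trans (mul_le_mul_of_nonneg_left h hQ)
    · rw [← intervalIntegral.integral_add_adjacent_intervals (hii 0 b) (hii b r),
        intervalIntegral.integral_congr (a := b) (b := r) (g := fun _ => (0 : ℝ)) fun s hs => ?_]
      · simpa using hle b hb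
      · rw [uIcc_of_le h] at hs
        change Fe s = 0
        rw [hFeF s (hb.trans_le hs.1), hFb s hs.1]
  · rw [hint r hr, intervalIntegral.integral_congr (g := fun _ => (0 : ℝ)) fun s hs => ?_]
    · simp
    · rw [uIcc_of_le hr.le] at hs
      change Fe s = 0
      simp only [hFe, max_eq_right (hs.2.trans hra), hFa a ha le_rfl]

/-- A priori bounds come for free from monotonicity of `U`: P lies above the Kepler parabola, so κ -
P ≤ D and the matter stays in a fixed annulus. Mass and potential difference are then O(δ) uniformly
in the steady state, and letting r → ∞ in the bounds for U(r) - U(0) controls U(0). -/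
theorem exists_keplerProfile (M L k κ : ℝ) (hM : 0 < M) (hL : 0 < L) (hk : 1 / 2 < k)
    (hκ0 : -(M ^ 2 / (2 * L)) < κ) (hκ : κ < 0) :
    ∃ c₁ B : ℝ, 0 ≤ c₁ ∧ 0 ≤ B ∧ ∀ (ε : ℝ) (U : ℝ → ℝ) (E₀ : ℝ), 0 ≤ ε →
      IsSteadyState M L k κ ε U E₀ →
      (∃ μ, KeplerProfile M L κ (k + 1 / 2) (c₁ * ε) B (fun u => effPot M L U u⁻¹ - U 0) μ) ∧
      -(B * (c₁ * ε)) ≤ U 0 ∧ U 0 ≤ 0 := by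
  obtain ⟨c₀, hc₀, hvel⟩ := velocity_integral k 1 hk zero_le_one
  -- The Kepler potential is nonnegative for r ≤ a and at least κ for r ≥ b, so there is no matter
  -- outside [a, b].
  set a : ℝ := L / (2 * M) with ha_def
  have ha : 0 < a := by positivity
  set D : ℝ := κ + M ^ 2 / (2 * L) with hD_def
  have hD : 0 < D := by linarith
  set b : ℝ := a + M / (-κ) with hb_def
  have hbM : 0 < M / (-κ) := div_pos hM (by linarith)
  have hab : a ≤ b := by linarith
  have hb : 0 < b := by linarith
  set p : ℝ := k + 1 / 2 with hp_def
  have hp : 1 < p := by linarith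
  have hDp : 0 ≤ D ^ p := Real.rpow_nonneg hD.le _
  -- The factor 4π² combines the 4π of the Poisson equation with the π of the mass density. The
  -- second constant adds the bounds D^p b for the mass and D^p b / a for the potential difference.
  refine ⟨4 * Real.pi ^ 2 * c₀, D ^ p * b * (1 + 1 / a), by positivity, by positivity, ?_⟩
  intro ε U E₀ hε h
  set δ : ℝ := 4 * Real.pi ^ 2 * c₀ * ε with hδ_def
  have hδ : 0 ≤ δ := by positivity
  have hmono := h.monotoneOn hε
  have hU0 : ∀ r, 0 < r → U 0 ≤ U r := fun r hr => hmono (self_mem_Ici) (mem_Ici.mpr hr.le) hr.le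
  set F : ℝ → ℝ := fun s => δ * (max (κ - (effPot M L U s - U 0)) 0) ^ p with hF_def
  have hE : E₀ = κ + U 0 := by linarith [h.kappa_eq]
  have hFm : ∀ s, 0 < s → 4 * Real.pi * (s ^ 2 * massDensity M L k ε U E₀ s) = F s := by
    intro s hs
    rw [massDensity, integral_phaseDensity hvel, hE]
    simp only [hF_def, hδ_def]
    rw [show κ + U 0 - effPot M L U s = κ - (effPot M L U s - U 0) by ring, ← hp_def]
    field_simp
  have hm : ∀ r, 0 < r → 4 * Real.pi * ∫ s in (0 : ℝ)..r, s ^ 2 * massDensity M L k ε U E₀ s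
      = ∫ s in (0 : ℝ)..r, F s := by
    intro r hr
    rw [← intervalIntegral.integral_const_mul]
    refine intervalIntegral.integral_congr_ae (ae_of_all _ fun s hs => ?_)
    rw [uIoc_of_le hr.le] at hs
    exact hFm s hs.1
  have hUc : ContinuousOn U (Ioi 0) := fun r hr => (h.poisson r hr).continuousAt.continuousWithinAt
  have hpot : ContinuousOn (effPot M L U) (Ioi 0) := by
    unfold effPot
    refine (hUc.sub (continuousOn_const.div continuousOn_id fun r hr => ne_of_gt hr)).add
      (continuousOn_const.div (by fun_prop) fun r hr => ?_)
    have : (0 : ℝ) < r := hr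
    positivity
  have hFc : ContinuousOn F (Ioi 0) := by
    refine continuousOn_const.mul (ContinuousOn.rpow_const ?_ fun _ _ => Or.inr (by linarith))
    exact ContinuousOn.sup (continuousOn_const.sub (hpot.sub continuousOn_const)) continuousOn_const
  have hlow : ∀ s, 0 < s → L * s⁻¹ ^ 2 / 2 - M * s⁻¹ ≤ effPot M L U s - U 0 := fun s hs => by
    rw [effPot_eq_inv]; linarith [hU0 s hs]
  have hzero : ∀ z : ℝ, z ≤ 0 → δ * (max z 0) ^ p = 0 := fun z hz => by
    rw [max_eq_right hz, Real.zero_rpow (by linarith), mul_zero]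
  obtain ⟨hmd, hm0, hmQ, hma⟩ := exists_mass_of_density (Q := δ * D ^ p) ha hab (by positivity) hFc
    (fun s _ => mul_nonneg hδ (Real.rpow_nonneg (le_max_right _ _) _))
    (fun s hs => by
      refine mul_le_mul_of_nonneg_left (Real.rpow_le_rpow (le_max_right _ _)
        (max_le ?_ hD.le) (by linarith)) hδ
      have h1 : -(M ^ 2 / (2 * L)) ≤ L * s⁻¹ ^ 2 / 2 - M * s⁻¹ := by
        have : L * s⁻¹ ^ 2 / 2 - M * s⁻¹ + M ^ 2 / (2 * L) = (L * s⁻¹ - M) ^ 2 / (2 * L) := by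
          generalize s⁻¹ = u; field_simp; ring
        have h2 : 0 ≤ (L * s⁻¹ - M) ^ 2 / (2 * L) := by positivity
        linarith
      linarith [hlow s hs])
    (fun s hs hsa => hzero _ (by
      have h1 : 2 * M / L ≤ s⁻¹ := by
        rw [show 2 * M / L = a⁻¹ by rw [ha_def, inv_div]]
        exact inv_anti₀ hs hsa
      rw [div_le_iff₀ hL] at h1
      have h2 : 0 ≤ s⁻¹ * (s⁻¹ * L - 2 * M) := mul_nonneg (by positivity) (by linarith)
      nlinarith [hlow s hs]))
    (fun s hs => hzero _ (by
      have hs0 : 0 < s := hb.trans_le hs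
      have h1 : M * s⁻¹ ≤ -κ := by
        rw [← div_eq_mul_inv, div_le_iff₀ hs0]
        have : M / (-κ) ≤ s := by linarith
        rw [div_le_iff₀ (by linarith)] at this
        linarith
      have h2 : 0 ≤ L * s⁻¹ ^ 2 / 2 := by positivity
      linarith [hlow s hs0]))
  have hUd : ∀ r, 0 < r → HasDerivAt U ((∫ s in (0 : ℝ)..r, F s) / r ^ 2) r := fun r hr => by
    refine (h.poisson r hr).congr_deriv ?_
    rw [← hm r hr]; ring
  set m : ℝ → ℝ := fun r => ∫ s in (0 : ℝ)..r, F s with hm_def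
  have hDb : 0 ≤ δ * D ^ p * b := by positivity
  have hUa : ∀ r, 0 < r → r ≤ a → U r ≤ U 0 := by
    intro r hr hra
    have hc : ContinuousOn U (Icc 0 a) := by
      intro y hy
      rcases eq_or_lt_of_le hy.1 with h0 | h0
      · rw [← h0]; exact h.continuous_zero.mono Icc_subset_Ici_self
      · exact (h.poisson y h0).continuousAt.continuousWithinAt
    have := (convex_Icc 0 a).image_sub_le_mul_sub_of_deriv_le hc
      (fun y hy => by
        rw [interior_Icc] at hy
        exact (hUd y hy.1).differentiableAt.differentiableWithinAt) (C := 0)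
      (fun y hy => by
        rw [interior_Icc] at hy
        rw [(hUd y hy.1).deriv, hma y hy.1 hy.2.le, zero_div])
      0 ⟨le_rfl, ha.le⟩ r ⟨hr.le, hra⟩ hr.le
    linarith
  have hUle : ∀ r, 0 < r → U r - U 0 ≤ δ * D ^ p * b / a := by
    intro r hr
    rcases le_total r a with hra | hra
    · have : 0 ≤ δ * D ^ p * b / a := by positivity
      linarith [hUa r hr hra]
    -- U' = m/r² with m below the constant δ D^p b, so adding that constant over r gives a
    -- decreasing function.
    · have hder : ∀ y, 0 < y → HasDerivAt (fun y => U y + δ * D ^ p * b * y⁻¹)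
          (m y / y ^ 2 + δ * D ^ p * b * (-(y ^ 2)⁻¹)) y := fun y hy =>
        (hUd y hy).add ((hasDerivAt_inv hy.ne').const_mul _)
      have hanti : AntitoneOn (fun y => U y + δ * D ^ p * b * y⁻¹) (Ici a) := by
        refine antitoneOn_of_deriv_nonpos (convex_Ici a)
          (fun y hy => (hder y (ha.trans_le hy)).continuousAt.continuousWithinAt) ?_ ?_
        · intro y hy
          rw [interior_Ici] at hy
          exact (hder y (ha.trans hy)).differentiableAt.differentiableWithinAt
        · intro y hy
          rw [interior_Ici] at hy
          have hy0 : 0 < y := ha.trans hy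
          rw [(hder y hy0).deriv]
          have h1 : m y / y ^ 2 ≤ δ * D ^ p * b / y ^ 2 :=
            div_le_div_of_nonneg_right (hmQ y hy0) (by positivity)
          rw [div_eq_mul_inv (δ * D ^ p * b)] at h1
          linarith
      have h1 := hanti (self_mem_Ici) (mem_Ici.mpr hra) hra
      simp only at h1
      have h2 : 0 ≤ δ * D ^ p * b * r⁻¹ := by positivity
      rw [div_eq_mul_inv]
      linarith [hUa a ha le_rfl]
  have hB : D ^ p * b * (1 + 1 / a) * δ = δ * D ^ p * b + δ * D ^ p * b / a := by ring
  have hDba : 0 ≤ δ * D ^ p * b / a := by positivity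
  refine ⟨⟨fun u => m u⁻¹, ?_⟩, ?_, ?_⟩
  · refine ⟨fun u hu => ?_, fun u hu => ?_, fun u hu => hm0 _ (inv_pos.mpr hu), fun u hu => ?_,
      fun u hu => ?_, fun u hu => ?_, fun u hu => ?_⟩
    · have h1 := (hUd u⁻¹ (inv_pos.mpr hu)).comp u (hasDerivAt_inv hu.ne')
      have h2 := ((hasDerivAt_pow 2 u).const_mul L).div_const 2
      have h3 := (hasDerivAt_id u).const_mul M
      have h4 := (h1.add (h2.sub h3)).sub_const (U 0)
      refine (h4.congr_of_eventuallyEq (eventuallyEq_of_mem univ_mem fun y _ => ?_)).congr_deriv ?_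
      · simp [effPot_eq_inv]
      · simp only [hm_def]
        push_cast
        field_simp
        ring
    · have h1 := (hmd u⁻¹ (inv_pos.mpr hu)).comp u (hasDerivAt_inv hu.ne')
      refine h1.congr_deriv ?_
      simp only [hF_def, inv_pow]
      ring
    · rw [hB]
      have := hmQ u⁻¹ (inv_pos.mpr hu)
      linarith
    · have hu0 : 0 < u := lt_of_lt_of_le (by positivity) hu
      refine hma _ (inv_pos.mpr hu0) ?_
      rw [ha_def, ← inv_div]
      exact inv_anti₀ (by positivity) hu
    · have := hlow u⁻¹ (inv_pos.mpr hu)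
      rwa [inv_inv] at this
    · have := hUle u⁻¹ (inv_pos.mpr hu)
      simp only [effPot_eq_inv, inv_inv]
      rw [hB]
      linarith
  · have h1 : ∀ᶠ r in atTop, U r ≤ U 0 + δ * D ^ p * b / a := by
      filter_upwards [eventually_gt_atTop 0] with r hr
      linarith [hUle r hr]
    have h2 := le_of_tendsto h.tendsto_zero h1
    rw [hB]
    linarith
  · refine ge_of_tendsto h.tendsto_zero ?_
    filter_upwards [eventually_gt_atTop 0] with r hr
    exact hU0 r hr

/-! ### The energy chart -/

/-- The mass correction `W` in the equation `x' = 1 / √(L + δ W)` of the energy chart. -/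
noncomputable def chartMass (p S : ℝ) (x : ℝ → ℝ) (s : ℝ) : ℝ :=
  2 * ∫ t in (0 : ℝ)..1, t ^ 1 * ((x (t * s))⁻¹ ^ 2 * gap S (t * s) ^ p)

/-- The solutions `u = x s` of `P u = Pm + s² / 2`, where `Pm` is the minimum of `P`. -/
structure EnergyChart (M L κ p δ B : ℝ) (P x : ℝ → ℝ) (S Pm : ℝ) : Prop where
  pos : 0 < S
  sq_eq : S ^ 2 = 2 * (κ - Pm)
  le_min : -(M ^ 2 / (2 * L)) ≤ Pm
  min_le : Pm ≤ -(M ^ 2 / (2 * L)) + B * δ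
  min_le_pot : ∀ u, 0 < u → Pm ≤ P u
  le_apply : ∀ s ∈ Ioo (-S) S, -κ / M ≤ x s
  apply_le : ∀ s ∈ Ioo (-S) S, x s ≤ 2 * M / L
  pot_apply : ∀ s ∈ Ioo (-S) S, P (x s) = Pm + s ^ 2 / 2
  surj : ∀ u, 0 < u → P u < κ → ∃ s ∈ Ioo (-S) S, x s = u
  hasDerivAt : ∀ s ∈ Ioo (-S) S, HasDerivAt x (√(L + δ * chartMass p S x s))⁻¹ s
  le_zero : M / L ≤ x 0
  zero_le : x 0 ≤ M / L + B * δ / L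

theorem chartMass_nonneg {p S : ℝ} {x : ℝ → ℝ} {s : ℝ} (hs : s ∈ Ioo (-S) S) :
    0 ≤ chartMass p S x s := by
  refine mul_nonneg zero_le_two (intervalIntegral.integral_nonneg zero_le_one fun t ht => ?_)
  have h1 : t * s ∈ Ioo (-S) S :=
    mul_mem_Ioo_of_abs_le_one (abs_le.mpr ⟨by linarith [ht.1], ht.2⟩) hs
  exact mul_nonneg (pow_nonneg ht.1 _)
    (mul_nonneg (sq_nonneg _) (Real.rpow_nonneg (gap_pos h1).le _))

theorem continuousOn_chartMass {p S : ℝ} {x : ℝ → ℝ} (hp : 0 ≤ p)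
    (hx : ContinuousOn x (Ioo (-S) S)) (hx0 : ∀ s ∈ Ioo (-S) S, 0 < x s) :
    ContinuousOn (chartMass p S x) (Ioo (-S) S) := by
  have hg : Continuous (gap S) := continuous_iff_continuousAt.mpr fun s =>
    (hasDerivAt_gap S s).continuousAt
  refine continuousOn_const.mul (continuousOn_integral_comp_mul (a := 0) (b := 1)
    (φ := fun t => t) (f := fun s => (x s)⁻¹ ^ 2 * gap S s ^ p) continuous_id (continuous_pow 1)
    (fun t ht => ?_) ?_)
  · rw [uIcc_of_le zero_le_one] at ht
    exact abs_le.mpr ⟨by linarith [ht.1], ht.2⟩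
  · exact ((hx.inv₀ fun s hs => (hx0 s hs).ne').pow 2).mul
      (hg.continuousOn.rpow_const fun _ _ => Or.inr hp)

/-- For the bottom of the well, where the quotient s / P'(x s) giving the derivative of the chart is
0/0. -/
theorem hasDerivAt_of_punctured {f g : ℝ → ℝ} {a b x : ℝ} (hx : x ∈ Ioo a b)
    (hfg : ∀ y ∈ Ioo a b, y ≠ x → HasDerivAt f (g y) y) (hf : ContinuousAt f x)
    (hg : ContinuousAt g x) : HasDerivAt f (g x) x := by
  have A : HasDerivWithinAt f (g x) (Ici x) x := by
    have hdiff : DifferentiableOn ℝ f (Ioo x b) := fun y hy =>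
      (hfg y ⟨hx.1.trans hy.1, hy.2⟩ hy.1.ne').differentiableAt.differentiableWithinAt
    refine hasDerivWithinAt_Ici_of_tendsto_deriv hdiff hf.continuousWithinAt
      (Ioo_mem_nhdsGT hx.2) ?_
    refine (hg.tendsto.mono_left nhdsWithin_le_nhds).congr' ?_
    filter_upwards [Ioo_mem_nhdsGT hx.2] with y hy
    exact (hfg y ⟨hx.1.trans hy.1, hy.2⟩ hy.1.ne').deriv.symm
  have B : HasDerivWithinAt f (g x) (Iic x) x := by
    have hdiff : DifferentiableOn ℝ f (Ioo a x) := fun y hy =>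
      (hfg y ⟨hy.1, hy.2.trans hx.2⟩ hy.2.ne).differentiableAt.differentiableWithinAt
    refine hasDerivWithinAt_Iic_of_tendsto_deriv hdiff hf.continuousWithinAt
      (Ioo_mem_nhdsLT hx.1) ?_
    refine (hg.tendsto.mono_left nhdsWithin_le_nhds).congr' ?_
    filter_upwards [Ioo_mem_nhdsLT hx.1] with y hy
    exact (hfg y ⟨hy.1, hy.2.trans hx.2⟩ hy.2.ne).deriv.symm
  simpa using B.union A

theorem KeplerProfile.exists_chart {M L κ p δ B : ℝ} {P μ : ℝ → ℝ} (hM : 0 < M) (hL : 0 < L)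
    (hp : 1 < p) (hδ : 0 ≤ δ) (hκ : κ < 0) (hB : B * δ < κ + M ^ 2 / (2 * L))
    (hB0 : 0 ≤ B * δ) (h : KeplerProfile M L κ p δ B P μ) :
    ∃ (x : ℝ → ℝ) (S Pm : ℝ), EnergyChart M L κ p δ B P x S Pm := by
  set P' : ℝ → ℝ := fun u => L * u - M - μ u with hP'
  have hML : 0 < M / L := by positivity
  have hPc : ContinuousOn P (Ioi 0) := fun u hu =>
    (h.hasDerivAt_pot u hu).continuousAt.continuousWithinAt
  have hP'd : ∀ u, 0 < u → HasDerivAt P' (L + δ * (u⁻¹ ^ 2 * (max (κ - P u) 0) ^ p)) u := by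
    intro u hu
    have := (((hasDerivAt_id u).const_mul L).sub_const M).sub (h.hasDerivAt_mass u hu)
    refine this.congr_deriv ?_
    ring
  have hP'c : ContinuousOn P' (Ioi 0) := fun u hu => (hP'd u hu).continuousAt.continuousWithinAt
  have hP'm : StrictMonoOn P' (Ioi 0) := by
    refine strictMonoOn_of_deriv_pos (convex_Ioi 0) hP'c fun u hu => ?_
    rw [interior_Ioi] at hu
    rw [(hP'd u hu).deriv]
    have : 0 ≤ δ * (u⁻¹ ^ 2 * (max (κ - P u) 0) ^ p) :=
      mul_nonneg hδ (mul_nonneg (sq_nonneg _) (Real.rpow_nonneg (le_max_right _ _) _))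
    linarith
  -- P' equals -μ ≤ 0 at M/L, and M > 0 at 2M/L, where there is no enclosed mass.
  obtain ⟨u₀, hu₀, hu₀'⟩ : ∃ u ∈ Icc (M / L) (2 * M / L), P' u = 0 := by
    have h1 : M / L ≤ 2 * M / L := div_le_div_of_nonneg_right (by linarith) hL.le
    have h2 := intermediate_value_Icc h1 (hP'c.mono fun u hu => hML.trans_le hu.1)
    refine h2 ⟨?_, ?_⟩
    · have : L * (M / L) = M := by field_simp
      simp only [hP', this]
      linarith [h.mass_nonneg _ hML]
    · have : L * (2 * M / L) = 2 * M := by field_simp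
      simp only [hP', this, h.mass_eq_zero _ le_rfl]
      linarith
  have hu₀0 : 0 < u₀ := hML.trans_le hu₀.1
  set Pm : ℝ := P u₀ with hPm
  have hanti : StrictAntiOn P (Ioc 0 u₀) := by
    refine strictAntiOn_of_deriv_neg (convex_Ioc 0 u₀) (hPc.mono fun u hu => hu.1) fun u hu => ?_
    rw [interior_Ioc] at hu
    rw [(h.hasDerivAt_pot u hu.1).deriv, ← hu₀']
    exact hP'm hu.1 hu₀0 hu.2
  have hmono : StrictMonoOn P (Ici u₀) := by
    refine strictMonoOn_of_deriv_pos (convex_Ici u₀) (hPc.mono fun u hu => hu₀0.trans_le hu)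
      fun u hu => ?_
    rw [interior_Ici] at hu
    rw [(h.hasDerivAt_pot u (hu₀0.trans hu)).deriv, ← hu₀']
    exact hP'm hu₀0 (hu₀0.trans hu) hu
  have hmin : ∀ u, 0 < u → Pm ≤ P u := by
    intro u hu
    rcases le_total u u₀ with h1 | h1
    · exact hanti.antitoneOn ⟨hu, h1⟩ ⟨hu₀0, le_rfl⟩ h1
    · exact hmono.monotoneOn self_mem_Ici h1 h1
  have hPm1 : -(M ^ 2 / (2 * L)) ≤ Pm := by
    have h1 : L * u₀ ^ 2 / 2 - M * u₀ + M ^ 2 / (2 * L) = (L * u₀ - M) ^ 2 / (2 * L) := by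
      field_simp; ring
    have h2 : 0 ≤ (L * u₀ - M) ^ 2 / (2 * L) := by positivity
    linarith [h.le_pot u₀ hu₀0]
  have hPm2 : Pm ≤ -(M ^ 2 / (2 * L)) + B * δ := by
    refine (hmin _ hML).trans ((h.pot_le _ hML).trans_eq ?_)
    field_simp; ring
  set S : ℝ := √(2 * (κ - Pm)) with hS
  have hκPm : 0 < 2 * (κ - Pm) := by linarith
  have hS0 : 0 < S := Real.sqrt_pos.mpr hκPm
  have hSsq : S ^ 2 = 2 * (κ - Pm) := Real.sq_sqrt hκPm.le
  -- The root of 2(P - Pm), negative to the left of the minimiser; one of the two terms always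
  -- vanishes, and in this form continuity is immediate. The chart `x` will be its inverse.
  set σ : ℝ → ℝ := fun u => √(2 * (P (max u u₀) - Pm)) - √(2 * (P (min u u₀) - Pm)) with hσ
  have hσr : ∀ u, u₀ ≤ u → σ u = √(2 * (P u - Pm)) := fun u hu => by
    simp only [hσ, max_eq_left hu, min_eq_right hu, ← hPm]; simp
  have hσl : ∀ u, u ≤ u₀ → σ u = -√(2 * (P u - Pm)) := fun u hu => by
    simp only [hσ, max_eq_right hu, min_eq_left hu, ← hPm]; simp
  have hσsq : ∀ u, 0 < u → σ u ^ 2 = 2 * (P u - Pm) := fun u hu => by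
    have h0 : 0 ≤ 2 * (P u - Pm) := by linarith [hmin u hu]
    rcases le_total u u₀ with h1 | h1
    · rw [hσl u h1, neg_sq, Real.sq_sqrt h0]
    · rw [hσr u h1, Real.sq_sqrt h0]
  have hσc : ContinuousOn σ (Ioi 0) := by
    refine ContinuousOn.sub ?_ ?_
    · refine (continuousOn_const.mul (ContinuousOn.sub (hPc.comp (by fun_prop) fun u hu => ?_)
        continuousOn_const)).sqrt
      exact hu₀0.trans_le (le_max_right _ _)
    · refine (continuousOn_const.mul (ContinuousOn.sub (hPc.comp (by fun_prop) fun u hu => ?_)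
        continuousOn_const)).sqrt
      exact lt_min hu hu₀0
  have hσm : StrictMonoOn σ (Ioi 0) := by
    intro u hu v hv huv
    have hu' : 0 < u := hu
    rcases le_total u₀ u with h1 | h1
    · rw [hσr u h1, hσr v (h1.trans huv.le)]
      refine Real.sqrt_lt_sqrt (by linarith [hmin u hu]) ?_
      linarith [hmono (mem_Ici.mpr h1) (mem_Ici.mpr (h1.trans huv.le)) huv]
    · rcases le_total u₀ v with h2 | h2
      · rcases eq_or_lt_of_le h1 with h3 | h3
        · rw [hσr u h3.ge, hσr v h2]
          refine Real.sqrt_lt_sqrt (by linarith [hmin u hu]) ?_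
          linarith [hmono (mem_Ici.mpr h3.ge) (mem_Ici.mpr h2) huv]
        · rw [hσl u h1, hσr v h2]
          have h4 : 0 < √(2 * (P u - Pm)) := Real.sqrt_pos.mpr (by
            linarith [hanti ⟨hu', h1⟩ ⟨hu₀0, le_rfl⟩ h3])
          linarith [Real.sqrt_nonneg (2 * (P v - Pm))]
      · rw [hσl u h1, hσl v h2]
        refine neg_lt_neg (Real.sqrt_lt_sqrt (by linarith [hmin v hv]) ?_)
        linarith [hanti ⟨hu', h1⟩ ⟨hv, h2⟩ huv]
  -- At `u₁` and `u₂` the Kepler lower bound already gives P ≥ κ, so [u₁, u₂] contains every orbit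
  -- below the cut-off.
  set u₁ : ℝ := -κ / M with hu₁
  set u₂ : ℝ := 2 * M / L with hu₂
  have hu₁0 : 0 < u₁ := div_pos (by linarith) hM
  have hu₁u₀ : u₁ ≤ u₀ := by
    refine le_trans ?_ hu₀.1
    rw [hu₁, div_le_div_iff₀ hM hL]
    have : -κ < M ^ 2 / (2 * L) := by linarith
    rw [lt_div_iff₀ (by positivity)] at this
    nlinarith
  have hPu₁ : κ ≤ P u₁ := by
    have h1 := h.le_pot u₁ hu₁0
    have h2 : M * u₁ = -κ := by rw [hu₁]; field_simp
    have h3 : 0 ≤ L * u₁ ^ 2 / 2 := by positivity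
    linarith
  have hPu₂ : κ ≤ P u₂ := by
    have h1 := h.le_pot u₂ (hu₀0.trans_le hu₀.2)
    have h2 : L * u₂ ^ 2 / 2 - M * u₂ = 0 := by rw [hu₂]; field_simp; ring
    linarith
  have hex : ∀ s ∈ Ioo (-S) S, ∃ u ∈ Icc u₁ u₂, σ u = s := by
    intro s hs
    have h1 := intermediate_value_Icc (hu₁u₀.trans hu₀.2) (hσc.mono fun u hu => hu₁0.trans_le hu.1)
    refine h1 ⟨?_, ?_⟩
    · rw [hσl _ hu₁u₀]
      have : S ≤ √(2 * (P u₁ - Pm)) := Real.sqrt_le_sqrt (by linarith)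
      linarith [hs.1]
    · rw [hσr _ hu₀.2]
      have : S ≤ √(2 * (P u₂ - Pm)) := Real.sqrt_le_sqrt (by linarith)
      linarith [hs.2]
  choose! x hxm hσx using hex
  have hx0 : ∀ s ∈ Ioo (-S) S, 0 < x s := fun s hs => hu₁0.trans_le (hxm s hs).1
  have hPx : ∀ s ∈ Ioo (-S) S, P (x s) = Pm + s ^ 2 / 2 := fun s hs => by
    have := hσsq _ (hx0 s hs)
    rw [hσx s hs] at this
    linarith
  have hsurj : ∀ u, 0 < u → P u < κ → ∃ s ∈ Ioo (-S) S, x s = u := by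
    intro u hu hPu
    have h1 : |σ u| < S := abs_lt_of_sq_lt_sq (by rw [hσsq u hu, hSsq]; linarith) hS0.le
    exact ⟨σ u, abs_lt.mp h1, hσm.injOn (hx0 _ (abs_lt.mp h1)) hu (hσx _ (abs_lt.mp h1))⟩
  have hxmono : StrictMonoOn x (Ioo (-S) S) := by
    intro s hs t ht hst
    by_contra! hcon
    have := hσm.monotoneOn (hx0 t ht) (hx0 s hs) hcon
    rw [hσx s hs, hσx t ht] at this
    linarith
  have hPlt : ∀ s ∈ Ioo (-S) S, P (x s) < κ := fun s hs => by
    have := gap_pos hs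
    unfold gap at this
    rw [hPx s hs]; linarith
  have hxc : ∀ s ∈ Ioo (-S) S, ContinuousAt x s := by
    intro s hs
    refine hxmono.continuousAt_of_image_mem_nhds (isOpen_Ioo.mem_nhds hs) ?_
    have h1 := (h.hasDerivAt_pot _ (hx0 s hs)).continuousAt.eventually_lt continuousAt_const
      (hPlt s hs)
    filter_upwards [h1, isOpen_Ioi.mem_nhds (hx0 s hs)] with u hu hu'
    obtain ⟨t, ht, hxt⟩ := hsurj u hu' hu
    exact ⟨t, ht, hxt⟩
  have h0S : (0 : ℝ) ∈ Ioo (-S) S := ⟨by linarith, hS0⟩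
  have hxz : x 0 = u₀ := by
    refine hσm.injOn (hx0 0 h0S) hu₀0 ?_
    rw [hσx 0 h0S, hσr u₀ le_rfl]; simp [← hPm]
  have hsign : ∀ s ∈ Ioo (-S) S, s ≠ 0 → 0 < P' (x s) / s := by
    intro s hs hs0
    rcases lt_or_gt_of_ne hs0 with h1 | h1
    · have h2 := hxmono hs h0S h1
      have h3 := hP'm (hx0 s hs) (hx0 0 h0S) h2
      rw [hxz, hu₀'] at h3
      exact div_pos_of_neg_of_neg h3 h1
    · have h2 := hxmono h0S hs h1
      have h3 := hP'm (hx0 0 h0S) (hx0 s hs) h2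
      rw [hxz, hu₀'] at h3
      exact div_pos h3 h1
  have hxd : ∀ s ∈ Ioo (-S) S, s ≠ 0 → HasDerivAt x (P' (x s) / s)⁻¹ s := by
    intro s hs hs0
    have habs : 0 < |s| := abs_pos.mpr hs0
    have h2 : 2 * (P (x s) - Pm) = s ^ 2 := by rw [hPx s hs]; ring
    -- Near s ≠ 0 the sign is constant, so this differentiable branch of the signed root is a local
    -- inverse of `x`.
    refine HasDerivAt.of_local_left_inverse (f := fun u => s / |s| * √(2 * (P u - Pm)))
      (hxc s hs) ?_ (hsign s hs hs0).ne' ?_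
    · have h1 := ((((h.hasDerivAt_pot _ (hx0 s hs)).sub_const Pm).const_mul 2).sqrt
        (by rw [h2]; positivity)).const_mul (s / |s|)
      refine h1.congr_deriv ?_
      rw [h2, Real.sqrt_sq_eq_abs]
      field_simp
      rw [sq_abs, hP']
    · have h4 : ∀ᶠ y in 𝓝 s, 0 < y * s :=
        (continuousAt_const).eventually_lt (by fun_prop) (mul_self_pos.mpr hs0)
      filter_upwards [h4, isOpen_Ioo.mem_nhds hs] with y hy hyS
      rw [hPx y hyS, show 2 * (Pm + y ^ 2 / 2 - Pm) = y ^ 2 by ring, Real.sqrt_sq_eq_abs]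
      rcases lt_or_gt_of_ne hs0 with h1 | h1
      · have : y < 0 := by nlinarith
        rw [abs_of_neg h1, abs_of_neg this]; field_simp
      · have : 0 < y := by nlinarith
        rw [abs_of_pos h1, abs_of_pos this]; field_simp
  have hxco : ContinuousOn x (Ioo (-S) S) := fun s hs => (hxc s hs).continuousWithinAt
  have hWc := continuousOn_chartMass (p := p) (by linarith) hxco hx0
  have hw0 : ∀ s ∈ Ioo (-S) S, 0 < L + δ * chartMass p S x s := fun s hs => by
    have := mul_nonneg hδ (chartMass_nonneg (p := p) (x := x) hs)
    linarith
  -- Because P'(x) x' = s, the factor P' drops out of the derivative of P'(x)². Integrating along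
  -- the dilates t s starts at t = 0, where P' vanishes.
  have hkin : ∀ s ∈ Ioo (-S) S, s ≠ 0 → P' (x s) ^ 2 = s ^ 2 * (L + δ * chartMass p S x s) := by
    intro s hs hs0
    have hts : ∀ t ∈ Icc (0 : ℝ) 1, t * s ∈ Ioo (-S) S := fun t ht =>
      mul_mem_Ioo_of_abs_le_one (abs_le.mpr ⟨by linarith [ht.1], ht.2⟩) hs
    have hgc : Continuous (gap S) := continuous_iff_continuousAt.mpr fun s =>
      (hasDerivAt_gap S s).continuousAt
    have hxtc : ContinuousOn (fun t => x (t * s)) (Icc 0 1) := hxco.comp (by fun_prop) hts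
    have hGc : ContinuousOn (fun t => t ^ 1 * ((x (t * s))⁻¹ ^ 2 * gap S (t * s) ^ p))
        (Icc 0 1) := by
      refine (continuousOn_id.pow 1).mul (((hxtc.inv₀ fun t ht => (hx0 _ (hts t ht)).ne').pow 2).mul
        (ContinuousOn.rpow_const ?_ fun _ _ => Or.inr (by linarith)))
      exact (hgc.comp (continuous_id.mul continuous_const)).continuousOn
    have hint : IntervalIntegrable (fun t => t ^ 1 * ((x (t * s))⁻¹ ^ 2 * gap S (t * s) ^ p))
        volume 0 1 := by
      refine ContinuousOn.intervalIntegrable ?_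
      rwa [uIcc_of_le zero_le_one]
    have hFTC := intervalIntegral.integral_eq_sub_of_hasDerivAt_of_le (a := 0) (b := 1)
      (f := fun t => P' (x (t * s)) ^ 2)
      (f' := fun t => 2 * s ^ 2 * L * t
        + 2 * s ^ 2 * δ * (t ^ 1 * ((x (t * s))⁻¹ ^ 2 * gap S (t * s) ^ p)))
      zero_le_one ((hP'c.comp hxtc fun t ht => hx0 _ (hts t ht)).pow 2)
      (fun t ht => by
        have hm := hts t (Ioo_subset_Icc_self ht)
        have hts0 : t * s ≠ 0 := mul_ne_zero ht.1.ne' hs0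
        have h1 := (hxd _ hm hts0).comp t ((hasDerivAt_id t).mul_const s)
        have h2 := ((hP'd _ (hx0 _ hm)).comp t h1).pow 2
        refine h2.congr_deriv ?_
        have h3 : κ - P (x (t * s)) = gap S (t * s) := by
          rw [hPx _ hm]; unfold gap; rw [hSsq]; ring
        have h4 := hsign _ hm hts0
        have h5 : P' (x (t * s)) ≠ 0 := fun h => by simp [h] at h4
        simp only [Function.comp_apply, id]
        rw [h3, max_eq_left (gap_pos hm).le]
        push_cast
        field_simp)
      ((Continuous.intervalIntegrable (by fun_prop) _ _).add (hint.const_mul _))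
    rw [intervalIntegral.integral_add (Continuous.intervalIntegrable (by fun_prop) _ _)
      (hint.const_mul _), intervalIntegral.integral_const_mul, intervalIntegral.integral_const_mul,
      integral_id] at hFTC
    simp only [zero_mul, one_mul, hxz, hu₀'] at hFTC
    unfold chartMass
    linarith
  have hroot : ∀ s ∈ Ioo (-S) S, s ≠ 0 → √(L + δ * chartMass p S x s) = P' (x s) / s := by
    intro s hs hs0
    rw [Real.sqrt_eq_iff_mul_self_eq (hw0 s hs).le (hsign s hs hs0).le, div_mul_div_comm, ← pow_two,
      ← pow_two, hkin s hs hs0]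
    field_simp
  have hxd' : ∀ s ∈ Ioo (-S) S, HasDerivAt x (√(L + δ * chartMass p S x s))⁻¹ s := by
    have hne : ∀ s ∈ Ioo (-S) S, s ≠ 0 → HasDerivAt x (√(L + δ * chartMass p S x s))⁻¹ s :=
      fun s hs hs0 => by rw [hroot s hs hs0]; exact hxd s hs hs0
    intro s hs
    rcases eq_or_ne s 0 with rfl | hs0
    · refine hasDerivAt_of_punctured (g := fun s => (√(L + δ * chartMass p S x s))⁻¹) hs hne
        (hxc 0 hs) ?_
      refine ContinuousAt.inv₀ (ContinuousAt.sqrt (continuousAt_const.add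
        (continuousAt_const.mul (hWc.continuousAt (isOpen_Ioo.mem_nhds hs))))) ?_
      exact (Real.sqrt_pos.mpr (hw0 0 hs)).ne'
    · exact hne s hs hs0
  refine ⟨x, S, Pm, hS0, hSsq, hPm1, hPm2, hmin, fun s hs => (hxm s hs).1, fun s hs => (hxm s hs).2,
    hPx, hsurj, hxd', hxz ▸ hu₀.1, ?_⟩
  -- P'(u₀) = 0 reads L u₀ = M + μ(u₀), and μ ≤ B δ.
  rw [hxz, ← add_div, le_div_iff₀ hL]
  have := h.mass_le u₀ hu₀0
  simp only [hP'] at hu₀'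
  linarith

/-! ### Derivatives of the period in the energy chart -/

/-- The integral `∫ cosⁿ θ f (A sin θ) dθ` over `[-π/2, π/2]`. -/
noncomputable def cosIntegral (n : ℕ) (f : ℝ → ℝ) (A : ℝ) : ℝ :=
  ∫ θ in (-(Real.pi / 2))..(Real.pi / 2), Real.cos θ ^ n * f (Real.sin θ * A)

theorem continuousOn_cosIntegral (n : ℕ) {S : ℝ} {f : ℝ → ℝ} (hf : ContinuousOn f (Ioo (-S) S)) :
    ContinuousOn (cosIntegral n f) (Ioo (-S) S) :=
  continuousOn_integral_comp_mul Real.continuous_sin (Real.continuous_cos.pow n)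
    (fun t _ => Real.abs_sin_le_one t) hf

/-- Integration by parts: cosⁿ sin is the derivative of -cosⁿ⁺¹/(n + 1), whose boundary values
vanish, and differentiating f'(A sin θ) in θ yields A cos θ f''. -/
theorem hasDerivAt_cosIntegral (n : ℕ) {S A : ℝ} {f f' f'' : ℝ → ℝ}
    (hf : ∀ s ∈ Ioo (-S) S, HasDerivAt f (f' s) s) (hf' : ∀ s ∈ Ioo (-S) S, HasDerivAt f' (f'' s) s)
    (hf'' : ContinuousOn f'' (Ioo (-S) S)) (hA : A ∈ Ioo (-S) S) :
    HasDerivAt (cosIntegral n f) (A / (n + 1) * cosIntegral (n + 2) f'' A) A := by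
  have hf'c : ContinuousOn f' (Ioo (-S) S) := fun s hs =>
    (hf' s hs).continuousAt.continuousWithinAt
  have h1 := hasDerivAt_integral_comp_mul (a := -(Real.pi / 2)) (b := Real.pi / 2)
    Real.continuous_sin (Real.continuous_cos.pow n)
    (fun t _ => Real.abs_sin_le_one t) hf hf'c hA
  simp only [Pi.pow_apply] at h1
  refine h1.congr_deriv ?_
  have hsin : ∀ t, Real.sin t * A ∈ Ioo (-S) S := fun t =>
    mul_mem_Ioo_of_abs_le_one (Real.abs_sin_le_one t) hA
  have hn : ((n : ℝ) + 1) ≠ 0 := by positivity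
  have hc1 : Continuous fun θ => f' (Real.sin θ * A) :=
    hf'c.comp_continuous (by fun_prop) hsin
  have hc2 : Continuous fun θ => f'' (Real.sin θ * A) :=
    hf''.comp_continuous (by fun_prop) hsin
  have hi1 : IntervalIntegrable (fun θ => Real.cos θ ^ n * Real.sin θ * f' (Real.sin θ * A)) volume
      (-(Real.pi / 2)) (Real.pi / 2) :=
    (((Real.continuous_cos.pow n).mul Real.continuous_sin).mul hc1).intervalIntegrable _ _
  have hi2 : IntervalIntegrable (fun θ => A / (n + 1) * (Real.cos θ ^ (n + 2) *
      f'' (Real.sin θ * A))) volume (-(Real.pi / 2)) (Real.pi / 2) :=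
    (continuous_const.mul ((Real.continuous_cos.pow _).mul hc2)).intervalIntegrable _ _
  have h2 := intervalIntegral.integral_eq_sub_of_hasDerivAt
    (f := fun θ => -(Real.cos θ ^ (n + 1) / (n + 1)) * f' (Real.sin θ * A))
    (f' := fun θ => Real.cos θ ^ n * Real.sin θ * f' (Real.sin θ * A)
      - A / (n + 1) * (Real.cos θ ^ (n + 2) * f'' (Real.sin θ * A)))
    (a := -(Real.pi / 2)) (b := Real.pi / 2) (fun θ _ => by
      have k1 := (((Real.hasDerivAt_cos θ).pow (n + 1)).div_const ((n : ℝ) + 1)).neg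
      have k2 := (hf' _ (hsin θ)).comp θ ((Real.hasDerivAt_sin θ).mul_const A)
      refine (k1.mul k2).congr_deriv ?_
      simp only [Function.comp_apply, Nat.add_sub_cancel, Pi.pow_apply, Pi.neg_apply]
      push_cast
      field_simp
      ring) (hi1.sub hi2)
  rw [intervalIntegral.integral_sub hi1 hi2, intervalIntegral.integral_const_mul] at h2
  simp only [Real.cos_neg, Real.cos_pi_div_two] at h2
  rw [zero_pow (Nat.succ_ne_zero n)] at h2
  simp only [zero_div, neg_zero, zero_mul, sub_zero] at h2
  unfold cosIntegral
  linarith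

/-- The factor A cancels against dA/dE = 1/A, so nothing is singular as E ↓ m. Each energy
derivative costs two derivatives of f but gains cos². -/
theorem hasDerivAt_cosIntegral_sqrt (n : ℕ) {S E m : ℝ} {f f' f'' : ℝ → ℝ}
    (hf : ∀ s ∈ Ioo (-S) S, HasDerivAt f (f' s) s) (hf' : ∀ s ∈ Ioo (-S) S, HasDerivAt f' (f'' s) s)
    (hf'' : ContinuousOn f'' (Ioo (-S) S)) (hE : m < E) (hES : √(2 * (E - m)) < S) :
    HasDerivAt (fun E => cosIntegral n f √(2 * (E - m)))
      (cosIntegral (n + 2) f'' √(2 * (E - m)) / (n + 1)) E := by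
  have h0 : 0 < √(2 * (E - m)) := Real.sqrt_pos.mpr (by linarith)
  have h1 : HasDerivAt (fun E => √(2 * (E - m))) _ E :=
    (((hasDerivAt_id E).sub_const m).const_mul 2).sqrt
      (by simp only [id]; linarith)
  have h2 := hasDerivAt_cosIntegral n hf hf' hf'' ⟨by linarith, hES⟩
  refine (h2.comp E h1).congr_deriv ?_
  have hn : ((n : ℝ) + 1) ≠ 0 := by positivity
  simp only [id]
  field_simp

/-- The density `-r'(s)` of the inverse radius in the energy chart. -/
noncomputable def orbitDensity (L p δ S : ℝ) (x : ℝ → ℝ) (s : ℝ) : ℝ :=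
  (√(L + δ * chartMass p S x s))⁻¹ ^ 1 * (x s)⁻¹ ^ 2

/-- A family of energy charts, uniformly nondegenerate. -/
structure ChartFamily {ι : Type*} (M L κ p B R : ℝ) (δ S Pm : ι → ℝ) (P x : ι → ℝ → ℝ) : Prop where
  chart : ∀ i, EnergyChart M L κ p (δ i) B (P i) (x i) (S i) (Pm i)
  nonneg : ∀ i, 0 ≤ δ i
  le_one : ∀ i, δ i ≤ 1
  le_sq : ∀ i, R ≤ S i ^ 2

namespace ChartFamily

variable {ι : Type*} {M L κ p B R : ℝ} {δ S Pm : ι → ℝ} {P x : ι → ℝ → ℝ}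

theorem sq_le (h : ChartFamily M L κ p B R δ S Pm P x) (i : ι) :
    S i ^ 2 ≤ 2 * (κ + M ^ 2 / (2 * L)) := by
  rw [(h.chart i).sq_eq]; linarith [(h.chart i).le_min]

theorem le_coeff (h : ChartFamily M L κ p B R δ S Pm P x) (i : ι) {s : ℝ}
    (hs : s ∈ Ioo (-S i) (S i)) : L ≤ L + δ i * chartMass p (S i) (x i) s := by
  have := mul_nonneg (h.nonneg i) (chartMass_nonneg (p := p) (x := x i) hs)
  linarith

theorem half_superadd (a b : ℕ) : a / 2 + b / 2 ≤ (a + b) / 2 := by omega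

theorem apply_pos (hM : 0 < M) (hκ : κ < 0) (h : ChartFamily M L κ p B R δ S Pm P x) (i : ι) {s : ℝ}
    (hs : s ∈ Ioo (-S i) (S i)) : 0 < x i s :=
  lt_of_lt_of_le (div_pos (by linarith) hM) ((h.chart i).le_apply s hs)

/-- The rate of `x` is relaxed to `l - 1` so that it can be multiplied by gap^p; the average
restores `l / 2`. -/
theorem tame_chartMass (hM : 0 < M) (hκ : κ < 0) (hp : 1 < p) (hR : 0 < R)
    (h : ChartFamily M L κ p B R δ S Pm P x) {n : ℕ} (hn : n ≤ 4)
    (hx : Tame S (fun l => l / 2) n 0 x) :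
    Tame S (fun l => l / 2) n 0 (fun i s => chartMass p (S i) (x i) s) := by
  have hx1 : Tame S (fun l => l - 1) n 0 x := hx.weaken h.sq_le fun j _ => by omega
  have hκM : 0 < -κ / M := div_pos (by linarith) hM
  have hx2 := (hx1.inv h.sq_le (fun a b => by omega) hκM
    fun i s hs => (h.chart i).le_apply s hs).pow h.sq_le (fun a b => by omega) 2
  have hx3 := hx2.mul h.sq_le (fun a b => by omega)
    (tame_gap_rpow (q := p) (l := 0) (n := n) h.sq_le (by simp; linarith) fun _ => hp.le)
  have hx4 := hx3.average hR h.le_sq (m := 1) le_rfl (by omega)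
  exact hx4.const_mul (c := fun _ => 2) (K := 2) (by simp)

theorem tame_coeff (hM : 0 < M) (hκ : κ < 0) (hp : 1 < p) (hR : 0 < R)
    (h : ChartFamily M L κ p B R δ S Pm P x) {n : ℕ} (hn : n ≤ 4)
    (hx : Tame S (fun l => l / 2) n 0 x) :
    Tame S (fun l => l / 2) n 0 (fun i s => L + δ i * chartMass p (S i) (x i) s) := by
  have h1 := (h.tame_chartMass hM hκ hp hR hn hx).const_mul (c := δ) (K := 1) fun i => by
    rw [abs_of_nonneg (h.nonneg i)]; exact h.le_one i
  exact (Tame.const (c := fun _ => L) (K := |L|) (by simp) h.sq_le).add h1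

theorem tame_speed (hM : 0 < M) (hL : 0 < L) (hκ : κ < 0) (hp : 1 < p) (hR : 0 < R)
    (h : ChartFamily M L κ p B R δ S Pm P x) {n : ℕ} (hn : n ≤ 4)
    (hx : Tame S (fun l => l / 2) n 0 x) :
    Tame S (fun l => l / 2) n 0 (fun i s => (√(L + δ i * chartMass p (S i) (x i) s))⁻¹) :=
  (h.tame_coeff hM hκ hp hR hn hx).inv_sqrt h.sq_le half_superadd hL fun i _ hs => h.le_coeff i hs

/-- Bootstrap: n controlled derivatives of `x` give n of `chartMass`, hence n of x' = (L + δ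
W)^(-1/2), hence n + 1 of `x`. -/
theorem tame_chart (hM : 0 < M) (hL : 0 < L) (hκ : κ < 0) (hp : 1 < p) (hR : 0 < R)
    (h : ChartFamily M L κ p B R δ S Pm P x) {n : ℕ} (hn : n ≤ 4) :
    Tame S (fun l => l / 2) n 0 x := by
  have hb : GapBound S (0 / 2) x := by
    refine GapBound.of_bounded (K := 2 * M / L) fun i s hs => ?_
    rw [abs_of_pos (h.apply_pos hM hκ i hs)]
    exact (h.chart i).apply_le s hs
  induction n with
  | zero => exact ⟨hb, fun i s hs => ((h.chart i).hasDerivAt s hs).continuousAt.continuousWithinAt⟩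
  | succ n ih =>
    refine ⟨hb, _, fun i s hs => (h.chart i).hasDerivAt s hs, ?_⟩
    refine (h.tame_speed hM hL hκ hp hR (by omega) (ih (by omega))).weaken h.sq_le fun j _ => ?_
    omega

/-- One step in the computation of the derivatives of the orbit density: up to a perturbation of
size `δ` they are those of the Kepler problem. -/
theorem exists_deriv_remainder (hM : 0 < M) (hL : 0 < L) (hκ : κ < 0) (hp : 1 < p) (hR : 0 < R)
    (h : ChartFamily M L κ p B R δ S Pm P x) (C : ℝ) (j : ℕ) {n : ℕ} (hn : n ≤ 3)
    {r : ι → ℝ → ℝ} (hr : Tame S (fun l => l / 2) (n + 1) j r) :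
    ∃ r' : ι → ℝ → ℝ, Tame S (fun l => l / 2) n (j + 1) r' ∧
      ∀ i, ∀ s ∈ Ioo (-S i) (S i), HasDerivAt
        (fun s => C * ((√(L + δ i * chartMass p (S i) (x i) s))⁻¹ ^ (j + 1) * (x i s)⁻¹ ^ (j + 2))
          + δ i * r i s)
        (-(j + 2) * C * ((√(L + δ i * chartMass p (S i) (x i) s))⁻¹ ^ (j + 2)
          * (x i s)⁻¹ ^ (j + 3)) + δ i * r' i s) s := by
  have hκM : 0 < -κ / M := div_pos (by linarith) hM
  have hx4 := h.tame_chart hM hL hκ hp hR le_rfl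
  have hW4 := h.tame_chartMass hM hκ hp hR le_rfl hx4
  have hv := (h.tame_speed hM hL hκ hp hR le_rfl hx4).of_le (m := n) (by omega)
  have hxi := (hx4.inv h.sq_le half_superadd hκM
    fun i s hs => (h.chart i).le_apply s hs).of_le (m := n) (by omega)
  obtain ⟨_, W', hWd, hW'⟩ := hW4
  have hW' := hW'.of_le hn
  obtain ⟨_, rd, hrd, hr'⟩ := hr
  -- Write v = x' = (L + δ W)^(-1/2). Differentiating the power of x⁻¹ brings out another v and
  -- gives the next Kepler monomial; differentiating the power of v uses v' = -v³ δ W'/2, which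
  -- carries a factor δ and joins the remainder.
  refine ⟨fun i s => rd i s + (-(1 / 2) * (C * (j + 1))) *
    (((√(L + δ i * chartMass p (S i) (x i) s))⁻¹ ^ (j + 3) * (x i s)⁻¹ ^ (j + 2)) * W' i s),
    ?_, ?_⟩
  · refine hr'.add ?_
    have h1 := ((hv.pow h.sq_le half_superadd (j + 3)).mul h.sq_le half_superadd
      (hxi.pow h.sq_le half_superadd (j + 2))).mul h.sq_le half_superadd hW'
    refine Tame.const_mul (c := fun _ => -(1 / 2) * (C * (j + 1)))
      (K := |-(1 / 2) * (C * (j + 1))|) (fun _ => le_rfl) (h1.weaken h.sq_le fun a _ => ?_)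
    omega
  · intro i s hs
    have hw : 0 < L + δ i * chartMass p (S i) (x i) s := hL.trans_le (h.le_coeff i hs)
    have hx0 := h.apply_pos hM hκ i hs
    have hvd := hasDerivAt_inv_sqrt (((hWd i s hs).const_mul (δ i)).const_add L) hw
    have hxd := ((h.chart i).hasDerivAt s hs).inv hx0.ne'
    have k := (((hvd.pow (j + 1)).mul (hxd.pow (j + 2))).const_mul C).add
      ((hrd i s hs).const_mul (δ i))
    refine k.congr_deriv ?_
    have hv0 := Real.sqrt_pos.mpr hw
    simp only [Pi.pow_apply, Pi.inv_apply]
    generalize √(L + δ i * chartMass p (S i) (x i) s) = v at *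
    generalize x i s = y at *
    rw [show j + 1 - 1 = j by omega, show j + 2 - 1 = j + 1 by omega]
    push_cast
    simp only [pow_succ, div_eq_mul_inv, mul_inv]
    ring

end ChartFamily

/-- As A² ≤ S², the gap at A sin θ is at least S² cos²θ / 2. -/
theorem cos_sq_le_gap {S A θ R : ℝ} (hR : 0 < R) (hRS : R ≤ S ^ 2) (hA : A ∈ Ioo (-S) S) :
    Real.cos θ ^ 2 ≤ 2 / R * gap S (Real.sin θ * A) := by
  have h1 : A ^ 2 ≤ S ^ 2 := by nlinarith [hA.1, hA.2]
  have h2 := Real.sin_sq_add_cos_sq θ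
  rw [div_mul_eq_mul_div, le_div_iff₀ hR]
  unfold gap
  nlinarith [mul_le_mul_of_nonneg_left h1 (sq_nonneg (Real.sin θ)),
    mul_le_mul_of_nonneg_left hRS (sq_nonneg (Real.cos θ))]

/-- The weight cos²ᵐ compensates an error of size gap⁻ᵐ, so `f` may be replaced by its bounded main
part `g`, uniformly up to the end A → S. -/
theorem cosIntegral_bounds {S A R a b K : ℝ} (m : ℕ) {f g : ℝ → ℝ} (hR : 0 < R) (hRS : R ≤ S ^ 2)
    (hA : A ∈ Ioo (-S) S) (hf : ContinuousOn f (Ioo (-S) S)) (ha : 0 ≤ a)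
    (hga : ∀ s ∈ Ioo (-S) S, a ≤ g s) (hgb : ∀ s ∈ Ioo (-S) S, g s ≤ b)
    (hfg : ∀ s ∈ Ioo (-S) S, |f s - g s| * gap S s ^ m ≤ K) :
    a * (∫ θ in (-(Real.pi / 2))..(Real.pi / 2), Real.cos θ ^ (2 * m)) - Real.pi * ((2 / R) ^ m * K)
      ≤ cosIntegral (2 * m) f A ∧
    cosIntegral (2 * m) f A ≤ Real.pi * (b + (2 / R) ^ m * K) := by
  have hsin : ∀ t, Real.sin t * A ∈ Ioo (-S) S := fun t =>
    mul_mem_Ioo_of_abs_le_one (Real.abs_sin_le_one t) hA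
  have hpi : -(Real.pi / 2) ≤ Real.pi / 2 := by linarith [Real.pi_pos]
  have hc : Continuous fun θ => f (Real.sin θ * A) := hf.comp_continuous (by fun_prop) hsin
  have hi : IntervalIntegrable (fun θ => Real.cos θ ^ (2 * m) * f (Real.sin θ * A)) volume
      (-(Real.pi / 2)) (Real.pi / 2) := ((Real.continuous_cos.pow _).mul hc).intervalIntegrable _ _
  have hcos0 : ∀ θ, 0 ≤ Real.cos θ ^ (2 * m) := fun θ => by rw [pow_mul]; positivity
  have hcos1 : ∀ θ, Real.cos θ ^ (2 * m) ≤ 1 := fun θ => by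
    rw [pow_mul]
    exact pow_le_one₀ (sq_nonneg _) (Real.cos_sq_le_one θ)
  have hb : 0 ≤ b := ha.trans ((hga _ (hsin 0)).trans (hgb _ (hsin 0)))
  have herr : ∀ θ, Real.cos θ ^ (2 * m) * |f (Real.sin θ * A) - g (Real.sin θ * A)|
      ≤ (2 / R) ^ m * K := by
    intro θ
    have h1 : Real.cos θ ^ (2 * m) ≤ (2 / R * gap S (Real.sin θ * A)) ^ m := by
      rw [pow_mul]
      exact pow_le_pow_left₀ (sq_nonneg _) (cos_sq_le_gap hR hRS hA) m
    calc _ ≤ (2 / R * gap S (Real.sin θ * A)) ^ m * |f (Real.sin θ * A) - g (Real.sin θ * A)| :=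
          mul_le_mul_of_nonneg_right h1 (abs_nonneg _)
      _ = (2 / R) ^ m * (|f (Real.sin θ * A) - g (Real.sin θ * A)|
          * gap S (Real.sin θ * A) ^ m) := by rw [mul_pow]; ring
      _ ≤ _ := mul_le_mul_of_nonneg_left (hfg _ (hsin θ)) (by positivity)
  constructor
  · have h1 := intervalIntegral.integral_mono_on hpi
      (f := fun θ => Real.cos θ ^ (2 * m) * a - (2 / R) ^ m * K)
      (g := fun θ => Real.cos θ ^ (2 * m) * f (Real.sin θ * A))
      (Continuous.intervalIntegrable (by fun_prop) _ _) hi fun θ _ => by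
        have h2 := herr θ
        have h3 := neg_abs_le (f (Real.sin θ * A) - g (Real.sin θ * A))
        have h4 := mul_le_mul_of_nonneg_left h3 (hcos0 θ)
        have h5 := mul_le_mul_of_nonneg_left (hga _ (hsin θ)) (hcos0 θ)
        linarith
    rw [intervalIntegral.integral_sub (Continuous.intervalIntegrable (by fun_prop) _ _) (by simp),
      intervalIntegral.integral_mul_const, intervalIntegral.integral_const, smul_eq_mul,
      show Real.pi / 2 - -(Real.pi / 2) = Real.pi by ring] at h1
    unfold cosIntegral
    linarith
  · have h1 := intervalIntegral.integral_mono_on hpi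
      (f := fun θ => Real.cos θ ^ (2 * m) * f (Real.sin θ * A))
      (g := fun θ => b + (2 / R) ^ m * K) hi (by simp) fun θ _ => by
        have h2 := herr θ
        have h3 := le_abs_self (f (Real.sin θ * A) - g (Real.sin θ * A))
        have h4 := mul_le_mul_of_nonneg_left h3 (hcos0 θ)
        have h5 := mul_le_mul_of_nonneg_left (hgb _ (hsin θ)) (hcos0 θ)
        have h6 := mul_le_mul_of_nonneg_right (hcos1 θ) hb
        linarith
    rw [intervalIntegral.integral_const, smul_eq_mul,
      show Real.pi / 2 - -(Real.pi / 2) = Real.pi by ring] at h1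
    exact h1

theorem integral_cos_pow_pos (m : ℕ) :
    0 < ∫ θ in (-(Real.pi / 2))..(Real.pi / 2), Real.cos θ ^ m := by
  refine intervalIntegral.intervalIntegral_pos_of_pos_on
    (Continuous.intervalIntegrable (by fun_prop) _ _) (fun θ hθ => ?_) (by linarith [Real.pi_pos])
  exact pow_pos (Real.cos_pos_of_mem_Ioo hθ) m

/-- The period as a function of the energy `E` above the potential at the origin. -/
noncomputable def chartPeriod (L p δ S Pm : ℝ) (x : ℝ → ℝ) (E : ℝ) : ℝ :=
  2 * cosIntegral 0 (orbitDensity L p δ S x) √(2 * (E - Pm))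

namespace ChartFamily

variable {ι : Type*} {M L κ p B R : ℝ} {δ S Pm : ι → ℝ} {P x : ι → ℝ → ℝ}

theorem exists_chartMass_le (hM : 0 < M) (hL : 0 < L) (hκ : κ < 0) (hp : 1 < p) (hR : 0 < R)
    (h : ChartFamily M L κ p B R δ S Pm P x) :
    ∃ K, 0 ≤ K ∧ ∀ i, ∀ s ∈ Ioo (-S i) (S i), chartMass p (S i) (x i) s ≤ K := by
  obtain ⟨K, hK0, hK⟩ := (h.tame_chartMass hM hκ hp hR (Nat.zero_le 4)
    (h.tame_chart hM hL hκ hp hR (Nat.zero_le 4))).gapBound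
  exact ⟨K, hK0, fun i s hs => (le_abs_self _).trans (by simpa using hK i s hs)⟩

/-- Bounds for the quantities in which the Kepler parts of the derivatives are monomials. -/
theorem exists_monomial_bounds (hM : 0 < M) (hL : 0 < L) (hκ : κ < 0) (hp : 1 < p) (hR : 0 < R)
    (h : ChartFamily M L κ p B R δ S Pm P x) (a b : ℕ) :
    ∃ c C, 0 < c ∧ ∀ i, ∀ s ∈ Ioo (-S i) (S i),
      c ≤ (√(L + δ i * chartMass p (S i) (x i) s))⁻¹ ^ a * (x i s)⁻¹ ^ b ∧
      (√(L + δ i * chartMass p (S i) (x i) s))⁻¹ ^ a * (x i s)⁻¹ ^ b ≤ C := by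
  obtain ⟨K, hK0, hK⟩ := h.exists_chartMass_le hM hL hκ hp hR
  have hκM : 0 < -κ / M := div_pos (by linarith) hM
  refine ⟨(√(L + K))⁻¹ ^ a * (2 * M / L)⁻¹ ^ b, (√L)⁻¹ ^ a * (-κ / M)⁻¹ ^ b, ?_, fun i s hs => ?_⟩
  · have : 0 < √(L + K) := Real.sqrt_pos.mpr (by linarith)
    positivity
  · have h0 := Real.sqrt_pos.mpr hL
    have h1 : √L ≤ √(L + δ i * chartMass p (S i) (x i) s) := Real.sqrt_le_sqrt (h.le_coeff i hs)
    have h2 : √(L + δ i * chartMass p (S i) (x i) s) ≤ √(L + K) := by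
      refine Real.sqrt_le_sqrt ?_
      have := mul_le_mul (h.le_one i) (hK i s hs) (chartMass_nonneg hs) zero_le_one
      linarith
    have h3 : 0 < √(L + δ i * chartMass p (S i) (x i) s) := h0.trans_le h1
    have h4 := h.apply_pos hM hκ i hs
    have h5 := (h.chart i).le_apply s hs
    have h6 := (h.chart i).apply_le s hs
    constructor <;> gcongr

theorem exists_orbitDensity_derivs (hM : 0 < M) (hL : 0 < L) (hκ : κ < 0) (hp : 1 < p) (hR : 0 < R)
    (h : ChartFamily M L κ p B R δ S Pm P x) :
    ∃ f₁ f₂ f₃ f₄ r₂ r₄ : ι → ℝ → ℝ, (∀ i, ∀ s ∈ Ioo (-S i) (S i),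
      HasDerivAt (orbitDensity L p (δ i) (S i) (x i)) (f₁ i s) s ∧ HasDerivAt (f₁ i) (f₂ i s) s ∧
      HasDerivAt (f₂ i) (f₃ i s) s ∧ HasDerivAt (f₃ i) (f₄ i s) s) ∧
      (∀ i, ContinuousOn (f₄ i) (Ioo (-S i) (S i))) ∧ GapBound S 1 r₂ ∧ GapBound S 2 r₄ ∧
      (∀ i s, f₂ i s = 6 * ((√(L + δ i * chartMass p (S i) (x i) s))⁻¹ ^ 3 * (x i s)⁻¹ ^ 4)
        + δ i * r₂ i s) ∧
      (∀ i s, f₄ i s = 120 * ((√(L + δ i * chartMass p (S i) (x i) s))⁻¹ ^ 5 * (x i s)⁻¹ ^ 6)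
        + δ i * r₄ i s) := by
  -- The constants 1, -2, 6, -24, 120 are those of the successive derivatives of x⁻². The remainder
  -- starts at 0; each step spends one derivative and raises the order of singularity by one.
  obtain ⟨r₁, t₁, d₁⟩ := h.exists_deriv_remainder hM hL hκ hp hR 1 0 (n := 3) le_rfl
    (r := fun _ _ => 0) (Tame.const (c := fun _ => 0) (K := 0) (by simp) h.sq_le)
  obtain ⟨r₂, t₂, d₂⟩ := h.exists_deriv_remainder hM hL hκ hp hR (-2) 1 (n := 2) (by norm_num) t₁
  obtain ⟨r₃, t₃, d₃⟩ := h.exists_deriv_remainder hM hL hκ hp hR 6 2 (n := 1) (by norm_num) t₂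
  obtain ⟨r₄, t₄, d₄⟩ := h.exists_deriv_remainder hM hL hκ hp hR (-24) 3 (n := 0) (by norm_num) t₃
  norm_num at d₁ d₂ d₃ d₄
  have hκM : 0 < -κ / M := div_pos (by linarith) hM
  have hx4 := h.tame_chart hM hL hκ hp hR (Nat.zero_le 4)
  have hv := h.tame_speed hM hL hκ hp hR (Nat.zero_le 4) hx4
  have hxi := hx4.inv h.sq_le half_superadd hκM fun i s hs => (h.chart i).le_apply s hs
  simp only [← inv_pow] at d₁ d₂ d₃ d₄
  refine ⟨_, _, _, _, r₂, r₄, fun i s hs => ⟨?_, d₂ i s hs.1 hs.2, d₃ i s hs.1 hs.2,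
    d₄ i s hs.1 hs.2⟩, ?_, t₂.gapBound, t₄.gapBound, fun i s => rfl, fun i s => rfl⟩
  · have := d₁ i s hs.1 hs.2
    unfold orbitDensity
    simpa only [pow_one] using this
  · intro i
    exact (continuousOn_const.mul (((hv.continuousOn i).pow 5).mul ((hxi.continuousOn i).pow 6))).add
      (continuousOn_const.mul (t₄.continuousOn i))

theorem sqrt_mem (h : ChartFamily M L κ p B R δ S Pm P x) (i : ι) {E : ℝ}
    (hE : E ∈ Ioo (Pm i) κ) : √(2 * (E - Pm i)) ∈ Ioo (-S i) (S i) := by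
  have hS := (h.chart i).pos
  refine ⟨(neg_lt_zero.mpr hS).trans_le (Real.sqrt_nonneg _), ?_⟩
  rw [Real.sqrt_lt' hS, (h.chart i).sq_eq]
  linarith [hE.2]

theorem exists_period_bounds (hM : 0 < M) (hL : 0 < L) (hκ : κ < 0) (hp : 1 < p) (hR : 0 < R)
    (h : ChartFamily M L κ p B R δ S Pm P x) :
    ∃ T' T'' : ι → ℝ → ℝ, ∃ c C K : ℝ, 0 < c ∧ 0 ≤ K ∧ ∀ i, ∀ E ∈ Ioo (Pm i) κ,
      (HasDerivAt (chartPeriod L p (δ i) (S i) (Pm i) (x i)) (T' i E) E ∧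
        HasDerivAt (T' i) (T'' i E) E ∧ ContinuousAt (T'' i) E) ∧
      (c - K * δ i ≤ chartPeriod L p (δ i) (S i) (Pm i) (x i) E ∧
        chartPeriod L p (δ i) (S i) (Pm i) (x i) E ≤ C) ∧
      (c - K * δ i ≤ T' i E ∧ T' i E ≤ C) ∧ (c - K * δ i ≤ T'' i E ∧ T'' i E ≤ C) := by
  obtain ⟨f₁, f₂, f₃, f₄, r₂, r₄, hd, hc₄, ⟨K₂, hK₂0, hK₂⟩, ⟨K₄, hK₄0, hK₄⟩, hf₂, hf₄⟩ :=
    h.exists_orbitDensity_derivs hM hL hκ hp hR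
  obtain ⟨c₀, C₀, hc₀, hb₀⟩ := h.exists_monomial_bounds hM hL hκ hp hR 1 2
  obtain ⟨c₂, C₂, hc₂, hb₂⟩ := h.exists_monomial_bounds hM hL hκ hp hR 3 4
  obtain ⟨c₄, C₄, hc4, hb₄⟩ := h.exists_monomial_bounds hM hL hκ hp hR 5 6
  set J : ℕ → ℝ := fun m => ∫ θ in (-(Real.pi / 2))..(Real.pi / 2), Real.cos θ ^ (2 * m) with hJ
  have hJ0 : ∀ m, 0 < J m := fun m => integral_cos_pow_pos _
  have hpi := Real.pi_pos
  have hc₂f : ∀ i, ContinuousOn (f₂ i) (Ioo (-S i) (S i)) := fun i s hs =>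
    (hd i s hs).2.2.1.continuousAt.continuousWithinAt
  have hc₀f : ∀ i, ContinuousOn (orbitDensity L p (δ i) (S i) (x i)) (Ioo (-S i) (S i)) :=
    fun i s hs => (hd i s hs).1.continuousAt.continuousWithinAt
  set a₀ := 2 * (c₀ * J 0) with ha₀
  set a₂ := 2 * (6 * c₂ * J 1) with ha₂
  set a₄ := 2 / 3 * (120 * c₄ * J 2) with ha₄
  have ha₀0 : 0 < a₀ := by have := hJ0 0; positivity
  have ha₂0 : 0 < a₂ := by have := hJ0 1; positivity
  have ha₄0 : 0 < a₄ := by have := hJ0 2; positivity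
  set k₂ := 2 * (Real.pi * ((2 / R) ^ 1 * K₂)) with hk₂
  set k₄ := 2 / 3 * (Real.pi * ((2 / R) ^ 2 * K₄)) with hk₄
  have hk₂0 : 0 ≤ k₂ := by positivity
  have hk₄0 : 0 ≤ k₄ := by positivity
  -- Two applications of `hasDerivAt_cosIntegral_sqrt`, with n = 0 and then n = 2; the latter
  -- contributes the 1/3.
  refine ⟨fun i E => 2 * cosIntegral 2 (f₂ i) √(2 * (E - Pm i)),
    fun i E => 2 / 3 * cosIntegral 4 (f₄ i) √(2 * (E - Pm i)),
    min a₀ (min a₂ a₄), max (2 * (Real.pi * C₀)) (max (2 * (Real.pi * (6 * C₂)) + k₂)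
      (2 / 3 * (Real.pi * (120 * C₄)) + k₄)), k₂ + k₄, by positivity, by positivity, ?_⟩
  intro i E hE
  have hA := h.sqrt_mem i hE
  have hδ0 := h.nonneg i
  have hδ1 := h.le_one i
  have hSR := h.le_sq i
  -- The undifferentiated density is itself a monomial, so it is its own main part, with no error.
  have e₀ := cosIntegral_bounds 0 (K := 0) (a := c₀) (b := C₀) hR hSR hA (hc₀f i) hc₀.le
    (g := orbitDensity L p (δ i) (S i) (x i)) (fun s hs => (hb₀ i s hs).1)
    (fun s hs => (hb₀ i s hs).2) (fun s hs => by simp)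
  have e₂ := cosIntegral_bounds 1 (K := K₂ * δ i) (a := 6 * c₂) (b := 6 * C₂) hR hSR hA (hc₂f i)
    (by positivity)
    (g := fun s => 6 * ((√(L + δ i * chartMass p (S i) (x i) s))⁻¹ ^ 3 * (x i s)⁻¹ ^ 4))
    (fun s hs => by linarith [(hb₂ i s hs).1]) (fun s hs => by linarith [(hb₂ i s hs).2])
    (fun s hs => by
      have := hK₂ i s hs
      rw [hf₂, add_sub_cancel_left, abs_mul, abs_of_nonneg hδ0]
      nlinarith)
  have e₄ := cosIntegral_bounds 2 (K := K₄ * δ i) (a := 120 * c₄) (b := 120 * C₄) hR hSR hA (hc₄ i)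
    (by positivity)
    (g := fun s => 120 * ((√(L + δ i * chartMass p (S i) (x i) s))⁻¹ ^ 5 * (x i s)⁻¹ ^ 6))
    (fun s hs => by linarith [(hb₄ i s hs).1]) (fun s hs => by linarith [(hb₄ i s hs).2])
    (fun s hs => by
      have := hK₄ i s hs
      rw [hf₄, add_sub_cancel_left, abs_mul, abs_of_nonneg hδ0]
      nlinarith)
  have g₂ := mul_le_mul_of_nonneg_left hδ1 hk₂0
  have g₄ := mul_le_mul_of_nonneg_left hδ1 hk₄0
  have g₂' := mul_nonneg hk₂0 hδ0
  have g₄' := mul_nonneg hk₄0 hδ0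
  have m₀ : min a₀ (min a₂ a₄) ≤ a₀ := min_le_left _ _
  have m₂ : min a₀ (min a₂ a₄) ≤ a₂ := (min_le_right _ _).trans (min_le_left _ _)
  have m₄ : min a₀ (min a₂ a₄) ≤ a₄ := (min_le_right _ _).trans (min_le_right _ _)
  have q₂ : Real.pi * ((2 / R) ^ 1 * (K₂ * δ i)) = k₂ * δ i / 2 := by rw [hk₂]; ring
  have q₄ : Real.pi * ((2 / R) ^ 2 * (K₄ * δ i)) = 3 / 2 * (k₄ * δ i) := by rw [hk₄]; ring
  rw [mul_add Real.pi, q₂] at e₂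
  rw [mul_add Real.pi, q₄] at e₄
  simp only [mul_zero, add_zero, sub_zero] at e₀
  simp only [Nat.reduceMul] at e₂ e₄
  refine ⟨⟨?_, ?_, ?_⟩, ⟨?_, le_max_of_le_left ?_⟩, ⟨?_, le_max_of_le_right (le_max_of_le_left ?_)⟩,
    ⟨?_, le_max_of_le_right (le_max_of_le_right ?_)⟩⟩
  · have := hasDerivAt_cosIntegral_sqrt 0 (fun s hs => (hd i s hs).1) (fun s hs => (hd i s hs).2.1)
      (hc₂f i) hE.1 hA.2
    refine (this.const_mul 2).congr_deriv ?_
    norm_num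
  · have := hasDerivAt_cosIntegral_sqrt 2 (fun s hs => (hd i s hs).2.2.1)
      (fun s hs => (hd i s hs).2.2.2) (hc₄ i) hE.1 hA.2
    refine (this.const_mul 2).congr_deriv ?_
    norm_num
    ring
  · refine continuousAt_const.mul ?_
    exact ContinuousAt.comp (f := fun E => √(2 * (E - Pm i)))
      ((continuousOn_cosIntegral 4 (hc₄ i)).continuousAt (isOpen_Ioo.mem_nhds hA)) (by fun_prop)
  · unfold chartPeriod; simp only [hJ, mul_zero] at ha₀; linarith [e₀.1]
  · unfold chartPeriod; linarith [e₀.2]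
  · simp only [hJ] at ha₂; linarith [e₂.1]
  · linarith [e₂.2]
  · simp only [hJ] at ha₄; linarith [e₄.1]
  · linarith [e₄.2]

/-! ### Comparison of the periods with the Kepler periods -/

theorem abs_inv_sqrt_sub_le {L w : ℝ} (hL : 0 < L) (hw : L ≤ w) :
    |(√w)⁻¹ - (√L)⁻¹| ≤ (w - L) / √L ^ 3 := by
  have ha : 0 < √L := Real.sqrt_pos.mpr hL
  have hab : √L ≤ √w := Real.sqrt_le_sqrt hw
  have hb2 : √w ^ 2 - √L ^ 2 = w - L := by
    rw [Real.sq_sqrt (hL.le.trans hw), Real.sq_sqrt hL.le]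
  rw [← hb2]
  generalize √w = b at *
  generalize √L = a at *
  have hb : 0 < b := ha.trans_le hab
  rw [abs_sub_comm, abs_of_nonneg (sub_nonneg.mpr (inv_anti₀ ha hab)), le_div_iff₀ (by positivity)]
  have h1 : (a⁻¹ - b⁻¹) * a ^ 3 = (b - a) * a ^ 2 / b := by field_simp
  rw [h1, div_le_iff₀ hb, show (b ^ 2 - a ^ 2) * b = (b - a) * ((b + a) * b) by ring]
  exact mul_le_mul_of_nonneg_left (by nlinarith) (by linarith)

theorem abs_mul_inv_sq_sub_le {v c y z m X d₁ d₂ : ℝ} (hm : 0 < m) (hc : 0 < c) (hy : m ≤ y)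
    (hz : m ≤ z) (hyX : y ≤ X) (hzX : z ≤ X) (h1 : |v - c| ≤ d₁) (h2 : |y - z| ≤ d₂) :
    |v * y⁻¹ ^ 2 - c * z⁻¹ ^ 2| ≤ d₁ * m⁻¹ ^ 2 + c * (d₂ * (2 * X / m ^ 4)) := by
  have hy0 : 0 < y := hm.trans_le hy
  have hz0 : 0 < z := hm.trans_le hz
  have hX : 0 < X := hy0.trans_le hyX
  have hd₁ : 0 ≤ d₁ := (abs_nonneg _).trans h1
  have hd₂ : 0 ≤ d₂ := (abs_nonneg _).trans h2
  have h3 : |y⁻¹ ^ 2| ≤ m⁻¹ ^ 2 := by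
    rw [abs_of_nonneg (by positivity)]
    exact pow_le_pow_left₀ (by positivity) (inv_anti₀ hm hy) 2
  have h4 : |y⁻¹ ^ 2 - z⁻¹ ^ 2| ≤ d₂ * (2 * X / m ^ 4) := by
    have h5 : y⁻¹ ^ 2 - z⁻¹ ^ 2 = -(y - z) * ((y + z) / (y ^ 2 * z ^ 2)) := by
      field_simp; ring
    rw [h5, abs_mul, abs_neg, abs_of_nonneg (show 0 ≤ (y + z) / (y ^ 2 * z ^ 2) by positivity)]
    refine mul_le_mul h2 ?_ (by positivity) hd₂
    refine div_le_div₀ (by positivity) (by linarith) (by positivity) ?_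
    rw [show m ^ 4 = m ^ 2 * m ^ 2 by ring]
    gcongr
  rw [show v * y⁻¹ ^ 2 - c * z⁻¹ ^ 2 = (v - c) * y⁻¹ ^ 2 + c * (y⁻¹ ^ 2 - z⁻¹ ^ 2) by ring]
  refine (abs_add_le _ _).trans ?_
  rw [abs_mul, abs_mul, abs_of_pos hc]
  exact add_le_add (mul_le_mul h1 h3 (abs_nonneg _) hd₁) (mul_le_mul_of_nonneg_left h4 hc.le)

/-- Comparison of the orbit densities with those of the Kepler problem. -/
theorem exists_period_comparison (hM : 0 < M) (hL : 0 < L) (hκ : κ < 0) (hp : 1 < p) (hR : 0 < R)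
    (hB : 0 ≤ B) (h : ChartFamily M L κ p B R δ S Pm P x) :
    ∃ K : ℝ, 0 ≤ K ∧ ∀ i j, δ j = 0 → ∀ E ∈ Ioo (Pm i) κ, E - Pm i + Pm j < κ →
      |chartPeriod L p (δ i) (S i) (Pm i) (x i) E
        - chartPeriod L p (δ j) (S j) (Pm j) (x j) (E - Pm i + Pm j)| ≤ K * δ i := by
  obtain ⟨W₀, hW₀0, hW₀⟩ := h.exists_chartMass_le hM hL hκ hp hR
  set m : ℝ := -κ / M with hm_def
  have hm : 0 < m := div_pos (by linarith) hM
  set X : ℝ := 2 * M / L with hX_def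
  have hX : 0 < X := by positivity
  set a : ℝ := √L with ha_def
  have ha : 0 < a := Real.sqrt_pos.mpr hL
  set G : ℝ := 2 * (κ + M ^ 2 / (2 * L)) + 1 with hG_def
  set k₁ : ℝ := W₀ / a ^ 3 with hk₁_def
  have hk₁ : 0 ≤ k₁ := by positivity
  have hκ0 : ∀ i : ι, 0 < κ + M ^ 2 / (2 * L) := fun i => by
    have h1 := h.sq_le i
    have h2 := h.le_sq i
    linarith
  by_cases hne : Nonempty ι
  swap
  · exact ⟨0, le_rfl, fun i => (hne ⟨i⟩).elim⟩
  obtain ⟨i₀⟩ := hne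
  have hG : 0 < G := by linarith [hκ0 i₀]
  set k₂ : ℝ := B / L + k₁ * G with hk₂_def
  have hk₂ : 0 ≤ k₂ := by positivity
  set k₃ : ℝ := k₁ * m⁻¹ ^ 2 + a⁻¹ * (k₂ * (2 * X / m ^ 4)) with hk₃_def
  have hk₃ : 0 ≤ k₃ := by positivity
  refine ⟨2 * (Real.pi * k₃), by positivity, fun i j hj E hE hEj => ?_⟩
  have hδ0 := h.nonneg i
  have hA := h.sqrt_mem i hE
  have hA' := h.sqrt_mem j (E := E - Pm i + Pm j) ⟨by linarith [hE.1], hEj⟩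
  rw [add_sub_cancel_right] at hA'
  set A := √(2 * (E - Pm i)) with hA_def
  have hA0 : 0 ≤ A := Real.sqrt_nonneg _
  have hv : ∀ s ∈ Icc (-A) A, |(√(L + δ i * chartMass p (S i) (x i) s))⁻¹
      - (√(L + δ j * chartMass p (S j) (x j) s))⁻¹| ≤ k₁ * δ i := by
    intro s hs
    have hsi : s ∈ Ioo (-S i) (S i) := ⟨by linarith [hs.1, hA.2], by linarith [hs.2, hA.2]⟩
    rw [hj, zero_mul, add_zero]
    have hw := h.le_coeff i hsi
    refine (abs_inv_sqrt_sub_le hL hw).trans ?_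
    rw [hk₁_def, div_mul_eq_mul_div, add_sub_cancel_left, mul_comm W₀]
    exact div_le_div_of_nonneg_right (mul_le_mul_of_nonneg_left (hW₀ i s hsi) hδ0) (by positivity)
  have hsub : ∀ s ∈ Icc (-A) A, s ∈ Ioo (-S i) (S i) ∧ s ∈ Ioo (-S j) (S j) := fun s hs =>
    ⟨⟨by linarith [hs.1, hA.2], by linarith [hs.2, hA.2]⟩,
      ⟨by linarith [hs.1, hA'.2], by linarith [hs.2, hA'.2]⟩⟩
  -- The charts start within B δ/L of each other at s = 0, and their speeds differ by at most k₁ δ.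
  have hx : ∀ s ∈ Icc (-A) A, |x i s - x j s| ≤ k₂ * δ i := by
    intro s hs
    have h1 := (convex_Icc (-A) A).norm_image_sub_le_of_norm_hasDerivWithin_le
      (f := fun s => x i s - x j s) (fun s hs => (((h.chart i).hasDerivAt s (hsub s hs).1).sub
        ((h.chart j).hasDerivAt s (hsub s hs).2)).hasDerivWithinAt) hv
      (x := 0) (y := s) ⟨by linarith, hA0⟩ hs
    rw [Real.norm_eq_abs, Real.norm_eq_abs, sub_zero] at h1
    have h2 : |x i 0 - x j 0| ≤ B / L * δ i := by
      have h3 := (h.chart j).zero_le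
      rw [hj, mul_zero, zero_div, add_zero] at h3
      have h4 := (h.chart j).le_zero
      have h5 := (h.chart i).zero_le
      have h6 := (h.chart i).le_zero
      rw [abs_of_nonneg (by linarith)]
      have h7 : B / L * δ i = B * δ i / L := by ring
      linarith
    have h8 : |s| ≤ G := by
      have h9 : |s| < S i := abs_lt.mpr (hsub s hs).1
      have h10 : |s| ^ 2 ≤ S i ^ 2 := pow_le_pow_left₀ (abs_nonneg s) h9.le 2
      have h11 := h.sq_le i
      have h15 := sq_nonneg (|s| - 1)
      have h16 := sq_nonneg |s|
      have h17 : (|s| - 1) ^ 2 = |s| ^ 2 - 2 * |s| + 1 := by ring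
      linarith
    have h12 : k₁ * δ i * |s| ≤ k₁ * δ i * G :=
      mul_le_mul_of_nonneg_left h8 (by positivity)
    have h13 : |x i s - x j s| ≤ |x i s - x j s - (x i 0 - x j 0)| + |x i 0 - x j 0| := by
      have := abs_add_le (x i s - x j s - (x i 0 - x j 0)) (x i 0 - x j 0)
      rwa [sub_add_cancel] at this
    have h14 : k₂ * δ i = B / L * δ i + k₁ * δ i * G := by rw [hk₂_def]; ring
    linarith
  have hf : ∀ s ∈ Icc (-A) A, |orbitDensity L p (δ i) (S i) (x i) s
      - orbitDensity L p (δ j) (S j) (x j) s| ≤ k₃ * δ i := by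
    intro s hs
    unfold orbitDensity
    have h1 := hv s hs
    have h2 := hx s hs
    have hi1 := (h.chart i).le_apply s (hsub s hs).1
    have hj1 := (h.chart j).le_apply s (hsub s hs).2
    have hi2 := (h.chart i).apply_le s (hsub s hs).1
    have hj2 := (h.chart j).apply_le s (hsub s hs).2
    have hvj : (√(L + δ j * chartMass p (S j) (x j) s))⁻¹ = a⁻¹ := by
      rw [hj, zero_mul, add_zero]
    rw [hvj] at h1 ⊢
    rw [pow_one, pow_one]
    refine (abs_mul_inv_sq_sub_le hm (inv_pos.mpr ha) hi1 hj1 hi2 hj2 h1 h2).trans_eq ?_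
    rw [hk₃_def]; ring
  unfold chartPeriod cosIntegral
  rw [add_sub_cancel_right, ← hA_def, ← mul_sub, abs_mul, abs_two, mul_assoc]
  refine mul_le_mul_of_nonneg_left ?_ zero_le_two
  have hcont : ∀ i, A ∈ Ioo (-S i) (S i) → Continuous fun θ =>
      Real.cos θ ^ 0 * orbitDensity L p (δ i) (S i) (x i) (Real.sin θ * A) := by
    intro i hAi
    have hx0 := h.tame_chart hM hL hκ hp hR (Nat.zero_le 4)
    have h1 : ContinuousOn (orbitDensity L p (δ i) (S i) (x i)) (Ioo (-S i) (S i)) :=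
      (((h.tame_speed hM hL hκ hp hR (Nat.zero_le 4) hx0).continuousOn i).pow 1).mul
        (((hx0.continuousOn i).inv₀ fun s hs => (h.apply_pos hM hκ i hs).ne').pow 2)
    exact (Real.continuous_cos.pow 0).mul (h1.comp_continuous (by fun_prop) fun t =>
      mul_mem_Ioo_of_abs_le_one (Real.abs_sin_le_one t) hAi)
  rw [← intervalIntegral.integral_sub ((hcont i hA).intervalIntegrable _ _)
    ((hcont j hA').intervalIntegrable _ _)]
  have h1 := intervalIntegral.norm_integral_le_of_norm_le_const (a := -(Real.pi / 2))
    (b := Real.pi / 2) (C := k₃ * δ i) (f := fun θ =>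
      Real.cos θ ^ 0 * orbitDensity L p (δ i) (S i) (x i) (Real.sin θ * A)
      - Real.cos θ ^ 0 * orbitDensity L p (δ j) (S j) (x j) (Real.sin θ * A)) (fun θ _ => by
      rw [pow_zero, one_mul, one_mul]
      refine hf _ (abs_le.mp ?_)
      rw [abs_mul, abs_of_nonneg hA0]
      exact mul_le_of_le_one_left hA0 (Real.abs_sin_le_one θ))
  rw [show Real.pi / 2 - -(Real.pi / 2) = Real.pi by ring, abs_of_pos Real.pi_pos] at h1
  rw [← Real.norm_eq_abs]
  linarith

end ChartFamily

/-! ### The period of a steady state -/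

theorem period_eq_of_turning_points {M L E r₁ r₂ : ℝ} {U : ℝ → ℝ} (h12 : r₁ ≤ r₂)
    (h : {r : ℝ | 0 < r ∧ effPot M L U r = E} = {r₁, r₂}) :
    period M L U E = 2 * ∫ r in Ioo r₁ r₂, 1 / √(2 * E - 2 * effPot M L U r) := by
  unfold period rMinus rPlus
  rw [h, csInf_pair, csSup_pair, inf_eq_left.mpr h12, sup_eq_right.mpr h12,
    intervalIntegral.integral_of_le h12, integral_Ioc_eq_integral_Ioo]

theorem EnergyChart.minEnergy_eq {M L κ p δ B S Pm : ℝ} {U x : ℝ → ℝ} (hM : 0 < M) (hκ : κ < 0)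
    (h : EnergyChart M L κ p δ B (fun u => effPot M L U u⁻¹ - U 0) x S Pm) :
    minEnergy M L U = Pm + U 0 := by
  have h0 : (0 : ℝ) ∈ Ioo (-S) S := ⟨by linarith [h.pos], h.pos⟩
  have hx0 : 0 < x 0 := lt_of_lt_of_le (div_pos (by linarith) hM) (h.le_apply 0 h0)
  refine IsLeast.csInf_eq ⟨⟨(x 0)⁻¹, inv_pos.mpr hx0, ?_⟩, ?_⟩
  · have := h.pot_apply 0 h0
    linarith
  · rintro _ ⟨r, hr, rfl⟩
    have := h.min_le_pot r⁻¹ (inv_pos.mpr hr)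
    simp only [inv_inv] at this
    linarith

theorem EnergyChart.strictMonoOn {M L κ p δ B S Pm : ℝ} {P x : ℝ → ℝ} (hL : 0 < L) (hδ : 0 ≤ δ)
    (h : EnergyChart M L κ p δ B P x S Pm) : StrictMonoOn x (Ioo (-S) S) := by
  refine strictMonoOn_of_deriv_pos (convex_Ioo _ _)
    (fun s hs => (h.hasDerivAt s hs).continuousAt.continuousWithinAt) fun s hs => ?_
  rw [interior_Ioo] at hs
  rw [(h.hasDerivAt s hs).deriv]
  have := mul_nonneg hδ (chartMass_nonneg (p := p) (x := x) hs)
  exact inv_pos.mpr (Real.sqrt_pos.mpr (by linarith))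

/-- With r = 1/x(A sin θ) one has 2E - 2Ψ = A² cos²θ, and dr contributes the same factor A cos θ.
The singularities of the integrand at both turning points cancel. -/
theorem EnergyChart.period_eq {M L κ p δ B S Pm E : ℝ} {U x : ℝ → ℝ} (hM : 0 < M) (hL : 0 < L)
    (hκ : κ < 0) (hδ : 0 ≤ δ)
    (h : EnergyChart M L κ p δ B (fun u => effPot M L U u⁻¹ - U 0) x S Pm)
    (hE : E - U 0 ∈ Ioo Pm κ) :
    period M L U E = chartPeriod L p δ S Pm x (E - U 0) := by
  have hmono := h.strictMonoOn hL hδ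
  have hxpos : ∀ s ∈ Ioo (-S) S, 0 < x s := fun s hs =>
    lt_of_lt_of_le (div_pos (by linarith) hM) (h.le_apply s hs)
  set A := √(2 * (E - U 0 - Pm)) with hA_def
  have hA2 : A ^ 2 = 2 * (E - U 0 - Pm) := Real.sq_sqrt (by linarith [hE.1])
  have hA0 : 0 < A := Real.sqrt_pos.mpr (by linarith [hE.1])
  have hAS : A < S := by
    rw [hA_def, Real.sqrt_lt' h.pos, h.sq_eq]; linarith [hE.2]
  have hAm : A ∈ Ioo (-S) S := ⟨by linarith [h.pos], hAS⟩
  have hAm' : -A ∈ Ioo (-S) S := ⟨by linarith, by linarith [h.pos]⟩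
  have hpot : ∀ s ∈ Ioo (-S) S, effPot M L U (x s)⁻¹ = Pm + s ^ 2 / 2 + U 0 := fun s hs => by
    have := h.pot_apply s hs
    linarith
  have hset : {r : ℝ | 0 < r ∧ effPot M L U r = E} = {(x A)⁻¹, (x (-A))⁻¹} := by
    ext r
    simp only [mem_ofPred_eq, mem_insert_iff, mem_singleton_iff]
    constructor
    · rintro ⟨hr, hrE⟩
      obtain ⟨s, hs, hsx⟩ := h.surj r⁻¹ (inv_pos.mpr hr) (by
        simp only [inv_inv]; linarith [hE.2])
      have h1 := hpot s hs
      rw [hsx, inv_inv, hrE] at h1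
      have h2 : s ^ 2 = A ^ 2 := by rw [hA2]; linarith
      rcases sq_eq_sq_iff_eq_or_eq_neg.mp h2 with h3 | h3
      · left; rw [← h3, hsx, inv_inv]
      · right; rw [← h3, hsx, inv_inv]
    · rintro (rfl | rfl)
      · refine ⟨inv_pos.mpr (hxpos A hAm), ?_⟩
        rw [hpot A hAm, hA2]; ring
      · refine ⟨inv_pos.mpr (hxpos _ hAm'), ?_⟩
        rw [hpot _ hAm', neg_sq, hA2]; ring
  have hlt : (x A)⁻¹ ≤ (x (-A))⁻¹ :=
    inv_anti₀ (hxpos _ hAm') (hmono hAm' hAm (by linarith)).le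
  rw [period_eq_of_turning_points hlt hset]
  unfold chartPeriod cosIntegral
  rw [← hA_def]
  congr 1
  have hsin : ∀ t, Real.sin t * A ∈ Ioo (-S) S := fun t =>
    mul_mem_Ioo_of_abs_le_one (Real.abs_sin_le_one t) hAm
  have hpi : -(Real.pi / 2) ≤ Real.pi / 2 := by linarith [Real.pi_pos]
  set φ : ℝ → ℝ := fun θ => (x (Real.sin θ * A))⁻¹ with hφ
  have hφd : ∀ θ, HasDerivAt φ
      (-(orbitDensity L p δ S x (Real.sin θ * A) * (Real.cos θ * A))) θ := by
    intro θ
    have h1 := (((h.hasDerivAt _ (hsin θ)).comp θ ((Real.hasDerivAt_sin θ).mul_const A))).inv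
      (hxpos _ (hsin θ)).ne'
    refine h1.congr_deriv ?_
    unfold orbitDensity
    simp only [Function.comp_apply, inv_pow, pow_one, div_eq_mul_inv]
    ring
  have hφanti : StrictAntiOn φ (Icc (-(Real.pi / 2)) (Real.pi / 2)) := by
    intro s hs t ht hst
    have h1 := Real.strictMonoOn_sin hs ht hst
    have h2 := hmono (hsin s) (hsin t) (mul_lt_mul_of_pos_right h1 hA0)
    exact inv_strictAnti₀ (hxpos _ (hsin s)) h2
  have hφl : φ (-(Real.pi / 2)) = (x (-A))⁻¹ := by
    simp only [hφ, Real.sin_neg, Real.sin_pi_div_two, neg_mul, one_mul]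
  have hφr : φ (Real.pi / 2) = (x A)⁻¹ := by
    simp only [hφ, Real.sin_pi_div_two, one_mul]
  have himg : φ '' Ioo (-(Real.pi / 2)) (Real.pi / 2) = Ioo (x A)⁻¹ (x (-A))⁻¹ := by
    rw [← hφl, ← hφr]
    refine Subset.antisymm ?_ (intermediate_value_Ioo' hpi fun θ _ =>
      (hφd θ).continuousAt.continuousWithinAt)
    rintro _ ⟨θ, hθ, rfl⟩
    exact ⟨hφanti (Ioo_subset_Icc_self hθ) (right_mem_Icc.mpr hpi) hθ.2,
      hφanti (left_mem_Icc.mpr hpi) (Ioo_subset_Icc_self hθ) hθ.1⟩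
  rw [← himg, integral_image_eq_integral_abs_deriv_smul measurableSet_Ioo
    (fun θ _ => (hφd θ).hasDerivWithinAt) (hφanti.injOn.mono Ioo_subset_Icc_self),
    intervalIntegral.integral_of_le hpi, integral_Ioc_eq_integral_Ioo]
  refine setIntegral_congr_fun measurableSet_Ioo fun θ hθ => ?_
  have hcos := Real.cos_pos_of_mem_Ioo hθ
  have hcA : 0 < Real.cos θ * A := mul_pos hcos hA0
  have hden : 0 ≤ orbitDensity L p δ S x (Real.sin θ * A) := by
    unfold orbitDensity; positivity
  have h1 : 2 * E - 2 * effPot M L U (φ θ) = (Real.cos θ * A) ^ 2 := by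
    simp only [hφ]
    rw [hpot _ (hsin θ)]
    have h2 := Real.sin_sq_add_cos_sq θ
    have h3 : (Real.cos θ * A) ^ 2 = A ^ 2 - (Real.sin θ * A) ^ 2 := by
      rw [mul_pow, mul_pow]; linear_combination A ^ 2 * h2
    rw [h3, hA2]; ring
  simp only [smul_eq_mul]
  rw [h1, Real.sqrt_sq hcA.le, abs_neg, abs_of_nonneg (mul_nonneg hden hcA.le), pow_zero, one_mul]
  field_simp

/-- The period function of the Kepler problem. -/
theorem period_zero_eq {M L E : ℝ} {U : ℝ → ℝ} (hM : 0 < M) (hL : 0 < L) (hU : ∀ r, U r = 0)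
    (hE : -(M ^ 2 / (2 * L)) < E) (hE0 : E < 0) :
    period M L U E = Real.pi * M / (√2 * (-E) ^ (3 / 2 : ℝ)) := by
  -- The semi-major axis; `b` below is the axis times the eccentricity, so the turning points are a
  -- ± b.
  set a : ℝ := M / (2 * (-E)) with ha_def
  have ha : 0 < a := div_pos hM (by linarith)
  have haM : 2 * (-E) * a = M := by rw [ha_def]; field_simp [hE0.ne]
  have hsq : 0 < a ^ 2 - L / (2 * (-E)) := by
    have h1 : -E < M ^ 2 / (2 * L) := by linarith
    rw [lt_div_iff₀ (by positivity)] at h1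
    rw [sub_pos, div_lt_iff₀ (by linarith), ← sub_pos]
    have h2 : a ^ 2 * (2 * -E) - L = (M ^ 2 - 2 * (-E) * L) / (2 * (-E)) := by
      rw [ha_def]; field_simp [hE0.ne]; ring
    rw [h2]
    exact div_pos (by linarith) (by linarith)
  set b : ℝ := √(a ^ 2 - L / (2 * (-E))) with hb_def
  have hb : 0 < b := Real.sqrt_pos.mpr hsq
  have hb2 : b ^ 2 = a ^ 2 - L / (2 * (-E)) := Real.sq_sqrt hsq.le
  have hLb : L = 2 * (-E) * (a ^ 2 - b ^ 2) := by
    rw [hb2]; field_simp [hE0.ne]; ring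
  have hba : b < a := by
    have : 0 < L / (2 * (-E)) := div_pos hL (by linarith)
    nlinarith
  have hpot : ∀ r, 0 < r → 2 * E - 2 * effPot M L U r = 2 * (-E) * (b ^ 2 - (r - a) ^ 2) / r ^ 2 := by
    intro r hr
    unfold effPot
    rw [hU, hLb, ← haM]
    field_simp
    ring
  have hset : {r : ℝ | 0 < r ∧ effPot M L U r = E} = {a - b, a + b} := by
    ext r
    simp only [mem_ofPred_eq, mem_insert_iff, mem_singleton_iff]
    have hiff : ∀ r, 0 < r → (effPot M L U r = E ↔ (r - a) ^ 2 = b ^ 2) := by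
      intro r hr
      have h1 := hpot r hr
      constructor
      · intro h2
        rw [h2, sub_self, eq_comm, div_eq_zero_iff] at h1
        rcases h1 with h1 | h1
        · rcases mul_eq_zero.mp h1 with h3 | h3
          · linarith
          · linarith
        · exact absurd h1 (by positivity)
      · intro h2
        rw [h2, sub_self, mul_zero, zero_div] at h1
        linarith
    constructor
    · rintro ⟨hr, h1⟩
      rcases sq_eq_sq_iff_eq_or_eq_neg.mp ((hiff r hr).mp h1) with h2 | h2
      · right; linarith
      · left; linarith
    · rintro (rfl | rfl)
      · exact ⟨by linarith, (hiff _ (by linarith)).mpr (by ring)⟩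
      · exact ⟨by linarith, (hiff _ (by linarith)).mpr (by ring)⟩
  rw [period_eq_of_turning_points (by linarith) hset]
  -- Eccentric anomaly: the integrand becomes (a - b cos θ)/√(-2E), whose cosine term integrates to
  -- 0.
  set φ : ℝ → ℝ := fun θ => a - b * Real.cos θ with hφ
  have hφd : ∀ θ, HasDerivAt φ (b * Real.sin θ) θ := fun θ => by
    refine (((Real.hasDerivAt_cos θ).const_mul b).const_sub a).congr_deriv ?_
    ring
  have hφm : StrictMonoOn φ (Icc 0 Real.pi) := fun s hs t ht hst => by
    have := mul_lt_mul_of_pos_left (Real.strictAntiOn_cos hs ht hst) hb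
    simp only [hφ]; linarith
  have hφl : φ 0 = a - b := by simp [hφ]
  have hφr : φ Real.pi = a + b := by simp [hφ]
  have himg : φ '' Ioo 0 Real.pi = Ioo (a - b) (a + b) := by
    rw [← hφl, ← hφr]
    refine Subset.antisymm ?_ (intermediate_value_Ioo Real.pi_pos.le fun θ _ =>
      (hφd θ).continuousAt.continuousWithinAt)
    rintro _ ⟨θ, hθ, rfl⟩
    exact ⟨hφm (left_mem_Icc.mpr Real.pi_pos.le) (Ioo_subset_Icc_self hθ) hθ.1,
      hφm (Ioo_subset_Icc_self hθ) (right_mem_Icc.mpr Real.pi_pos.le) hθ.2⟩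
  rw [← himg, integral_image_eq_integral_deriv_smul_of_monotoneOn measurableSet_Ioo
    (fun θ _ => (hφd θ).hasDerivWithinAt) (hφm.monotoneOn.mono Ioo_subset_Icc_self)]
  have hsqE : 0 < √(2 * (-E)) := Real.sqrt_pos.mpr (by linarith)
  rw [setIntegral_congr_fun (g := fun θ => (√(2 * (-E)))⁻¹ * (a - b * Real.cos θ)) measurableSet_Ioo
    fun θ hθ => ?_]
  · rw [← integral_Ioc_eq_integral_Ioo, ← intervalIntegral.integral_of_le Real.pi_pos.le,
      intervalIntegral.integral_const_mul, intervalIntegral.integral_sub (by simp)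
        (Continuous.intervalIntegrable (by fun_prop) _ _), intervalIntegral.integral_const_mul,
      integral_cos]
    simp only [intervalIntegral.integral_const, Real.sin_pi, Real.sin_zero, sub_zero, mul_zero,
      smul_eq_mul]
    have h1 : (-E) ^ (3 / 2 : ℝ) = (-E) * √(-E) := by
      rw [show (3 / 2 : ℝ) = 1 + 1 / 2 by norm_num, Real.rpow_add (by linarith), Real.rpow_one,
        ← Real.sqrt_eq_rpow]
    rw [h1, Real.sqrt_mul (by norm_num), ← haM]
    have h2 : 0 < √(-E) := Real.sqrt_pos.mpr (by linarith)
    have h3 : -E ≠ 0 := by linarith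
    field_simp
    exact (div_self hE0.ne).symm
  · have hsin := Real.sin_pos_of_mem_Ioo hθ
    have hr : 0 < φ θ := by
      simp only [hφ]
      nlinarith [Real.cos_le_one θ]
    simp only [smul_eq_mul]
    rw [hpot _ hr]
    have h1 : 2 * (-E) * (b ^ 2 - (φ θ - a) ^ 2) / φ θ ^ 2 = 2 * (-E) * (b * Real.sin θ / φ θ) ^ 2 := by
      have h2 : b ^ 2 - (φ θ - a) ^ 2 = (b * Real.sin θ) ^ 2 := by
        simp only [hφ]
        linear_combination (-b ^ 2) * Real.sin_sq_add_cos_sq θ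
      rw [h2, div_pow, mul_div_assoc]
    have h3 : 0 < b * Real.sin θ / φ θ := by positivity
    rw [h1, Real.sqrt_mul (by linarith), Real.sqrt_sq h3.le]
    change _ = (√(2 * (-E)))⁻¹ * φ θ
    field_simp

/-! ### Limits of extrema -/

/-- Nestedness of the intervals gives the lower bound. For the upper bound, a near-minimiser t₀ < ℓ₀
eventually lies in the smaller interval. -/
theorem tendsto_sInf_image_Ioo {α : Type*} {l : Filter α} {ℓ η : α → ℝ} {g : α → ℝ → ℝ} {ℓ₀ c : ℝ}
    {g₀ : ℝ → ℝ} (hℓ₀ : 0 < ℓ₀) (hℓ : Tendsto ℓ l (𝓝 ℓ₀)) (hη : Tendsto η l (𝓝 0))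
    (hle : ∀ᶠ a in l, ℓ a ≤ ℓ₀) (hg : ∀ᶠ a in l, ∀ t ∈ Ioo 0 (ℓ a), |g a t - g₀ t| ≤ η a)
    (hc : ∀ t ∈ Ioo 0 ℓ₀, c ≤ g₀ t) :
    Tendsto (fun a => sInf (g a '' Ioo 0 (ℓ a))) l (𝓝 (sInf (g₀ '' Ioo 0 ℓ₀))) := by
  have hbdd : BddBelow (g₀ '' Ioo 0 ℓ₀) := ⟨c, by rintro _ ⟨t, ht, rfl⟩; exact hc t ht⟩
  have hne : (g₀ '' Ioo 0 ℓ₀).Nonempty := (nonempty_Ioo.mpr hℓ₀).image _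
  rw [Metric.tendsto_nhds]
  intro r hr
  obtain ⟨_, ⟨t₀, ht₀, rfl⟩, hlt⟩ := exists_lt_of_csInf_lt hne
    (show sInf (g₀ '' Ioo 0 ℓ₀) < sInf (g₀ '' Ioo 0 ℓ₀) + r / 2 by linarith)
  filter_upwards [hle, hg, hℓ.eventually (lt_mem_nhds ht₀.2),
    hη.eventually (gt_mem_nhds (show (0 : ℝ) < r / 2 by linarith))] with a h1 h2 h3 h4
  have hlow : ∀ y ∈ g a '' Ioo 0 (ℓ a), sInf (g₀ '' Ioo 0 ℓ₀) - r / 2 ≤ y := by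
    rintro _ ⟨t, ht, rfl⟩
    have h5 := csInf_le hbdd ⟨t, ⟨ht.1, ht.2.trans_le h1⟩, rfl⟩
    have h6 := (abs_le.mp (h2 t ht)).1
    linarith
  have h7 : sInf (g₀ '' Ioo 0 ℓ₀) - r / 2 ≤ sInf (g a '' Ioo 0 (ℓ a)) :=
    le_csInf ((nonempty_Ioo.mpr (ht₀.1.trans h3)).image _) hlow
  have h8 : sInf (g a '' Ioo 0 (ℓ a)) ≤ g a t₀ := csInf_le ⟨_, hlow⟩ ⟨t₀, ⟨ht₀.1, h3⟩, rfl⟩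
  have h9 := (abs_le.mp (h2 t₀ ⟨ht₀.1, h3⟩)).2
  rw [Real.dist_eq, abs_lt]
  constructor <;> linarith

theorem sSup_image_eq_neg_sInf (f : ℝ → ℝ) (s : Set ℝ) :
    sSup (f '' s) = -sInf ((fun t => -f t) '' s) := by
  rw [← image_image (fun y => -y) f s, image_neg_eq_neg, Real.sInf_neg, neg_neg]

theorem tendsto_sSup_image_Ioo {α : Type*} {l : Filter α} {ℓ η : α → ℝ} {g : α → ℝ → ℝ} {ℓ₀ c : ℝ}
    {g₀ : ℝ → ℝ} (hℓ₀ : 0 < ℓ₀) (hℓ : Tendsto ℓ l (𝓝 ℓ₀)) (hη : Tendsto η l (𝓝 0))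
    (hle : ∀ᶠ a in l, ℓ a ≤ ℓ₀) (hg : ∀ᶠ a in l, ∀ t ∈ Ioo 0 (ℓ a), |g a t - g₀ t| ≤ η a)
    (hc : ∀ t ∈ Ioo 0 ℓ₀, g₀ t ≤ c) :
    Tendsto (fun a => sSup (g a '' Ioo 0 (ℓ a))) l (𝓝 (sSup (g₀ '' Ioo 0 ℓ₀))) := by
  simp only [sSup_image_eq_neg_sInf]
  refine (tendsto_sInf_image_Ioo (g := fun a t => -g a t) (c := -c) hℓ₀ hℓ hη hle ?_
    fun t ht => neg_le_neg (hc t ht)).neg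
  filter_upwards [hg] with a ha t ht
  rw [show -g a t - -g₀ t = -(g a t - g₀ t) by ring, abs_neg]
  exact ha t ht

theorem contDiffOn_two_of_hasDerivAt {f f' f'' : ℝ → ℝ} {s : Set ℝ} (hs : IsOpen s)
    (hf : ∀ y ∈ s, HasDerivAt f (f' y) y) (hf' : ∀ y ∈ s, HasDerivAt f' (f'' y) y)
    (hf'' : ContinuousOn f'' s) :
    ContDiffOn ℝ 2 f s ∧ (∀ y ∈ s, iteratedDeriv 1 f y = f' y) ∧
      ∀ y ∈ s, iteratedDeriv 2 f y = f'' y := by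
  have h1 : EqOn (deriv f) f' s := fun y hy => (hf y hy).deriv
  have h2 : ∀ y ∈ s, HasDerivAt (deriv f) (f'' y) y := fun y hy =>
    (hf' y hy).congr_of_eventuallyEq (eventuallyEq_of_mem (hs.mem_nhds hy) h1)
  refine ⟨?_, fun y hy => by rw [iteratedDeriv_one]; exact h1 hy, fun y hy => ?_⟩
  · rw [show (2 : WithTop ℕ∞) = 1 + 1 by norm_num, contDiffOn_succ_iff_deriv_of_isOpen hs]
    refine ⟨fun y hy => (hf y hy).differentiableAt.differentiableWithinAt, by simp, ?_⟩
    rw [show (1 : WithTop ℕ∞) = 0 + 1 by norm_num, contDiffOn_succ_iff_deriv_of_isOpen hs]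
    refine ⟨fun y hy => (h2 y hy).differentiableAt.differentiableWithinAt, by simp, ?_⟩
    rw [contDiffOn_zero]
    exact hf''.congr fun y hy => (h2 y hy).deriv
  · rw [iteratedDeriv_succ, iteratedDeriv_one]
    exact (h2 y hy).deriv

theorem isSteadyState_zero {M L k κ : ℝ} {U : ℝ → ℝ} (hU : ∀ r, U r = 0) :
    IsSteadyState M L k κ 0 U κ := by
  obtain rfl : U = fun _ => 0 := funext hU
  refine ⟨continuousWithinAt_const, fun r _ => ?_, tendsto_const_nhds, by simp⟩
  refine (hasDerivAt_const r (0 : ℝ)).congr_deriv ?_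
  simp [massDensity, phaseDensity]

/-- Measuring energies from the minimum makes the action intervals for different ε comparable: all
start at 0. -/
theorem image_Ioo_eq_image_shift (f : ℝ → ℝ) (a b : ℝ) :
    f '' Ioo a b = (fun t => f (a + t)) '' Ioo 0 (b - a) := by
  rw [← image_image f (fun t => a + t), image_const_add_Ioo, add_zero, add_sub_cancel]

theorem periodMin_eq_sInf_shift (M L E₀ : ℝ) (U : ℝ → ℝ) :
    periodMin M L U E₀ = sInf ((fun t => period M L U (minEnergy M L U + t)) ''
      Ioo 0 (E₀ - minEnergy M L U)) := by
  rw [periodMin, actionInterval, image_Ioo_eq_image_shift]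

theorem periodMax_eq_sSup_shift (M L E₀ : ℝ) (U : ℝ → ℝ) :
    periodMax M L U E₀ = sSup ((fun t => period M L U (minEnergy M L U + t)) ''
      Ioo 0 (E₀ - minEnergy M L U)) := by
  rw [periodMax, actionInterval, image_Ioo_eq_image_shift]

theorem tendsto_nhdsGT_of_abs_sub_le {f : ℝ → ℝ} {a C ε₁ : ℝ} (hε₁ : 0 < ε₁)
    (h : ∀ ε ∈ Ioo 0 ε₁, |f ε - a| ≤ C * ε) : Tendsto f (𝓝[>] 0) (𝓝 a) := by
  rw [tendsto_iff_dist_tendsto_zero]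
  have h0 : Tendsto (fun ε : ℝ => C * ε) (𝓝[>] 0) (𝓝 0) := by
    have : Tendsto (fun ε : ℝ => C * ε) (𝓝 0) (𝓝 (C * 0)) := tendsto_id.const_mul C
    rw [mul_zero] at this
    exact this.mono_left nhdsWithin_le_nhds
  refine squeeze_zero' (Eventually.of_forall fun _ => dist_nonneg) ?_ h0
  filter_upwards [Ioo_mem_nhdsGT hε₁] with ε hε
  exact h ε hε

theorem exists_pos_mul_le {a b : ℝ} (ha : 0 ≤ a) (hb : 0 < b) :
    ∃ ε₁, 0 < ε₁ ∧ ∀ ε, 0 ≤ ε → ε < ε₁ → a * ε ≤ b := by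
  refine ⟨b / (a + 1), by positivity, fun ε h0 h1 => ?_⟩
  rw [lt_div_iff₀ (by linarith)] at h1
  linarith

end VP

/-! ### Uniform choice of constants and passage to the limit -/

open VP

theorem lemma3p4 (M L k κ : ℝ) (hM : 0 < M) (hL : 0 < L) (hk : 1 / 2 < k)
    (hκ : -((2 : ℝ) ^ (-(2 / 3 : ℝ)) * (M ^ 2 / (2 * L))) < κ) (hκ' : κ < 0)
    (U : ℝ → ℝ → ℝ) (E₀ : ℝ → ℝ)
    (hU : ∀ ε : ℝ, 0 < ε → VP.IsSteadyState M L k κ ε (U ε) (E₀ ε))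
    (hU_zero : ∀ r : ℝ, U 0 r = 0) (hE₀_zero : E₀ 0 = κ) :
    (VP.minEnergy M L (U 0) = -(M ^ 2 / (2 * L)) ∧
      Tendsto (fun ε => VP.minEnergy M L (U ε)) (𝓝[>] 0) (𝓝 (VP.minEnergy M L (U 0))) ∧
      Tendsto E₀ (𝓝[>] 0) (𝓝 κ)) ∧
    (∀ E ∈ Ioo (VP.minEnergy M L (U 0)) 0,
      VP.period M L (U 0) E = Real.pi * M / (Real.sqrt 2 * (-E) ^ (3 / 2 : ℝ))) ∧
    Tendsto (fun ε => VP.periodMin M L (U ε) (E₀ ε)) (𝓝[>] 0)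
      (𝓝 (VP.periodMin M L (U 0) (E₀ 0))) ∧
    Tendsto (fun ε => VP.periodMax M L (U ε) (E₀ ε)) (𝓝[>] 0)
      (𝓝 (VP.periodMax M L (U 0) (E₀ 0))) ∧
    ∃ ε₀ : ℝ, 0 < ε₀ ∧ ∃ c C : ℝ, 0 < c ∧
      ∀ ε : ℝ, 0 ≤ ε → ε < ε₀ →
        ContDiffOn ℝ 2 (VP.period M L (U ε)) (VP.actionInterval M L (U ε) (E₀ ε)) ∧
        (∀ j : ℕ, j ≤ 2 → ∀ E ∈ VP.actionInterval M L (U ε) (E₀ ε),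
          c ≤ iteratedDeriv j (VP.period M L (U ε)) E ∧
            iteratedDeriv j (VP.period M L (U ε)) E ≤ C) ∧
        StrictMonoOn (VP.period M L (U ε)) (VP.actionInterval M L (U ε) (E₀ ε)) := by
  have hp : 1 < k + 1 / 2 := by linarith
  set D : ℝ := κ + M ^ 2 / (2 * L) with hD_def
  have hD : 0 < D := by
    have h1 : (2 : ℝ) ^ (-(2 / 3 : ℝ)) ≤ 1 :=
      Real.rpow_le_one_of_one_le_of_nonpos (by norm_num) (by norm_num)
    have h2 : 0 < M ^ 2 / (2 * L) := by positivity
    nlinarith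
  have hss : ∀ ε, 0 ≤ ε → IsSteadyState M L k κ ε (U ε) (E₀ ε) := by
    intro ε hε
    rcases eq_or_lt_of_le hε with rfl | h
    · rw [hE₀_zero]; exact isSteadyState_zero hU_zero
    · exact hU ε h
  obtain ⟨c₁, B, hc₁, hB, hprof⟩ := exists_keplerProfile M L k κ hM hL hk (by linarith) hκ'
  obtain ⟨εa, hεa, hεa'⟩ := exists_pos_mul_le hc₁ zero_lt_one
  -- With B δ ≤ D/2 one gets S² = 2(κ - Pm) ≥ D, so `D` serves as the lower bound `R` for the whole
  -- family.
  obtain ⟨εb, hεb, hεb'⟩ := exists_pos_mul_le (mul_nonneg hB hc₁) (half_pos hD)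
  set ε₁ := min εa εb with hε₁_def
  have hε₁ : 0 < ε₁ := lt_min hεa hεb
  have hδB : ∀ ε, 0 ≤ ε → ε < ε₁ → B * (c₁ * ε) ≤ D / 2 := fun ε h0 h1 => by
    rw [← mul_assoc]; exact hεb' ε h0 (h1.trans_le (min_le_right _ _))
  have hchart : ∀ i : {ε : ℝ // 0 ≤ ε ∧ ε < ε₁}, ∃ (x : ℝ → ℝ) (S Pm : ℝ),
      EnergyChart M L κ (k + 1 / 2) (c₁ * i.1) B (fun u => effPot M L (U i.1) u⁻¹ - U i.1 0)
        x S Pm := by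
    rintro ⟨ε, h0, h1⟩
    obtain ⟨⟨μ, hμ⟩, -, -⟩ := hprof ε (U ε) (E₀ ε) h0 (hss ε h0)
    exact hμ.exists_chart hM hL hp (by positivity) hκ' (by linarith [hδB ε h0 h1]) (by positivity)
  choose x S Pm hch using hchart
  have hfam : ChartFamily M L κ (k + 1 / 2) B D (fun i : {ε : ℝ // 0 ≤ ε ∧ ε < ε₁} => c₁ * i.1)
      S Pm (fun i u => effPot M L (U i.1) u⁻¹ - U i.1 0) x := by
    refine ⟨hch, fun i => mul_nonneg hc₁ i.2.1, fun i => ?_, fun i => ?_⟩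
    · exact hεa' i.1 i.2.1 (i.2.2.trans_le (min_le_left _ _))
    · rw [(hch i).sq_eq]
      have h1 := (hch i).min_le
      have h2 := hδB i.1 i.2.1 i.2.2
      linarith
  have hminE : ∀ i : {ε : ℝ // 0 ≤ ε ∧ ε < ε₁}, minEnergy M L (U i.1) = Pm i + U i.1 0 :=
    fun i => (hch i).minEnergy_eq hM hκ'
  have hE₀ : ∀ i : {ε : ℝ // 0 ≤ ε ∧ ε < ε₁}, E₀ i.1 = κ + U i.1 0 := fun i => by
    linarith [(hss i.1 i.2.1).kappa_eq]
  have hU0 : ∀ i : {ε : ℝ // 0 ≤ ε ∧ ε < ε₁}, -(B * (c₁ * i.1)) ≤ U i.1 0 ∧ U i.1 0 ≤ 0 := fun i =>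
    (hprof i.1 (U i.1) (E₀ i.1) i.2.1 (hss i.1 i.2.1)).2
  have hper : ∀ i : {ε : ℝ // 0 ≤ ε ∧ ε < ε₁}, ∀ E, E - U i.1 0 ∈ Ioo (Pm i) κ →
      period M L (U i.1) E
        = chartPeriod L (k + 1 / 2) (c₁ * i.1) (S i) (Pm i) (x i) (E - U i.1 0) :=
    fun i E hE => (hch i).period_eq hM hL hκ' (hfam.nonneg i) hE
  -- The Kepler problem is a member of the family, so the uniform constants cover ε = 0 as well.
  set i₀ : {ε : ℝ // 0 ≤ ε ∧ ε < ε₁} := ⟨0, le_rfl, hε₁⟩ with hi₀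
  have hPm0 : Pm i₀ = -(M ^ 2 / (2 * L)) := by
    have h1 := (hch i₀).le_min
    have h2 := (hch i₀).min_le
    simp only [hi₀, mul_zero, add_zero] at h1 h2
    exact le_antisymm h2 h1
  have hmin0 : minEnergy M L (U 0) = -(M ^ 2 / (2 * L)) := by
    have := hminE i₀
    rw [hPm0] at this
    simpa [hi₀, hU_zero] using this
  have hlimE : Tendsto (fun ε => minEnergy M L (U ε)) (𝓝[>] 0) (𝓝 (minEnergy M L (U 0))) := by
    refine tendsto_nhdsGT_of_abs_sub_le (C := B * c₁) hε₁ fun ε hε => ?_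
    set i : {ε : ℝ // 0 ≤ ε ∧ ε < ε₁} := ⟨ε, hε.1.le, hε.2⟩
    have h1 := hminE i
    have h2 := hU0 i
    have h3 := (hch i).le_min
    have h4 := (hch i).min_le
    rw [hmin0, abs_le, mul_assoc]
    constructor <;> linarith
  have hlimE₀ : Tendsto E₀ (𝓝[>] 0) (𝓝 κ) := by
    refine tendsto_nhdsGT_of_abs_sub_le (C := B * c₁) hε₁ fun ε hε => ?_
    set i : {ε : ℝ // 0 ≤ ε ∧ ε < ε₁} := ⟨ε, hε.1.le, hε.2⟩
    have h1 := hE₀ i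
    have h2 := hU0 i
    have h3 : 0 ≤ B * (c₁ * ε) := mul_nonneg hB (mul_nonneg hc₁ hε.1.le)
    rw [abs_le, mul_assoc]
    constructor <;> linarith
  obtain ⟨T', T'', c, C, K, hc, hK, hbd⟩ := hfam.exists_period_bounds hM hL hκ' hp hD
  obtain ⟨K₁, hK₁, hcmp⟩ := hfam.exists_period_comparison hM hL hκ' hp hD hB
  have hℓ₀ : 0 < κ - minEnergy M L (U 0) := by rw [hmin0]; linarith
  have hℓ : Tendsto (fun ε => E₀ ε - minEnergy M L (U ε)) (𝓝[>] 0)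
      (𝓝 (κ - minEnergy M L (U 0))) := hlimE₀.sub hlimE
  have hη : Tendsto (fun ε : ℝ => K₁ * c₁ * ε) (𝓝[>] 0) (𝓝 0) :=
    tendsto_nhdsGT_of_abs_sub_le (C := K₁ * c₁) hε₁ fun ε hε => by
      rw [sub_zero, abs_of_nonneg (mul_nonneg (mul_nonneg hK₁ hc₁) hε.1.le)]
  -- The length of the action interval is κ - Pm, and Pm is smallest for the Kepler problem.
  have hle : ∀ᶠ ε in 𝓝[>] (0 : ℝ), E₀ ε - minEnergy M L (U ε) ≤ κ - minEnergy M L (U 0) := by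
    filter_upwards [Ioo_mem_nhdsGT hε₁] with ε hε
    have h1 := hE₀ ⟨ε, hε.1.le, hε.2⟩
    have h2 := hminE ⟨ε, hε.1.le, hε.2⟩
    have h3 := (hch ⟨ε, hε.1.le, hε.2⟩).le_min
    rw [hmin0]
    linarith
  have hg : ∀ᶠ ε in 𝓝[>] (0 : ℝ), ∀ t ∈ Ioo 0 (E₀ ε - minEnergy M L (U ε)),
      |period M L (U ε) (minEnergy M L (U ε) + t) - period M L (U 0) (minEnergy M L (U 0) + t)|
        ≤ K₁ * c₁ * ε := by
    filter_upwards [Ioo_mem_nhdsGT hε₁, hle] with ε hε hleε t ht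
    set i : {ε : ℝ // 0 ≤ ε ∧ ε < ε₁} := ⟨ε, hε.1.le, hε.2⟩
    have h1 := hE₀ i
    have h2 := hminE i
    have h5 : Pm i + t ∈ Ioo (Pm i) κ := ⟨by linarith [ht.1], by linarith [ht.2]⟩
    have h6 : Pm i + t - Pm i + Pm i₀ < κ := by rw [hPm0, ← hmin0]; linarith [ht.2]
    have h7 := hcmp i i₀ (by simp [hi₀]) (Pm i + t) h5 h6
    have h8 := hper i (minEnergy M L (U ε) + t) (by
      rw [show minEnergy M L (U ε) + t - U i.1 0 = Pm i + t by linarith]; exact h5)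
    have h9 := hper i₀ (minEnergy M L (U 0) + t) (by
      rw [show minEnergy M L (U 0) + t - U i₀.1 0 = Pm i + t - Pm i + Pm i₀ by
        rw [hPm0, hmin0, show U i₀.1 0 = 0 from hU_zero 0]; ring]
      exact ⟨by linarith [ht.1], h6⟩)
    rw [show minEnergy M L (U ε) + t - U i.1 0 = Pm i + t by linarith] at h8
    rw [show minEnergy M L (U 0) + t - U i₀.1 0 = Pm i + t - Pm i + Pm i₀ by
        rw [hPm0, hmin0, show U i₀.1 0 = 0 from hU_zero 0]; ring] at h9
    rw [show period M L (U ε) (minEnergy M L (U ε) + t) = _ from h8,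
      show period M L (U 0) (minEnergy M L (U 0) + t) = _ from h9, mul_assoc]
    exact h7
  have hbd0 : ∀ t ∈ Ioo 0 (κ - minEnergy M L (U 0)),
      c - K * (c₁ * 0) ≤ period M L (U 0) (minEnergy M L (U 0) + t) ∧
      period M L (U 0) (minEnergy M L (U 0) + t) ≤ C := by
    intro t ht
    have h1 : minEnergy M L (U 0) + t - U i₀.1 0 = Pm i₀ + t := by
      rw [hPm0, hmin0, show U i₀.1 0 = 0 from hU_zero 0]; ring
    have h2 : Pm i₀ + t ∈ Ioo (Pm i₀) κ := ⟨by linarith [ht.1], by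
      rw [hPm0, ← hmin0]; linarith [ht.2]⟩
    have h3 := hper i₀ (minEnergy M L (U 0) + t) (h1 ▸ h2)
    rw [h1] at h3
    rw [show period M L (U 0) (minEnergy M L (U 0) + t) = _ from h3]
    exact (hbd i₀ _ h2).2.1
  refine ⟨⟨hmin0, hlimE, hlimE₀⟩, fun E hE => period_zero_eq hM hL hU_zero (hmin0 ▸ hE.1) hE.2,
    ?_, ?_, ?_⟩
  · simp only [periodMin_eq_sInf_shift]
    rw [hE₀_zero]
    exact tendsto_sInf_image_Ioo hℓ₀ hℓ hη hle hg fun t ht => (hbd0 t ht).1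
  · simp only [periodMax_eq_sSup_shift]
    rw [hE₀_zero]
    exact tendsto_sSup_image_Ioo hℓ₀ hℓ hη hle hg fun t ht => (hbd0 t ht).2
  -- A last reduction of ε makes the error K δ at most c/2, leaving c/2 as the common lower bound.
  · obtain ⟨εc, hεc, hεc'⟩ := exists_pos_mul_le (mul_nonneg hK hc₁) (half_pos hc)
    refine ⟨min ε₁ εc, lt_min hε₁ hεc, c / 2, C, half_pos hc, fun ε h0 h1 => ?_⟩
    set i : {ε : ℝ // 0 ≤ ε ∧ ε < ε₁} := ⟨ε, h0, h1.trans_le (min_le_left _ _)⟩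
    have hsmall : c / 2 ≤ c - K * (c₁ * ε) := by
      have := hεc' ε h0 (h1.trans_le (min_le_right _ _))
      rw [mul_assoc] at this
      linarith
    have hI : ∀ E ∈ actionInterval M L (U ε) (E₀ ε), E - U ε 0 ∈ Ioo (Pm i) κ := by
      rintro E ⟨hE1, hE2⟩
      have k1 : minEnergy M L (U ε) = Pm i + U ε 0 := hminE i
      have k2 : E₀ ε = κ + U ε 0 := hE₀ i
      exact ⟨by linarith, by linarith⟩
    have hopen : IsOpen (actionInterval M L (U ε) (E₀ ε)) := isOpen_Ioo
    have hd1 : ∀ E ∈ actionInterval M L (U ε) (E₀ ε),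
        HasDerivAt (period M L (U ε)) (T' i (E - U ε 0)) E := by
      intro E hE
      have k1 := ((hbd i _ (hI E hE)).1.1).comp E ((hasDerivAt_id E).sub_const (U ε 0))
      rw [mul_one] at k1
      exact k1.congr_of_eventuallyEq (eventuallyEq_of_mem (hopen.mem_nhds hE) fun y hy =>
        hper i y (hI y hy))
    have hd2 : ∀ E ∈ actionInterval M L (U ε) (E₀ ε),
        HasDerivAt (fun E => T' i (E - U ε 0)) (T'' i (E - U ε 0)) E := by
      intro E hE
      have k1 := ((hbd i _ (hI E hE)).1.2.1).comp E ((hasDerivAt_id E).sub_const (U ε 0))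
      rwa [mul_one] at k1
    have hc2 : ContinuousOn (fun E => T'' i (E - U ε 0)) (actionInterval M L (U ε) (E₀ ε)) :=
      fun E hE => (ContinuousAt.comp (f := fun E => E - U ε 0) (hbd i _ (hI E hE)).1.2.2
        (by fun_prop)).continuousWithinAt
    obtain ⟨hC2, hit1, hit2⟩ := contDiffOn_two_of_hasDerivAt hopen hd1 hd2 hc2
    refine ⟨hC2, fun j hj E hE => ?_, ?_⟩
    · have hb := (hbd i _ (hI E hE)).2
      interval_cases j
      · rw [iteratedDeriv_zero, hper i E (hI E hE)]
        exact ⟨hsmall.trans hb.1.1, hb.1.2⟩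
      · rw [hit1 E hE]
        exact ⟨hsmall.trans hb.2.1.1, hb.2.1.2⟩
      · rw [hit2 E hE]
        exact ⟨hsmall.trans hb.2.2.1, hb.2.2.2⟩
    · refine strictMonoOn_of_deriv_pos (convex_Ioo _ _)
        (fun E hE => (hd1 E hE).continuousAt.continuousWithinAt) fun E hE => ?_
      rw [interior_Ioo] at hE
      rw [(hd1 E hE).deriv]
      exact lt_of_lt_of_le (half_pos hc) (hsmall.trans (hbd i _ (hI E hE)).2.2.1.1)
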